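/- Let $g\ge 0$, let $L\subset\mathbb{R}^g$ be a lattice of rank $g$, and let $X=\mathbb{R}^g/\mathbb{Z}^g$ be the tropical compact torus whose integral affine structure is given by $L$. Its tropical cosheaves $\mathbf F_p$ and $\mathbf F_p^{\mathbb Z}$ are the constant cosheaves $\wedge^p\mathbb{R}^g$ and $\wedge^pL$. Let $\mathcal C$ be any polyhedral structure on $X$ with any orientation of its cells. Let $\mathrm H_{p,q}(X,\mathbb Z)$ and $\mathrm H_{p,q}(X,\mathbb R)$ be the $q$-th homology groups of the cellular complexes with chains $\sum_P[P,v_P]$, where $P$ runs over the $q$-dimensional cells and $v_P$ is in $\wedge^pL$, respectively $\wedge^p\mathbb R^g$, and with boundary $\partial[P,v]=\sum_Q\mathrm{sgn}(P,Q)[Q,v]$. Here $Q$ runs over the codimension one faces of $P$, and $\mathrm{sgn}(P,Q)=\pm1$ compares the orientation of $Q$ with the one induced by $P$ (outward normal first). For any choice of points $o_P\in P$, one for each cell, put $$\mathrm N[P,v]=\sum_{Q}\mathrm{sgn}(P,Q)\,[Q,(o_P-o_Q)\wedge v].$$ Then $\mathrm N$ maps cycles to cycles and boundaries to boundaries, so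 it induces the monodromy operator $\mathrm N\colon \mathrm H_{p,q}(X,\mathbb R)\to\mathrm H_{p+1,q-1}(X,\mathbb R)$ for $q\geq 1$. There are isomorphisms $$\mathrm H_{p,q}(X,\mathbb Z)\cong\wedge^q\mathbb Z^g\otimes_{\mathbb Z}\wedge^pL,\qquad \mathrm H_{p,q}(X,\mathbb R)\cong\wedge^q\mathbb R^g\otimes_{\mathbb R}\wedge^p\mathbb R^g,$$ compatible with the natural maps from integral to real coefficients. The real one is the canonical isomorphism given on cycles by $[P,v]\mapsto\bigl(\int_P dx\bigr)\otimes v$, where $\int_P dx\in\wedge^q\mathbb R^g$ is the volume multivector of the oriented polytope $P$. For $q\ge1$ let $$\varphi\colon\wedge^q\mathbb Z^g\otimes_{\mathbb Z}\wedge^pL\to\wedge^{q-1}\mathbb R^g\otimes\wedge^{p+1}\mathbb R^g,\qquad u_1\wedge\cdots\wedge u_q\otimes v\mapsto\sum_{k=1}^q(-1)^k\,u_1\wedge\cdots\wedge\widehat{u_k}\wedge\cdots\wedge u_q\otimes u_k\wedge v .$$ Under these identifications, the map $\mathrm H_{p,q}(X,\mathbb Z)\to\mathrm H_{p+1,q-1}(X,\mathbb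 R)$ given by $\mathrm N$ is $\varphi$. Moreover, for $q\le p$, let $\mathrm{JH}_{p,q}(X)=\mathrm H_{p,q}(X,\mathbb R)/\mathrm{im}\bigl(\mathrm N^{p-q}\colon\mathrm H_{q,p}(X,\mathbb Z)\to\mathrm H_{p,q}(X,\mathbb R)\bigr)$ be the tropical intermediate Jacobian. The identification of $\mathrm H_{p,q}(X,\mathbb R)$ induces an isomorphism $$\mathrm{JH}_{p,q}(X)\cong\frac{\wedge^q\mathbb R^g\otimes\wedge^p\mathbb R^g}{\mathrm{im}\bigl(\varphi^{p-q}\colon\wedge^p\mathbb Z^g\otimes\wedge^qL\to\wedge^q\mathbb R^g\otimes\wedge^p\mathbb R^g\bigr)},$$ where $\varphi^{p-q}$ is formed with the $\mathbb R$-linear extension of $\varphi$. -/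

import Mathlib

open Module
open scoped TensorProduct Pointwise

noncomputable section

/-! ## Multilinear algebra -/

namespace TropTorus

/-- The exterior power `⋀^p E` of an `R`-module: Mathlib's exterior power, as a type. -/
def ExtPow (R : Type) (p : ℕ) (E : Type) [CommRing R] [AddCommGroup E] [Module R E] : Type :=
  ⋀[R]^p E

section ExtPow

variable (R : Type) (p q : ℕ) {E F : Type} [CommRing R] [AddCommGroup E] [Module R E]
  [AddCommGroup F] [Module R F]

instance : AddCommGroup (ExtPow R p E) := inferInstanceAs (AddCommGroup (⋀[R]^p E))

instance : Module R (ExtPow R p E) := inferInstanceAs (Module R (⋀[R]^p E))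

/-- The decomposable multivector `u_1 ∧ ⋯ ∧ u_p`. -/
def wedgeProd : E [⋀^Fin p]→ₗ[R] ExtPow R p E := exteriorPower.ιMulti R p

/-- The universal property of `⋀^p E`: alternating maps are linear maps on `⋀^p E`. -/
def extLift (f : E [⋀^Fin p]→ₗ[R] F) : ExtPow R p E →ₗ[R] F :=
  exteriorPower.alternatingMapLinearEquiv (R := R) (M := E) (N := F) f

theorem extLift_wedgeProd (f : E [⋀^Fin p]→ₗ[R] F) (u : Fin p → E) :
    extLift R p f (wedgeProd R p u) = f u :=
  exteriorPower.alternatingMapLinearEquiv_apply_ιMulti f u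

/-- The map `⋀^p E → ⋀^p F` induced by a linear map `E → F`. -/
def extMap (f : E →ₗ[R] F) : ExtPow R p E →ₗ[R] ExtPow R p F := exteriorPower.map p f

/-- Left exterior multiplication `v ↦ u ∧ v`, from `⋀^p E` to `⋀^(p+1) E`, linear in `u`. -/
def wedge : E →ₗ[R] ExtPow R p E →ₗ[R] ExtPow R (p + 1) E :=
  LinearMap.mk₂ R
    (fun u v => (⟨ExteriorAlgebra.ι R u * (v : ⋀[R]^p E).1, by
      change _ ∈ LinearMap.range (ExteriorAlgebra.ι R) ^ (p + 1)
      rw [pow_succ']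
      exact Submodule.mul_mem_mul (LinearMap.mem_range_self _ u) (v : ⋀[R]^p E).2⟩ :
        ⋀[R]^(p + 1) E))
    (fun u u' v => Subtype.ext ((congrArg (· * (v : ⋀[R]^p E).1)
      (map_add (ExteriorAlgebra.ι R) u u')).trans (add_mul _ _ _)))
    (fun c u v => Subtype.ext ((congrArg (· * (v : ⋀[R]^p E).1)
      (map_smul (ExteriorAlgebra.ι R) c u)).trans (smul_mul_assoc _ _ _)))
    (fun _ _ _ => Subtype.ext (mul_add _ _ _))
    (fun _ _ _ => Subtype.ext (mul_smul_comm _ _ _))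

theorem wedge_wedgeProd (u : E) (w : Fin p → E) :
    wedge R p u (wedgeProd R p w) = wedgeProd R (p + 1) (Matrix.vecCons u w) := by
  refine Subtype.ext ?_
  change ExteriorAlgebra.ι R u * ExteriorAlgebra.ιMulti R p w =
    ExteriorAlgebra.ιMulti R (p + 1) (Matrix.vecCons u w)
  rw [ExteriorAlgebra.ιMulti_succ_apply]
  simp

variable (E)

/-- The alternating map underlying `phiReal`. -/
def phiAlt : E [⋀^Fin (q + 1)]→ₗ[R] (ExtPow R p E →ₗ[R] (ExtPow R q E ⊗[R] ExtPow R (p + 1) E)) :=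
  -AlternatingMap.alternatizeUncurryFin
    ({ toFun := fun u =>
          (((TensorProduct.mk R (ExtPow R q E) (ExtPow R (p + 1) E)).compl₂
            (wedge R p u)).compAlternatingMap (wedgeProd R q))
       map_add' := fun u u' => by
          ext w v
          simp [TensorProduct.tmul_add]
       map_smul' := fun c u => by
          ext w v
          simp } :
      E →ₗ[R] E [⋀^Fin q]→ₗ[R] (ExtPow R p E →ₗ[R] (ExtPow R q E ⊗[R] ExtPow R (p + 1) E)))

/-- The map `⋀^(q+1) E ⊗ ⋀^p E → ⋀^q E ⊗ ⋀^(p+1) E` given, with indices `k = 1, …, q+1`, by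
`u_1 ∧ ⋯ ∧ u_{q+1} ⊗ v ↦ ∑_k (-1)^k u_1 ∧ ⋯ ∧ û_k ∧ ⋯ ∧ u_{q+1} ⊗ u_k ∧ v`;
see `phiReal_apply`. -/
def phiReal :
    (ExtPow R (q + 1) E ⊗[R] ExtPow R p E) →ₗ[R] (ExtPow R q E ⊗[R] ExtPow R (p + 1) E) :=
  TensorProduct.lift (extLift R (q + 1) (phiAlt R p q E))

theorem phiReal_apply (u : Fin (q + 1) → E) (v : ExtPow R p E) :
    phiReal R p q E (wedgeProd R (q + 1) u ⊗ₜ[R] v) =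
      ∑ k : Fin (q + 1), (-1 : ℤ) ^ ((k : ℕ) + 1) •
        (wedgeProd R q (k.removeNth u) ⊗ₜ[R] wedge R p (u k) v) := by
  rw [phiReal, TensorProduct.lift.tmul, extLift_wedgeProd]
  simp [phiAlt, AlternatingMap.alternatizeUncurryFin_apply, pow_succ, LinearMap.sum_apply]

end ExtPow

/-- Iterates of a family of maps `N : M p (q+1) → M (p+1) q` of a bigraded module:
`N^k : M p q → M p' q'` where `p' = p + k` and `q = q' + k`. -/
def iterate {R : Type*} [Semiring R] {M : ℕ → ℕ → Type*} [∀ p q, AddCommMonoid (M p q)]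
    [∀ p q, Module R (M p q)] (N : ∀ p q, M p (q + 1) →ₗ[R] M (p + 1) q) :
    ∀ (k : ℕ) {p q p' q' : ℕ}, p + k = p' → q' + k = q → (M p q →ₗ[R] M p' q')
  | 0, _, _, _, _, rfl, rfl => LinearMap.id
  | k + 1, p, _, _, q', hp, rfl =>
      (iterate N k (p := p + 1) (q := q' + k) (by omega) rfl).comp (N p (q' + k))

/-! ## The torus `X = ℝ^g / ℤ^g` with the integral affine structure of a lattice `L` -/

/-- The inclusion `ℤ^g ⊆ ℝ^g`. -/
def intEmb (g : ℕ) : (Fin g → ℤ) →ₗ[ℤ] (Fin g → ℝ) where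
  toFun n i := (n i : ℝ)
  map_add' m n := by ext; simp
  map_smul' c n := by ext; simp

/-- For a `ℤ`-linear map from `G` to a real vector space `E`, the map `⋀_ℤ^p G → ⋀_ℝ^p E`. -/
def extPowMap {G E : Type} [AddCommGroup G] [AddCommGroup E] [Module ℝ E]
    (f : G →ₗ[ℤ] E) (p : ℕ) : ExtPow ℤ p G →+ ExtPow ℝ p E :=
  (extLift (F := ExtPow ℝ p E) ℤ p
    { ((wedgeProd ℝ p (E := E)).toMultilinearMap.restrictScalars ℤ).compLinearMap
        (fun _ => f) with
      map_eq_zero_of_eq' := fun v _ _ h hij =>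
        (wedgeProd ℝ p (E := E)).map_eq_zero_of_eq (fun i => f (v i))
          (congrArg f h) hij }).toAddMonoidHom

theorem extPowMap_wedgeProd {G E : Type} [AddCommGroup G] [AddCommGroup E] [Module ℝ E]
    (f : G →ₗ[ℤ] E) (p : ℕ) (w : Fin p → G) :
    extPowMap f p (wedgeProd ℤ p w) = wedgeProd ℝ p (fun i => f (w i)) :=
  extLift_wedgeProd _ _ _ _

/-- The natural map `⋀^q ℤ^g ⊗_ℤ ⋀^p L → ⋀^q ℝ^g ⊗_ℝ ⋀^p ℝ^g`. -/
def tensorToReal {g : ℕ} (L : Submodule ℤ (Fin g → ℝ)) (p q : ℕ) :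
    (ExtPow ℤ q (Fin g → ℤ) ⊗[ℤ] ExtPow ℤ p L) →+
      (ExtPow ℝ q (Fin g → ℝ) ⊗[ℝ] ExtPow ℝ p (Fin g → ℝ)) :=
  TensorProduct.liftAddHom
    (AddMonoidHom.mk' (fun x =>
      ((TensorProduct.mk ℝ _ _ (extPowMap (intEmb g) q x)).toAddMonoidHom.comp
        (extPowMap L.subtype p))) (fun x x' => by ext y; simp))
    (fun c x y => by
      change extPowMap (intEmb g) q (c • x) ⊗ₜ[ℝ] extPowMap L.subtype p y =
        extPowMap (intEmb g) q x ⊗ₜ[ℝ] extPowMap L.subtype p (c • y)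
      rw [map_zsmul, map_zsmul, ← Int.cast_smul_eq_zsmul ℝ, ← Int.cast_smul_eq_zsmul ℝ,
        TensorProduct.smul_tmul])

/-- The map `φ^k : ⋀^q ℤ^g ⊗ ⋀^p L → ⋀^q' ℝ^g ⊗ ⋀^p' ℝ^g`, where `p' = p + k`, `q = q' + k`. -/
def phiIter {g : ℕ} (L : Submodule ℤ (Fin g → ℝ)) (k : ℕ) {p q p' q' : ℕ}
    (hp : p + k = p') (hq : q' + k = q) :
    (ExtPow ℤ q (Fin g → ℤ) ⊗[ℤ] ExtPow ℤ p L) →+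
      (ExtPow ℝ q' (Fin g → ℝ) ⊗[ℝ] ExtPow ℝ p' (Fin g → ℝ)) :=
  (iterate (R := ℝ) (M := fun p q => ExtPow ℝ q (Fin g → ℝ) ⊗[ℝ] ExtPow ℝ p (Fin g → ℝ))
    (fun p q => phiReal ℝ p q (Fin g → ℝ)) k hp hq).toAddMonoidHom.comp (tensorToReal L p q)

/-- The map `φ : ⋀^(q+1) ℤ^g ⊗ ⋀^p L → ⋀^q ℝ^g ⊗ ⋀^(p+1) ℝ^g`. -/
def phi {g : ℕ} (L : Submodule ℤ (Fin g → ℝ)) (p q : ℕ) :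
    (ExtPow ℤ (q + 1) (Fin g → ℤ) ⊗[ℤ] ExtPow ℤ p L) →+
      (ExtPow ℝ q (Fin g → ℝ) ⊗[ℝ] ExtPow ℝ (p + 1) (Fin g → ℝ)) :=
  (phiReal ℝ p q (Fin g → ℝ)).toAddMonoidHom.comp (tensorToReal L p (q + 1))

/-- The defining formula of `φ`. -/
theorem phi_apply {g : ℕ} (L : Submodule ℤ (Fin g → ℝ)) (p q : ℕ)
    (u : Fin (q + 1) → Fin g → ℤ) (v : ExtPow ℤ p L) :
    phi L p q (wedgeProd ℤ (q + 1) u ⊗ₜ[ℤ] v) =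
      ∑ k : Fin (q + 1), (-1 : ℤ) ^ ((k : ℕ) + 1) •
        (wedgeProd ℝ q (k.removeNth fun i => intEmb g (u i)) ⊗ₜ[ℝ]
          wedge ℝ p (intEmb g (u k)) (extPowMap L.subtype p v)) := by
  rw [← phiReal_apply, ← extPowMap_wedgeProd]
  rfl

/-! ## Polyhedral structures on `X` -/

/-- A polyhedral structure on `X = ℝ^g / ℤ^g`, described by the collection of all lifts of its
cells to the universal cover `ℝ^g`: a locally finite `ℤ^g`-invariant collection of nonempty
polytopes that cover `ℝ^g`, closed under passing to nonempty faces, in which two polytopes meet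
(if at all) along a common face, and each of which is embedded in `X`. -/
structure PolyhedralStructure (g : ℕ) where
  lifts : Set (Set (Fin g → ℝ))
  polytope : ∀ P ∈ lifts, ∃ s : Finset (Fin g → ℝ), s.Nonempty ∧ P = convexHull ℝ (s : Set _)
  face_mem : ∀ P ∈ lifts, ∀ F : Set (Fin g → ℝ), F.Nonempty → IsExposed ℝ P F → F ∈ lifts
  inter : ∀ P ∈ lifts, ∀ Q ∈ lifts, (P ∩ Q).Nonempty →
    IsExposed ℝ P (P ∩ Q) ∧ IsExposed ℝ Q (P ∩ Q)
  vadd_mem : ∀ P ∈ lifts, ∀ n : Fin g → ℤ, intEmb g n +ᵥ P ∈ lifts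
  cover : ∀ x, ∃ P ∈ lifts, x ∈ P
  locallyFinite : LocallyFinite (fun P : lifts => (P : Set (Fin g → ℝ)))
  embedded : ∀ P ∈ lifts, ∀ x ∈ P, ∀ n : Fin g → ℤ, intEmb g n + x ∈ P → n = 0

namespace PolyhedralStructure

variable {g : ℕ} (C : PolyhedralStructure g)

/-- The lifts to `ℝ^g` of the `q`-dimensional cells. -/
def Lift (q : ℕ) : Type :=
  {P : Set (Fin g → ℝ) // P ∈ C.lifts ∧ finrank ℝ (vectorSpan ℝ P) = q}

instance (q : ℕ) : AddAction (Fin g → ℤ) (C.Lift q) where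
  vadd n P := ⟨intEmb g n +ᵥ P.1, C.vadd_mem _ P.2.1 n, by rw [vectorSpan_vadd]; exact P.2.2⟩
  zero_vadd P := Subtype.ext (by
    change intEmb g 0 +ᵥ P.1 = P.1
    rw [map_zero, zero_vadd])
  add_vadd m n P := Subtype.ext (by
    change intEmb g (m + n) +ᵥ P.1 = intEmb g m +ᵥ (intEmb g n +ᵥ P.1)
    rw [map_add, add_vadd])

/-- The `q`-dimensional cells of `X`. -/
def Cell (q : ℕ) : Type := AddAction.orbitRel.Quotient (Fin g → ℤ) (C.Lift q)

/-- The cell of `X` with a given lift. -/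
def toCell {q : ℕ} (P : C.Lift q) : C.Cell q := Quotient.mk _ P

/-- A lift of a cell. -/
def someLift {q : ℕ} (P : C.Cell q) : C.Lift q := Quotient.out P

/-- The codimension one faces of a lifted cell. A lifted cell is a face of another one as soon as
it is contained in it. -/
def Facet {q : ℕ} (P : C.Lift (q + 1)) : Type := {Q : C.Lift q // Q.1 ⊆ P.1}

instance {q : ℕ} (P : C.Lift (q + 1)) : Finite (C.Facet P) := by
  obtain ⟨s, -, hs⟩ := C.polytope P.1 P.2.1
  have hc : IsCompact P.1 := by
    rw [hs]
    exact s.finite_toSet.isCompact_convexHull ℝ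
  have hf := C.locallyFinite.finite_nonempty_inter_compact hc
  have : Finite {i : C.lifts | ((i : Set (Fin g → ℝ)) ∩ P.1).Nonempty} := hf.to_subtype
  refine Finite.of_injective
    (fun Q : C.Facet P => (⟨⟨Q.1.1, Q.1.2.1⟩, ?_⟩ :
      {i : C.lifts | ((i : Set (Fin g → ℝ)) ∩ P.1).Nonempty})) ?_
  · obtain ⟨t, ht, hQ⟩ := C.polytope Q.1.1 Q.1.2.1
    have hne : Q.1.1.Nonempty := by
      rw [hQ]
      exact (convexHull_nonempty_iff).2 (by exact_mod_cast ht)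
    change (Q.1.1 ∩ P.1).Nonempty
    rwa [Set.inter_eq_left.2 Q.2]
  · intro Q Q' h
    have h' : Q.1.1 = Q'.1.1 := by simpa using h
    exact Subtype.ext (Subtype.ext h')

/-- An orientation of every cell: a generator `vec P` of the half-line in `⋀^q T_P ⊆ ⋀^q ℝ^g`
that orients `P`, where `T_P` is the tangent space of `P`. -/
structure Orientation where
  vec : ∀ {q : ℕ}, C.Lift q → ExtPow ℝ q (Fin g → ℝ)
  vec_ne_zero : ∀ {q : ℕ} (P : C.Lift q), vec P ≠ 0
  vec_mem : ∀ {q : ℕ} (P : C.Lift q),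
    vec P ∈ LinearMap.range (extMap ℝ q (vectorSpan ℝ P.1).subtype)
  vec_vadd : ∀ {q : ℕ} (n : Fin g → ℤ) (P : C.Lift q), vec (n +ᵥ P) = vec P

/-- A marking: a point in every cell. -/
structure Marking where
  pt : ∀ {q : ℕ}, C.Lift q → (Fin g → ℝ)
  pt_mem : ∀ {q : ℕ} (P : C.Lift q), pt P ∈ P.1
  pt_vadd : ∀ {q : ℕ} (n : Fin g → ℤ) (P : C.Lift q), pt (n +ᵥ P) = intEmb g n + pt P

variable {C}

open Classical in
/-- The sign of a facet `Q` of `P`: it is `1` if the orientation that `P` induces on `Q` (outward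
normal vector first) is the orientation of `Q`, and `-1` otherwise. -/
def Orientation.sgn (o : C.Orientation) {q : ℕ} (P : C.Lift (q + 1)) (Q : C.Lift q) : ℤ :=
  if ∃ x ∈ Q.1, ∃ y ∈ P.1 \ Q.1, ∃ c : ℝ, 0 < c ∧ wedge ℝ q (x - y) (o.vec Q) = c • o.vec P
  then 1 else -1

/-! ## Tropical homology -/

section Homology

variable (o : C.Orientation) (R : Type) (A : Type) [CommRing R] [AddCommGroup A] [Module R A]

/-- The boundary map on cellular chains with coefficients in the constant cosheaf `A`,
`∂ [P, v] = ∑_Q sgn(P, Q) [Q, v]`. -/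
def boundary (q : ℕ) : (C.Cell (q + 1) →₀ A) →ₗ[R] (C.Cell q →₀ A) :=
  Finsupp.lsum R fun P => ∑ᶠ Q : C.Facet (C.someLift P),
    o.sgn (C.someLift P) Q.1 • Finsupp.lsingle (C.toCell Q.1)

/-- Cycles. -/
def cycles : ∀ q : ℕ, Submodule R (C.Cell q →₀ A)
  | 0 => ⊤
  | q + 1 => LinearMap.ker (boundary o R A q)

/-- Boundaries. -/
def boundaries (q : ℕ) : Submodule R (C.Cell q →₀ A) := LinearMap.range (boundary o R A q)

/-- Cellular homology with coefficients in the constant cosheaf `A`. -/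
def Homology (q : ℕ) : Type :=
  cycles o R A q ⧸ (boundaries o R A q).submoduleOf (cycles o R A q)

instance (q : ℕ) : AddCommGroup (Homology o R A q) :=
  inferInstanceAs (AddCommGroup (cycles o R A q ⧸ (boundaries o R A q).submoduleOf (cycles o R A q)))

instance (q : ℕ) : Module R (Homology o R A q) :=
  inferInstanceAs (Module R (cycles o R A q ⧸ (boundaries o R A q).submoduleOf (cycles o R A q)))

/-- The class of a cycle. -/
def cls (q : ℕ) : cycles o R A q →ₗ[R] Homology o R A q :=
  ((boundaries o R A q).submoduleOf (cycles o R A q)).mkQ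

end Homology

/-- The tropical homology `H_{p,q}(X, ℤ)`: the cosheaf `F_p^ℤ` is constant with value `⋀^p L`. -/
abbrev HZ (o : C.Orientation) (L : Submodule ℤ (Fin g → ℝ)) (p q : ℕ) : Type :=
  Homology o ℤ (ExtPow ℤ p L) q

/-- The tropical homology `H_{p,q}(X, ℝ)`: the cosheaf `F_p` is constant with value `⋀^p ℝ^g`. -/
abbrev HR (o : C.Orientation) (p q : ℕ) : Type :=
  Homology o ℝ (ExtPow ℝ p (Fin g → ℝ)) q

section CoefficientChange

variable (o : C.Orientation) (L : Submodule ℤ (Fin g → ℝ)) (p : ℕ)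

/-- The inclusion of integral chains in real chains. -/
def chainToReal (q : ℕ) :
    (C.Cell q →₀ ExtPow ℤ p L) →+ (C.Cell q →₀ ExtPow ℝ p (Fin g → ℝ)) :=
  Finsupp.mapRange.addMonoidHom (extPowMap L.subtype p)

theorem boundary_single (R A : Type) [CommRing R] [AddCommGroup A] [Module R A] (q : ℕ)
    (P : C.Cell (q + 1)) (a : A) :
    boundary o R A q (Finsupp.single P a) = ∑ᶠ Q : C.Facet (C.someLift P),
      o.sgn (C.someLift P) Q.1 • Finsupp.single (C.toCell Q.1) a := by
  have := Fintype.ofFinite (C.Facet (C.someLift P))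
  rw [boundary, Finsupp.lsum_single, finsum_eq_sum_of_fintype, finsum_eq_sum_of_fintype,
    LinearMap.sum_apply]
  refine Finset.sum_congr rfl fun Q _ => ?_
  rfl

theorem boundary_chainToReal (q : ℕ) (c : C.Cell (q + 1) →₀ ExtPow ℤ p L) :
    boundary o ℝ (ExtPow ℝ p (Fin g → ℝ)) q (chainToReal L p (q + 1) c) =
      chainToReal L p q (boundary o ℤ (ExtPow ℤ p L) q c) := by
  induction c using Finsupp.induction_linear with
  | zero => simp
  | add a b ha hb => simp only [map_add, ha, hb]
  | single P a =>
    have := Fintype.ofFinite (C.Facet (C.someLift P))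
    have h : chainToReal L p (q + 1) (Finsupp.single P a) =
        Finsupp.single P (extPowMap L.subtype p a) := by simp [chainToReal]
    rw [h, boundary_single, boundary_single, finsum_eq_sum_of_fintype, finsum_eq_sum_of_fintype,
      map_sum]
    refine Finset.sum_congr rfl fun Q _ => ?_
    refine Eq.trans ?_ (map_zsmul (chainToReal L p q) _ _).symm
    congr 1
    simp [chainToReal]

theorem chainToReal_mem_cycles (q : ℕ) (c : C.Cell q →₀ ExtPow ℤ p L)
    (hc : c ∈ cycles o ℤ (ExtPow ℤ p L) q) :
    chainToReal L p q c ∈ cycles o ℝ (ExtPow ℝ p (Fin g → ℝ)) q := by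
  cases q with
  | zero => exact Submodule.mem_top
  | succ q =>
    have hc' : boundary o ℤ (ExtPow ℤ p L) q c = 0 := hc
    change boundary o ℝ _ q _ = 0
    rw [boundary_chainToReal, hc', map_zero]

/-- The natural map `H_{p,q}(X, ℤ) → H_{p,q}(X, ℝ)`. -/
def toReal (q : ℕ) : HZ o L p q →+ HR o p q :=
  QuotientAddGroup.lift ((boundaries o ℤ (ExtPow ℤ p L) q).submoduleOf
      (cycles o ℤ (ExtPow ℤ p L) q)).toAddSubgroup
    (AddMonoidHom.mk' (fun c => cls o ℝ (ExtPow ℝ p (Fin g → ℝ)) q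
        ⟨chainToReal L p q c.1, chainToReal_mem_cycles o L p q c.1 c.2⟩)
      (fun a b => by
        rw [← map_add]
        congr 1
        exact Subtype.ext (map_add _ _ _)))
    (by
      rintro ⟨c, hc⟩ ⟨b, hb⟩
      refine (Submodule.Quotient.mk_eq_zero _).2 ⟨chainToReal L p (q + 1) b, ?_⟩
      rw [boundary_chainToReal, hb]
      rfl)

/-- The map on homology is induced by the inclusion of chains. -/
theorem toReal_cls (q : ℕ) (z : cycles o ℤ (ExtPow ℤ p L) q) :
    toReal o L p q (cls o ℤ (ExtPow ℤ p L) q z) = cls o ℝ (ExtPow ℝ p (Fin g → ℝ)) q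
      ⟨chainToReal L p q z.1, chainToReal_mem_cycles o L p q z.1 z.2⟩ := rfl

end CoefficientChange

/-! ## The monodromy operator and intermediate Jacobians -/

section Monodromy

variable (o : C.Orientation) (m : C.Marking)

/-- The monodromy operator on chains,
`N [P, v] = ∑_Q sgn(P, Q) [Q, (o_P - o_Q) ∧ v]`. -/
def chainN (p q : ℕ) :
    (C.Cell (q + 1) →₀ ExtPow ℝ p (Fin g → ℝ)) →ₗ[ℝ] (C.Cell q →₀ ExtPow ℝ (p + 1) (Fin g → ℝ)) :=
  Finsupp.lsum ℝ fun P => ∑ᶠ Q : C.Facet (C.someLift P),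
    o.sgn (C.someLift P) Q.1 • (Finsupp.lsingle (C.toCell Q.1)).comp
      (wedge ℝ p (m.pt (C.someLift P) - m.pt Q.1))

/-- The operator `N` on chains maps cycles to cycles and boundaries to boundaries, so that it
induces a map in homology. -/
def Descends (p q : ℕ) : Prop :=
  (∀ z ∈ cycles o ℝ (ExtPow ℝ p (Fin g → ℝ)) (q + 1),
    chainN o m p q z ∈ cycles o ℝ (ExtPow ℝ (p + 1) (Fin g → ℝ)) q) ∧
  (∀ b ∈ boundaries o ℝ (ExtPow ℝ p (Fin g → ℝ)) (q + 1),
    chainN o m p q b ∈ boundaries o ℝ (ExtPow ℝ (p + 1) (Fin g → ℝ)) q)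

open Classical in
/-- The monodromy operator `N : H_{p,q+1}(X, ℝ) → H_{p+1,q}(X, ℝ)` induced by the operator on
chains. (The value `0` stands in if `Descends` fails, which the theorem rules out.) -/
def N (p q : ℕ) : HR o p (q + 1) →ₗ[ℝ] HR o (p + 1) q :=
  if h : Descends o m p q then
    Submodule.mapQ _ _ ((chainN o m p q).restrict h.1) (fun z hz => h.2 z hz)
  else 0

/-- The group `L_{p,q}(X)`, the image of `N^k : H_{q,p}(X, ℤ) → H_{p,q}(X, ℝ)`, `k = p - q`. -/
def latticeL (L : Submodule ℤ (Fin g → ℝ)) {p q k : ℕ} (h : q + k = p) : AddSubgroup (HR o p q) :=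
  ((iterate (R := ℝ) (M := fun p q => HR o p q) (N o m) k h h).toAddMonoidHom.comp
    (toReal o L q p)).range

/-- The tropical intermediate Jacobian `JH_{p,q}(X) = H_{p,q}(X, ℝ) / L_{p,q}(X)`. -/
abbrev JH (L : Submodule ℤ (Fin g → ℝ)) {p q k : ℕ} (h : q + k = p) : Type :=
  HR o p q ⧸ latticeL o m L h

open Classical in
/-- The volume multivector `∫_P dx ∈ ⋀^q ℝ^g` of an oriented polytope `P`, that is, the unit
multivector of the orientation times the `q`-dimensional volume. It is `±1` for a point; a
polytope of dimension `q + 1` is cut into the pyramids over its facets `Q` with apex `o_P`, and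
the multivector of such a pyramid is `(q+1)⁻¹ (x - o_P) ∧ vol(Q)` for any `x ∈ Q`. -/
def vol : ∀ {q : ℕ}, C.Lift q → ExtPow ℝ q (Fin g → ℝ)
  | 0, P =>
      if ∃ c : ℝ, 0 < c ∧ o.vec P = c • wedgeProd ℝ 0 ![]
      then wedgeProd ℝ 0 ![] else -wedgeProd ℝ 0 ![]
  | q + 1, P => ((q : ℝ) + 1)⁻¹ • ∑ᶠ Q : C.Facet P,
      o.sgn P Q.1 • wedge ℝ q (m.pt Q.1 - m.pt P) (vol Q.1)

/-- The period of a real chain, `[P, v] ↦ (∫_P dx) ⊗ v`. It induces the canonical identification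
of `H_q(X, A)` with `⋀^q ℝ^g ⊗ A`: integration of constant differential forms over cycles. -/
def period (p q : ℕ) : (C.Cell q →₀ ExtPow ℝ p (Fin g → ℝ)) →ₗ[ℝ]
    (ExtPow ℝ q (Fin g → ℝ) ⊗[ℝ] ExtPow ℝ p (Fin g → ℝ)) :=
  Finsupp.lsum ℝ fun P => TensorProduct.mk ℝ _ _ (vol o m (C.someLift P))

end Monodromy

end PolyhedralStructure

end TropTorus

end

namespace TropTorus

noncomputable section

/-! ## Chains on finite lists and the nerve of a convex covering -/

section ListChains

variable {I X : Type} [AddCommGroup X]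

/-! The lifts of the cells cut `ℝ^g` into polytopes, and `ℤ^g` acts freely on the resulting cellular
complex. The proof computes the homology of the quotient from three facts.

The augmented cellular complex of the universal cover is exact (`exactOn_lifts`). A double complex
argument (`exactOn_of_bicomplex`, `exactOn_of_nerve`) reduces this to the faces of a single polytope
together with the acyclicity of a nerve, which is a nerve theorem for convex sets (`acycL_nerve`). A
polytope `P` is treated by induction on its dimension. Seen from a point just beyond a facet `Q`,
the other proper faces form the far side of `P`, and central projection turns them into a covering
of a convex set by convex sets (`acycL_others`). Attaching `Q` and then `P` to this acyclic complex
keeps it acyclic (`exactOn_faces_succ`).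

The homology of the torus is read off by iterated periods. Choose equivariantly a position for every
lifted cell, and let `del j` be the commutator of the boundary with multiplication by the `j`-th
coordinate of the position. It commutes with translations and anticommutes with the boundary, so
applying several `del j` and then the augmentation gives translation invariant functionals that
vanish on boundaries. Dividing out the translations one direction at a time, as in the Wang sequence
of a circle, shows that these functionals, indexed by increasing multi-indices, identify the
homology with tuples of coefficients (`per_bijective_aux`, `homPer_bijective`). This works over any
ring. Integral positions (`coordPosition`) give the integral and the real isomorphism at once, and
their compatibility (`realIso_toReal`).

On cycles the periods do not depend on the positions (`per_eq_per`), so over `ℝ` the marked points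
may be used. With these, the volume multivector satisfies a recursion in the `del j` (`volL_succ`),
and contracting it with the `j`-th coordinate form amounts, up to sign, to applying `del j` first
(`contrT_volL`). Hence the coordinates of the period of a cycle are its iterated periods
(`thetaT_volL`), and the isomorphism is the canonical one (`realIso_cls`). Finally `N` is `∑ e_j ∧
del j`, while `φ` is `-∑ contr_j ⊗ (e_j ∧ ·)` (`phiReal_eq_sum`). The same contraction formula
matches the two (`period_chainN`), and the statement on Jacobians is transport of structure
(`map_latticeL`). -/

/-- Prepending `i` to all lists of a chain. -/
def coneL (i : I) : (List I →₀ X) →+ (List I →₀ X) :=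
  Finsupp.mapDomain.addMonoidHom (List.cons i)

@[simp] theorem coneL_single (i : I) (s : List I) (x : X) :
    coneL i (Finsupp.single s x) = Finsupp.single (i :: s) x := by
  simp [coneL]

/-- The simplicial boundary of a list. -/
def bdL : List I → X →+ (List I →₀ X)
  | [] => 0
  | i :: s => Finsupp.singleAddHom s - (coneL i).comp (bdL s)

/-- The augmented simplicial boundary operator on chains of lists. -/
def dL : (List I →₀ X) →+ (List I →₀ X) := Finsupp.liftAddHom bdL

@[simp] theorem dL_single (s : List I) (x : X) : dL (Finsupp.single s x) = bdL s x := by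
  simp [dL]

/-- Coning with a fixed vertex is a contracting homotopy. The empty list, in degree `-1`, makes the
formula hold without exception. -/
theorem dL_coneL (i : I) (z : List I →₀ X) : dL (coneL i z) = z - coneL i (dL z) := by
  induction z using Finsupp.induction_linear with
  | zero => simp
  | add a b ha hb => simp only [map_add, ha, hb]; abel
  | single s x => simp [bdL]

theorem dL_dL (z : List I →₀ X) : dL (dL z) = 0 := by
  induction z using Finsupp.induction_linear with
  | zero => simp
  | add a b ha hb => simp only [map_add, ha, hb, add_zero]
  | single s x =>
    induction s with
    | nil => simp [bdL]
    | cons i s ih =>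
      rw [← coneL_single, dL_coneL, map_sub, dL_coneL, ih]
      simp

/-- Chains whose coefficient at a list `s` lies in `S s`. -/
def listSub (S : List I → AddSubgroup X) : AddSubgroup (List I →₀ X) where
  carrier := {z | ∀ s, z s ∈ S s}
  zero_mem' s := by simp
  add_mem' ha hb s := by simpa using add_mem (ha s) (hb s)
  neg_mem' ha s := by simpa using ha s

theorem single_mem_listSub {S : List I → AddSubgroup X} {s : List I} {x : X} (h : x ∈ S s) :
    Finsupp.single s x ∈ listSub S := by
  classical
  intro t
  rw [Finsupp.single_apply]
  split_ifs with h'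
  · exact h' ▸ h
  · exact zero_mem _

theorem map_mem_of_mem_listSub {Y : Type} [AddCommGroup Y] {S : List I → AddSubgroup X}
    (f : (List I →₀ X) →+ Y) (N : AddSubgroup Y)
    (h : ∀ s, ∀ x ∈ S s, f (Finsupp.single s x) ∈ N) {z : List I →₀ X} (hz : z ∈ listSub S) :
    f z ∈ N := by
  rw [← z.sum_single, Finsupp.sum, map_sum]
  exact sum_mem fun s _ => h s _ (hz s)

theorem coneL_mem {S : List I → AddSubgroup X} (i : I) {z : List I →₀ X}
    (hz : z ∈ listSub fun s => S (i :: s)) : coneL i z ∈ listSub S :=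
  map_mem_of_mem_listSub _ _ (fun s x hx => by
    rw [coneL_single]; exact single_mem_listSub hx) hz

/-- The family `S` is quantified after `s` because the induction passes to the shifted family `t ↦ S
(i :: t)`. -/
theorem bdL_mem (s : List I) (x : X) :
    ∀ (S : List I → AddSubgroup X), (∀ t ⊆ s, x ∈ S t) → bdL s x ∈ listSub S := by
  induction s with
  | nil => intro S _; exact zero_mem _
  | cons i s ih =>
    intro S h
    exact sub_mem (single_mem_listSub (h s (List.subset_cons_self _ _)))
      (coneL_mem i (ih _ fun t ht => h _ (List.cons_subset_cons i ht)))

theorem dL_mem {S : List I → AddSubgroup X} (hS : ∀ s t, t ⊆ s → S s ≤ S t) {z : List I →₀ X}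
    (hz : z ∈ listSub S) : dL z ∈ listSub S :=
  map_mem_of_mem_listSub _ _ (fun s x hx => by
    rw [dL_single]; exact bdL_mem s x S fun t ht => hS s t ht hx) hz

variable (X) in
/-- The subgroup that is everything if `p` holds and zero otherwise. -/
def condSub (p : Prop) : AddSubgroup X where
  carrier := {x | x ≠ 0 → p}
  zero_mem' h := absurd rfl h
  add_mem' {a b} ha hb h := by
    by_cases h' : a = 0
    · exact hb fun h'' => h (by simp [h', h''])
    · exact ha h'
  neg_mem' ha h := ha fun h' => h (by simp [h'])

theorem condSub_mono {p q : Prop} (h : p → q) : condSub X p ≤ condSub X q :=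
  fun _ hx h0 => h (hx h0)

variable (X) in
/-- Exactness of the augmented complex of chains on lists with the property `p`. -/
def AcycL (p : List I → Prop) : Prop :=
  ∀ z ∈ listSub (fun s => condSub X (p s)), dL z = 0 →
    ∃ w ∈ listSub (fun s => condSub X (p s)), dL w = z

theorem acycL_of_false {p : List I → Prop} (h : ∀ s, ¬ p s) : AcycL X p := by
  intro z hz _
  refine ⟨0, zero_mem _, ?_⟩
  ext s
  by_contra hs
  exact h s (hz s fun h' => hs (by simp [h']))

theorem acycL_of_cone {p : List I → Prop} (i : I) (h : ∀ s, p s → p (i :: s)) : AcycL X p := by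
  intro z hz hd
  refine ⟨coneL i z, coneL_mem i fun s => condSub_mono (h s) (hz s), ?_⟩
  rw [dL_coneL, hd, map_zero, sub_zero]

/-- Mayer–Vietoris, with `p₃` the intersection of `p₁` and `p₂`. The part `z₁` of a cycle lying in
`p₁` has its boundary in the intersection, where some `w` fills it. Then `z₁ - w` and `z - z₁ + w`
are cycles, one on each side. -/
theorem AcycL.union {p p₁ p₂ p₃ : List I → Prop} (a₁ : AcycL X p₁) (a₂ : AcycL X p₂)
    (a₃ : AcycL X p₃) (h : ∀ s, p s → p₁ s ∨ p₂ s) (h₁ : ∀ s, p₁ s → p s) (h₂ : ∀ s, p₂ s → p s)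
    (h₁₂ : ∀ s, p₁ s → p₂ s → p₃ s) (h₃₁ : ∀ s, p₃ s → p₁ s) (h₃₂ : ∀ s, p₃ s → p₂ s)
    (m₁ : ∀ s t, t ⊆ s → p₁ s → p₁ t) (m₂ : ∀ s t, t ⊆ s → p₂ s → p₂ t) : AcycL X p := by
  classical
  intro z hz hd
  set z₁ := z.filter p₁ with hz₁
  have hm₁ : z₁ ∈ listSub (fun s => condSub X (p₁ s)) := by
    intro s h0
    by_contra hn
    exact h0 (Finsupp.filter_apply_neg _ _ hn)
  have hm₂ : z - z₁ ∈ listSub (fun s => condSub X (p₂ s)) := by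
    intro s h0
    by_cases hp : p₁ s
    · exact absurd (by simp [hz₁, hp]) h0
    · refine (h s (hz s fun h' => h0 ?_)).resolve_left hp
      simp [hz₁, hp, h']
  have hd₁ : dL z₁ ∈ listSub (fun s => condSub X (p₁ s)) :=
    dL_mem (fun s t hst => condSub_mono (m₁ s t hst)) hm₁
  have hd₂ : dL z₁ ∈ listSub (fun s => condSub X (p₂ s)) := by
    have h' := dL_mem (fun s t hst => condSub_mono (m₂ s t hst)) hm₂
    rw [map_sub, hd, zero_sub] at h'
    exact neg_mem_iff.1 h'
  obtain ⟨w, hw, hwd⟩ := a₃ (dL z₁) (fun s h0 => h₁₂ s (hd₁ s h0) (hd₂ s h0)) (dL_dL _)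
  obtain ⟨w₁, hw₁, hwd₁⟩ := a₁ (z₁ - w)
    (sub_mem hm₁ fun s => condSub_mono (h₃₁ s) (hw s)) (by rw [map_sub, hwd, sub_self])
  obtain ⟨w₂, hw₂, hwd₂⟩ := a₂ (z - z₁ + w)
    (add_mem hm₂ fun s => condSub_mono (h₃₂ s) (hw s))
    (by rw [map_add, map_sub, hwd, hd]; abel)
  refine ⟨w₁ + w₂, add_mem (fun s => condSub_mono (h₁ s) (hw₁ s))
    (fun s => condSub_mono (h₂ s) (hw₂ s)), ?_⟩
  rw [map_add, hwd₁, hwd₂]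
  abel

end ListChains

/-! ### The nerve theorem for convex sets -/

section Nerve

variable {I X : Type} [AddCommGroup X] {n : ℕ} (K : I → Set (Fin n → ℝ))

/-- The simplices of the nerve of the sets `B ∩ K i`. -/
def InNerve (B : Set (Fin n → ℝ)) (s : List I) : Prop := ∃ x ∈ B, ∀ i ∈ s, x ∈ K i

variable {K}

theorem InNerve.anti {B : Set (Fin n → ℝ)} (s t : List I) (h : t ⊆ s) :
    InNerve K B s → InNerve K B t :=
  fun ⟨x, hx, hs⟩ => ⟨x, hx, fun i hi => hs i (h hi)⟩

theorem InNerve.mono {B B' : Set (Fin n → ℝ)} (h : B ⊆ B') (s : List I) :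
    InNerve K B s → InNerve K B' s :=
  fun ⟨x, hx, hs⟩ => ⟨x, h hx, hs⟩

/-- Mayer–Vietoris for a cut by a hyperplane. A simplex seen on both sides has a common point on
each, and by convexity the segment between them gives a common point on the hyperplane. -/
theorem acycL_split (hK : ∀ i, Convex ℝ (K i)) {B : Set (Fin n → ℝ)} (hB : Convex ℝ B)
    (j : Fin n) (c : ℝ) (h₁ : AcycL X (InNerve K (B ∩ {x | x j ≤ c})))
    (h₂ : AcycL X (InNerve K (B ∩ {x | c ≤ x j})))
    (h₃ : AcycL X (InNerve K (B ∩ {x | x j = c}))) : AcycL X (InNerve K B) := by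
  refine h₁.union h₂ h₃ ?_ (InNerve.mono Set.inter_subset_left)
    (InNerve.mono Set.inter_subset_left) ?_
    (InNerve.mono (Set.inter_subset_inter_right _ fun x hx => le_of_eq hx))
    (InNerve.mono (Set.inter_subset_inter_right _ fun x hx => ge_of_eq hx))
    InNerve.anti InNerve.anti
  · rintro s ⟨x, hx, hs⟩
    rcases le_total (x j) c with h | h
    · exact Or.inl ⟨x, ⟨hx, h⟩, hs⟩
    · exact Or.inr ⟨x, ⟨hx, h⟩, hs⟩
  · rintro s ⟨x, ⟨hx, hxc⟩, hs⟩ ⟨y, ⟨hy, hyc⟩, hs'⟩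
    rw [Set.mem_ofPred_eq] at hxc hyc
    obtain ⟨z, hz, hzc⟩ : ∃ z ∈ segment ℝ x y, z j = c := by
      have hc : c ∈ segment ℝ (x j) (y j) := by
        rw [segment_eq_Icc (hxc.trans hyc)]; exact ⟨hxc, hyc⟩
      obtain ⟨a, b, ha, hb, hab, h⟩ := hc
      exact ⟨a • x + b • y, ⟨a, b, ha, hb, hab, rfl⟩, by simpa using h⟩
    exact ⟨z, ⟨hB.segment_subset hx hy hz, hzc⟩,
      fun i hi => (hK i).segment_subset (hs i hi) (hs' i hi) hz⟩

/-- The box with the coordinates in `F` ranging over all of `J`, the others over halves of it. -/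
def partialBox (J : BoxIntegral.Box (Fin n)) (F : Finset (Fin n)) (s : Set (Fin n)) :
    Set (Fin n → ℝ) :=
  {x | ∀ i, J.lower i ≤ x i ∧ x i ≤ J.upper i ∧ (i ∉ F → i ∈ s → (J.lower i + J.upper i) / 2 ≤ x i)
    ∧ (i ∉ F → i ∉ s → x i ≤ (J.lower i + J.upper i) / 2)}

theorem convex_partialBox (J : BoxIntegral.Box (Fin n)) (F : Finset (Fin n)) (s : Set (Fin n)) :
    Convex ℝ (partialBox J F s) := by
  intro x hx y hy a b ha hb hab i
  obtain rfl : b = 1 - a := by linarith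
  obtain ⟨h1, h2, h3, h4⟩ := hx i
  obtain ⟨k1, k2, k3, k4⟩ := hy i
  simp only [Pi.add_apply, Pi.smul_apply, smul_eq_mul]
  refine ⟨by nlinarith, by nlinarith, fun h h' => ?_, fun h h' => ?_⟩
  · have := h3 h h'; have := k3 h h'; nlinarith
  · have := h4 h h'; have := k4 h h'; nlinarith

theorem isClosed_partialBox (J : BoxIntegral.Box (Fin n)) (F : Finset (Fin n)) (s : Set (Fin n)) :
    IsClosed (partialBox J F s) := by
  simp only [partialBox, Set.ofPred_forall, Set.ofPred_and]
  refine isClosed_iInter fun i => ?_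
  refine IsClosed.inter (isClosed_le (by fun_prop) (by fun_prop)) (IsClosed.inter
    (isClosed_le (by fun_prop) (by fun_prop)) (IsClosed.inter ?_ ?_))
  · exact isClosed_iInter fun _ => isClosed_iInter fun _ => isClosed_le (by fun_prop) (by fun_prop)
  · exact isClosed_iInter fun _ => isClosed_iInter fun _ => isClosed_le (by fun_prop) (by fun_prop)

/-- Induction on the set `S` of coordinates that may vary on `B`, combined with subdivision of
boxes. Small boxes give cones, and the sub-boxes of a box are glued along hyperplane slices, on
which fewer coordinates vary. -/
theorem acycL_nerve_aux (hK : ∀ i, Convex ℝ (K i))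
    (hlf : ∀ x, ∃ U ∈ nhds x, ∀ i, (K i ∩ U).Nonempty → x ∈ K i) (S : Finset (Fin n)) :
    ∀ (B : Set (Fin n → ℝ)) (I₀ : BoxIntegral.Box (Fin n)), Convex ℝ B → IsClosed B →
      (∀ x ∈ B, ∃ i, x ∈ K i) → (∀ i ∉ S, ∃ c : ℝ, ∀ x ∈ B, x i = c) →
      AcycL X (InNerve K (B ∩ BoxIntegral.Box.Icc I₀)) := by
  classical
  induction S using Finset.strongInduction with
  | H S ih =>
  intro B I₀ hB hBc hcov hflat
  refine BoxIntegral.Box.subbox_induction_on'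
    (p := fun J => AcycL X (InNerve K (B ∩ BoxIntegral.Box.Icc J))) I₀ ?_ ?_
  · intro J _ hJ
    -- `F` collects the directions in which the halves are already glued: the empty set gives the
    -- sub-boxes, the full set the whole box.
    have key : ∀ (F : Finset (Fin n)) (s : Set (Fin n)),
        AcycL X (InNerve K (B ∩ partialBox J F s)) := by
      intro F
      induction F using Finset.induction_on with
      | empty =>
        intro s
        convert hJ s using 3
        ext x
        simp only [partialBox, BoxIntegral.Box.Icc, Set.mem_ofPred_eq]
        constructor
        · intro h
          refine ⟨fun i => ?_, fun i => ?_⟩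
          · obtain ⟨h1, h2, h3, h4⟩ := h i
            by_cases hi : i ∈ s <;> simp_all [BoxIntegral.Box.splitCenterBox]
          · obtain ⟨h1, h2, h3, h4⟩ := h i
            by_cases hi : i ∈ s <;> simp_all [BoxIntegral.Box.splitCenterBox]
        · intro h i
          have h1 := h.1 i
          have h2 := h.2 i
          have h3 := J.lower_lt_upper i
          by_cases hi : i ∈ s <;> simp_all [BoxIntegral.Box.splitCenterBox] <;> linarith
      | insert j F hj ihF =>
        intro s
        set c := (J.lower j + J.upper j) / 2 with hc
        have e1 : B ∩ partialBox J (insert j F) s ∩ {x | x j ≤ c} =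
            B ∩ partialBox J F (s \ {j}) := by
          ext x
          simp only [partialBox, Set.mem_inter_iff, Set.mem_ofPred_eq, and_assoc]
          refine and_congr_right fun _ => ⟨fun h i => ?_, fun h => ⟨fun i => ?_, ?_⟩⟩
          · obtain ⟨h1, h2, h3, h4⟩ := h.1 i
            by_cases hij : i = j
            · subst hij; simp [h1, h2, hj]; exact h.2
            · simp_all
          · obtain ⟨h1, h2, h3, h4⟩ := h i
            by_cases hij : i = j
            · subst hij; simp [h1, h2]
            · simp_all
          · obtain ⟨h1, h2, h3, h4⟩ := h j
            exact h4 hj (by simp)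
        have e2 : B ∩ partialBox J (insert j F) s ∩ {x | c ≤ x j} =
            B ∩ partialBox J F (insert j s) := by
          ext x
          simp only [partialBox, Set.mem_inter_iff, Set.mem_ofPred_eq, and_assoc]
          refine and_congr_right fun _ => ⟨fun h i => ?_, fun h => ⟨fun i => ?_, ?_⟩⟩
          · obtain ⟨h1, h2, h3, h4⟩ := h.1 i
            by_cases hij : i = j
            · subst hij; simp [h1, h2, hj]; exact h.2
            · simp_all
          · obtain ⟨h1, h2, h3, h4⟩ := h i
            by_cases hij : i = j
            · subst hij; simp [h1, h2]
            · simp_all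
          · obtain ⟨h1, h2, h3, h4⟩ := h j
            exact h3 hj (by simp)
        have a1 : AcycL X (InNerve K (B ∩ partialBox J (insert j F) s ∩ {x | x j ≤ c})) := by
          rw [e1]; exact ihF _
        have a2 : AcycL X (InNerve K (B ∩ partialBox J (insert j F) s ∩ {x | c ≤ x j})) := by
          rw [e2]; exact ihF _
        refine acycL_split hK (hB.inter (convex_partialBox _ _ _)) j c a1 a2 ?_
        -- The slice is flat in direction `j`. Either this makes progress in the outer induction, or
        -- `B` was already flat there and the slice is a whole half or empty.
        by_cases hjS : j ∈ S
        · have := ih (S.erase j) (Finset.erase_ssubset hjS)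
            (B ∩ partialBox J (insert j F) s ∩ {x | x j = c}) J
            ((hB.inter (convex_partialBox _ _ _)).inter
              (convex_hyperplane
                (LinearMap.isLinear (LinearMap.proj (R := ℝ) (φ := fun _ => ℝ) j)) c))
            ((hBc.inter (isClosed_partialBox _ _ _)).inter
              (isClosed_eq (by fun_prop) (by fun_prop)))
            (fun x hx => hcov x hx.1.1) (fun i hi => ?_)
          · rwa [Set.inter_eq_left.2] at this
            rintro x ⟨⟨-, hx⟩, -⟩
            exact ⟨fun i => (hx i).1, fun i => (hx i).2.1⟩
          · by_cases hij : i = j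
            · subst hij; exact ⟨c, fun x hx => hx.2⟩
            · obtain ⟨d, hd⟩ := hflat i (fun h => hi (Finset.mem_erase.2 ⟨hij, h⟩))
              exact ⟨d, fun x hx => hd x hx.1.1⟩
        · obtain ⟨d, hd⟩ := hflat j hjS
          by_cases hdc : d = c
          · have e3 : B ∩ partialBox J (insert j F) s ∩ {x | x j = c} =
                B ∩ partialBox J (insert j F) s ∩ {x | x j ≤ c} :=
              Set.ext fun x => and_congr_right fun hx => by simp [hd x hx.1, hdc]
            rw [e3]
            exact a1
          · refine acycL_of_false ?_
            rintro t ⟨x, hx, -⟩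
            exact hdc ((hd x hx.1.1).symm.trans hx.2)
    convert key Finset.univ ∅ using 3
    ext x
    simp only [partialBox, BoxIntegral.Box.Icc, Set.mem_ofPred_eq]
    exact ⟨fun h i => ⟨h.1 i, h.2 i, by simp, by simp⟩,
      fun h => ⟨fun i => (h i).1, fun i => (h i).2.1⟩⟩
  · intro z _
    obtain ⟨U, hU, hUK⟩ := hlf z
    by_cases hz : z ∈ B
    -- In a small box around `z`, every set of the covering that occurs passes through `z`, so any
    -- set through `z` can be the apex of a cone.
    · refine ⟨U, mem_nhdsWithin_of_mem_nhds hU, fun J _ m hzJ hJU _ => ?_⟩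
      obtain ⟨i, hi⟩ := hcov z hz
      refine acycL_of_cone i ?_
      rintro s ⟨x, ⟨hxB, hxJ⟩, hs⟩
      refine ⟨z, ⟨hz, hzJ⟩, fun k hk => ?_⟩
      rcases List.mem_cons.1 hk with rfl | hk
      · exact hi
      · exact hUK k ⟨x, hs k hk, hJU hxJ⟩
    · refine ⟨Bᶜ, mem_nhdsWithin_of_mem_nhds (hBc.isOpen_compl.mem_nhds hz),
        fun J _ m hzJ hJU _ => acycL_of_false ?_⟩
      rintro s ⟨x, ⟨hxB, hxJ⟩, -⟩
      exact hJU hxJ hxB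

/-- The nerve theorem: the nerve of a covering of a compact convex set `B` by convex sets is
acyclic. -/
theorem acycL_nerve (hK : ∀ i, Convex ℝ (K i))
    (hlf : ∀ x, ∃ U ∈ nhds x, ∀ i, (K i ∩ U).Nonempty → x ∈ K i) {B : Set (Fin n → ℝ)}
    (hB : Convex ℝ B) (hBc : IsCompact B) (hcov : ∀ x ∈ B, ∃ i, x ∈ K i) :
    AcycL X (InNerve K B) := by
  obtain ⟨r, hr⟩ := hBc.isBounded.subset_closedBall 0
  -- The radius may be negative if `B` is empty. The summand `1` keeps the box nondegenerate.
  let J : BoxIntegral.Box (Fin n) := ⟨fun _ => -|r| - 1, fun _ => |r| + 1, fun _ => by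
    have := abs_nonneg r; linarith⟩
  have := acycL_nerve_aux (X := X) hK hlf Finset.univ B J hB hBc.isClosed hcov (by simp)
  rwa [Set.inter_eq_left.2] at this
  intro x hx
  have h1 := hr hx
  rw [mem_closedBall_zero_iff] at h1
  have h2 : ∀ i, |x i| ≤ |r| := fun i =>
    ((norm_le_pi_norm x i).trans h1).trans (le_abs_self r)
  refine ⟨fun i => ?_, fun i => ?_⟩
  · have := (abs_le.1 (h2 i)).1
    change -|r| - 1 ≤ x i
    linarith
  · have := (abs_le.1 (h2 i)).2
    change x i ≤ |r| + 1
    linarith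

end Nerve

/-! ### The double complex of lists and augmented chains -/

section Bicomplex

variable {I : Type} {X : ℕ → Type} [∀ n, AddCommGroup (X n)] (d : ∀ n, X (n + 1) →+ X n)

/-- Cycles of an augmented complex: everything in degree `0`. -/
def IsCyc : ∀ n, X n → Prop
  | 0, _ => True
  | n + 1, x => d n x = 0

/-- Exactness of the subcomplex `S` of an augmented complex. -/
def ExactOn (S : ∀ n, AddSubgroup (X n)) : Prop :=
  ∀ n, ∀ x ∈ S n, IsCyc d n x → ∃ w ∈ S (n + 1), d n w = x

/-- The differential of the coefficients of a chain on lists. -/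
def dV (n : ℕ) : (List I →₀ X (n + 1)) →+ (List I →₀ X n) := Finsupp.mapRange.addMonoidHom (d n)

theorem dV_apply (n : ℕ) (z : List I →₀ X (n + 1)) (s : List I) : dV d n z s = d n (z s) := by
  simp [dV]

theorem dV_single (n : ℕ) (s : List I) (x : X (n + 1)) :
    dV d n (Finsupp.single s x) = Finsupp.single s (d n x) := by
  simp [dV]

theorem dV_coneL (n : ℕ) (i : I) (z : List I →₀ X (n + 1)) :
    dV d n (coneL i z) = coneL i (dV d n z) := by
  induction z using Finsupp.induction_linear with
  | zero => simp
  | add a b ha hb => simp only [map_add, ha, hb]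
  | single s x => simp [dV_single]

theorem dV_dL (n : ℕ) (z : List I →₀ X (n + 1)) : dV d n (dL z) = dL (dV d n z) := by
  induction z using Finsupp.induction_linear with
  | zero => simp
  | add a b ha hb => simp only [map_add, ha, hb]
  | single s x =>
    induction s with
    | nil => simp [bdL, dV_single]
    | cons i s ih =>
      rw [← coneL_single, dL_coneL, map_sub, dV_coneL, dV_coneL, ih, dL_coneL]

variable {d} {S : List I → ∀ n, AddSubgroup (X n)}

/-- The column over the empty list is not known to be exact; it is the one to be understood. The
comparison is made after `dL`, which kills that column. -/
theorem exists_dV_eq (hcol : ∀ s ≠ [], ExactOn d (S s)) (n : ℕ) {y : List I →₀ X n}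
    (hy : y ∈ listSub fun s => S s n) (hc : ∀ s, IsCyc d n (y s)) :
    ∃ w ∈ listSub fun s => S s (n + 1), dL (dV d n w) = dL y := by
  classical
  have h : ∀ s : List I, ∃ w ∈ S s (n + 1), s ≠ [] → d n w = y s := by
    intro s
    by_cases hs : s = []
    · exact ⟨0, zero_mem _, fun h => absurd hs h⟩
    · obtain ⟨w, hw, h⟩ := hcol s hs n (y s) (hy s) (hc s)
      exact ⟨w, hw, fun _ => h⟩
  choose w hw hdw using h
  refine ⟨∑ s ∈ y.support, Finsupp.single s (w s),
    sum_mem fun s _ => single_mem_listSub (hw s), ?_⟩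
  have hy' : y = ∑ s ∈ y.support, Finsupp.single s (y s) := y.sum_single.symm
  conv_rhs => rw [hy']
  rw [map_sum, map_sum, map_sum]
  refine Finset.sum_congr rfl fun s _ => ?_
  rw [dV_single]
  by_cases hs : s = []
  · subst hs; simp [bdL]
  · rw [hdw s hs]

/-- The zigzag of a double complex. Write `z = dL y` along the row. The obstruction `dV y` is again
closed in both directions, one degree lower, so by induction it is `dV (dL w)`. Then `y - dL w` is a
cycle in each column and can be lifted there. -/
theorem bicomplex_aux (hS : ∀ s t n, t ⊆ s → S s n ≤ S t n)
    (hdd : ∀ n x, d n (d (n + 1) x) = 0)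
    (hdS : ∀ s n, ∀ x ∈ S s (n + 1), d n x ∈ S s n) (hcol : ∀ s ≠ [], ExactOn d (S s))
    (hrow : ∀ n, ∀ z ∈ listSub (fun s => S s n), dL z = 0 →
      ∃ w ∈ listSub (fun s => S s n), dL w = z) (n : ℕ) :
    ∀ z ∈ listSub (fun s => S s n), dL z = 0 → (∀ s, IsCyc d n (z s)) →
      ∃ w ∈ listSub (fun s => S s (n + 1)), dL (dV d n w) = z := by
  induction n with
  | zero =>
    intro z hz hdz _
    obtain ⟨y, hy, rfl⟩ := hrow 0 z hz hdz
    exact exists_dV_eq hcol 0 hy fun _ => trivial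
  | succ n ih =>
    intro z hz hdz hc
    obtain ⟨y, hy, rfl⟩ := hrow (n + 1) z hz hdz
    have h0 : dV d n (dL y) = 0 := by
      ext s
      rw [dV_apply]
      exact hc s
    obtain ⟨w, hw, hdw⟩ := ih (dV d n y) (fun s => by rw [dV_apply]; exact hdS s n _ (hy s))
      (by rw [← dV_dL, h0]) (fun s => by
        cases n with
        | zero => trivial
        | succ n =>
          change d n _ = 0
          rw [dV_apply, hdd])
    obtain ⟨v, hv, hdv⟩ := exists_dV_eq hcol (n + 1)
      (sub_mem hy (dL_mem (fun s t h => hS s t _ h) hw)) (fun s => by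
        change d n _ = 0
        rw [← dV_apply, map_sub, dV_dL, hdw, sub_self]
        rfl)
    exact ⟨v, hv, by rw [hdv, map_sub, dL_dL, sub_zero]⟩

/-- Placed at the empty list, `x` is closed for `dL`. The zigzag writes it as `dV (dL w)`, and the
coefficient of `dL w` at the empty list is the required filling. -/
theorem exactOn_of_bicomplex (hS : ∀ s t n, t ⊆ s → S s n ≤ S t n)
    (hdd : ∀ n x, d n (d (n + 1) x) = 0)
    (hdS : ∀ s n, ∀ x ∈ S s (n + 1), d n x ∈ S s n) (hcol : ∀ s ≠ [], ExactOn d (S s))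
    (hrow : ∀ n, ∀ z ∈ listSub (fun s => S s n), dL z = 0 →
      ∃ w ∈ listSub (fun s => S s n), dL w = z) : ExactOn d (S []) := by
  intro n x hx hc
  obtain ⟨w, hw, h⟩ := bicomplex_aux hS hdd hdS hcol hrow n (Finsupp.single [] x)
    (single_mem_listSub hx) (by simp [bdL]) (fun s => by
      cases n with
      | zero => trivial
      | succ n =>
        have : d n x = 0 := hc
        change d n _ = 0
        rw [← dV_apply, dV_single, this]
        simp)
  refine ⟨dL w [], dL_mem (fun s t h => hS s t _ h) hw [], ?_⟩
  rw [← dV_apply, dV_dL, h]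
  simp

end Bicomplex

/-! ## Contractions and coordinates of multivectors -/

section Contraction

variable {R E F : Type} [CommRing R] [AddCommGroup E] [Module R E] [AddCommGroup F] [Module R F]

theorem extPow_ext {p : ℕ} {f h : ExtPow R p E →ₗ[R] F}
    (H : ∀ u, f (wedgeProd R p u) = h (wedgeProd R p u)) : f = h :=
  exteriorPower.linearMap_ext (AlternatingMap.ext H)

theorem extPow_induction {p : ℕ} {S : Submodule R (ExtPow R p E)}
    (H : ∀ u, wedgeProd R p u ∈ S) (x : ExtPow R p E) : x ∈ S := by
  have h : Submodule.span R (Set.range (wedgeProd R p (E := E))) ≤ S :=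
    Submodule.span_le.2 (Set.range_subset_iff.2 H)
  have h' : Submodule.span R (Set.range (wedgeProd R p (E := E))) = ⊤ :=
    exteriorPower.ιMulti_span R p E
  exact h (h' ▸ Submodule.mem_top)

theorem extPow_succ_induction {p : ℕ} {S : Submodule R (ExtPow R (p + 1) E)}
    (H : ∀ u w, wedge R p u w ∈ S) (x : ExtPow R (p + 1) E) : x ∈ S :=
  extPow_induction (fun u => by
    rw [← Matrix.cons_head_tail u, ← wedge_wedgeProd]
    exact H _ _) x

theorem wedge_self_wedge (p : ℕ) (u : E) (w : ExtPow R p E) :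
    wedge R (p + 1) u (wedge R p u w) = 0 := by
  refine Subtype.ext ?_
  change ExteriorAlgebra.ι R u * (ExteriorAlgebra.ι R u * (w : ⋀[R]^p E).1) = 0
  rw [← mul_assoc, ExteriorAlgebra.ι_sq_zero, zero_mul]

theorem wedge_wedge_swap (p : ℕ) (u v : E) (w : ExtPow R p E) :
    wedge R (p + 1) u (wedge R p v w) = -wedge R (p + 1) v (wedge R p u w) := by
  have h := wedge_self_wedge p (u + v) w
  simp only [map_add, LinearMap.add_apply, wedge_self_wedge, zero_add, add_zero] at h
  exact eq_neg_of_add_eq_zero_right h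

/-- The contraction of multivectors with a linear form. -/
def contr (f : E →ₗ[R] R) (q : ℕ) : ExtPow R (q + 1) E →ₗ[R] ExtPow R q E :=
  extLift R (q + 1) (AlternatingMap.alternatizeUncurryFin (f.smulRight (wedgeProd R q)))

theorem contr_wedgeProd (f : E →ₗ[R] R) (q : ℕ) (u : Fin (q + 1) → E) :
    contr f q (wedgeProd R (q + 1) u) =
      ∑ k : Fin (q + 1), (-1 : ℤ) ^ (k : ℕ) • (f (u k) • wedgeProd R q (k.removeNth u)) := by
  rw [contr, extLift_wedgeProd]
  simp [AlternatingMap.alternatizeUncurryFin_apply]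

/-- The antiderivation rule for contractions comes in two cases, because in degree zero its second
term has no place. -/
theorem contr_wedge_zero (f : E →ₗ[R] R) (u : E) (w : ExtPow R 0 E) :
    contr f 0 (wedge R 0 u w) = f u • w := by
  refine LinearMap.congr_fun (f := (contr f 0).comp (wedge R 0 u)) (g := f u • LinearMap.id)
    (extPow_ext fun v => ?_) w
  simp only [LinearMap.comp_apply, wedge_wedgeProd, contr_wedgeProd, LinearMap.smul_apply]
  simp

theorem contr_wedge (f : E →ₗ[R] R) (q : ℕ) (u : E) (w : ExtPow R (q + 1) E) :
    contr f (q + 1) (wedge R (q + 1) u w) = f u • w - wedge R q u (contr f q w) := by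
  refine LinearMap.congr_fun (f := (contr f (q + 1)).comp (wedge R (q + 1) u))
    (g := f u • LinearMap.id - (wedge R q u).comp (contr f q)) (extPow_ext fun v => ?_) w
  simp only [LinearMap.comp_apply, wedge_wedgeProd, contr_wedgeProd, LinearMap.smul_apply,
    LinearMap.sub_apply, LinearMap.id_apply, map_sum]
  rw [Fin.sum_univ_succ, sub_eq_add_neg, ← Finset.sum_neg_distrib]
  congr 1
  · simp
  · refine Finset.sum_congr rfl fun k _ => ?_
    rw [map_zsmul, map_smul, wedge_wedgeProd, Fin.val_succ, pow_succ, mul_neg_one, neg_smul]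
    congr 4
    · funext i
      refine Fin.cases ?_ (fun i => ?_) i
      · rfl
      · simp [Fin.removeNth, Matrix.vecCons]

/-- A multivector of degree zero is a number. -/
def extZero : ExtPow R 0 E ≃ₗ[R] R := exteriorPower.zeroEquiv R E

theorem extZero_wedgeProd (u : Fin 0 → E) : extZero (wedgeProd R 0 u) = 1 :=
  exteriorPower.zeroEquiv_ιMulti u

end Contraction

/-- Ordered sequences of `q` indices smaller than `i` (and than `g`). -/
inductive Idx (g : ℕ) : ℕ → ℕ → Type
  | nil : Idx g 0 0
  | skip {i q : ℕ} : Idx g i q → Idx g (i + 1) q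
  | take {i q : ℕ} (h : i < g) : Idx g i q → Idx g (i + 1) (q + 1)

instance finite_idx (g : ℕ) : ∀ i q : ℕ, Finite (Idx g i q)
  | 0, 0 => Finite.of_surjective (fun _ : Unit => Idx.nil) fun I => ⟨(), by cases I; rfl⟩
  | 0, q + 1 => @Finite.of_subsingleton _ ⟨fun I => nomatch I⟩
  | i + 1, 0 =>
    have := finite_idx g i 0
    Finite.of_surjective (fun I : Idx g i 0 => I.skip) fun I => by
      cases I with
      | skip I => exact ⟨I, rfl⟩
  | i + 1, q + 1 => by
    have := finite_idx g i q
    have := finite_idx g i (q + 1)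
    by_cases h : i < g
    · refine Finite.of_surjective (Sum.elim (fun I : Idx g i (q + 1) => I.skip)
        fun I : Idx g i q => I.take h) fun I => ?_
      cases I with
      | skip I => exact ⟨Sum.inl I, rfl⟩
      | take _ I => exact ⟨Sum.inr I, rfl⟩
    · refine Finite.of_surjective (fun I : Idx g i (q + 1) => I.skip) fun I => ?_
      cases I with
      | skip I => exact ⟨I, rfl⟩
      | take h' _ => exact absurd h' h

section Coordinates

variable (R : Type) [CommRing R] {g : ℕ}

/-- Standard basis vectors. -/
def basisVec (j : Fin g) : Fin g → R := Pi.single j 1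

/-- Contraction with a coordinate form. -/
def contrC (j : Fin g) (q : ℕ) : ExtPow R (q + 1) (Fin g → R) →ₗ[R] ExtPow R q (Fin g → R) :=
  contr (LinearMap.proj j) q

/-- Coordinates of multivectors, as iterated contractions. -/
def theta : ∀ {i q : ℕ}, Idx g i q → ExtPow R q (Fin g → R) →ₗ[R] R
  | _, _, Idx.nil => extZero.toLinearMap
  | _, _, Idx.skip I => theta I
  -- The sign cancels the one in `contrT_volL`, so that coordinates of volumes are iterated periods
  -- exactly. `extBas` carries the same sign in order to stay dual.
  | _, _, Idx.take (i := i) (q := q) h I => -(theta I).comp (contrC R ⟨i, h⟩ q)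

/-- The multivectors dual to the coordinates `theta`. -/
def extBas : ∀ {i q : ℕ}, Idx g i q → ExtPow R q (Fin g → R)
  | _, _, Idx.nil => wedgeProd R 0 ![]
  | _, _, Idx.skip I => extBas I
  | _, _, Idx.take (i := i) (q := q) h I => -wedge R q (basisVec R ⟨i, h⟩) (extBas I)

variable {R}

theorem proj_basisVec (j k : Fin g) :
    (LinearMap.proj j : (Fin g → R) →ₗ[R] R) (basisVec R k) = if j = k then 1 else 0 := by
  simp [basisVec, Pi.single_apply]

/-- Only basis vectors of index below `i` occur in `extBas R I`, and the `j`-th coordinate form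
kills all of them. -/
theorem contrC_extBas {i : ℕ} : ∀ {q : ℕ} (I : Idx g i (q + 1)) (j : Fin g), i ≤ j →
    contrC R j q (extBas R I) = 0 := by
  induction i with
  | zero => intro q I; cases I
  | succ i ih =>
    intro q I j hj
    cases I with
    | skip I => exact ih I j (by omega)
    | take h I =>
      have hne : j ≠ ⟨i, h⟩ := fun h' => by rw [h'] at hj; simp at hj
      rw [extBas, map_neg, neg_eq_zero, contrC]
      cases q with
      | zero => rw [contr_wedge_zero, proj_basisVec, if_neg hne, zero_smul]
      | succ q =>
        rw [contr_wedge, proj_basisVec, if_neg hne, zero_smul, zero_sub]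
        have := ih I j (by omega)
        rw [contrC] at this
        rw [this, map_zero, neg_zero]

/-- All contractions in `theta R J` are with forms that kill `e_j`. The antiderivation rule moves
them past `e_j`, until the last one meets `e_j` itself. -/
theorem theta_wedge {i : ℕ} : ∀ {q : ℕ} (J : Idx g i (q + 1)) (j : Fin g), i ≤ j →
    ∀ w, theta R J (wedge R q (basisVec R j) w) = 0 := by
  induction i with
  | zero => intro q J; cases J
  | succ i ih =>
    intro q J j hj w
    cases J with
    | skip J => exact ih J j (by omega) w
    | take h J =>
      have hne : (⟨i, h⟩ : Fin g) ≠ j := fun h' => by rw [← h'] at hj; simp at hj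
      rw [theta, LinearMap.neg_apply, neg_eq_zero, LinearMap.comp_apply, contrC]
      cases q with
      | zero => rw [contr_wedge_zero, proj_basisVec, if_neg hne, zero_smul, map_zero]
      | succ q =>
        rw [contr_wedge, proj_basisVec, if_neg hne, zero_smul, zero_sub, map_neg,
          ih J j (by omega), neg_zero]

open Classical in
theorem theta_extBas {i : ℕ} : ∀ {q : ℕ} (J I : Idx g i q),
    theta R J (extBas R I) = if J = I then 1 else 0 := by
  induction i with
  | zero =>
    intro q J I
    cases J
    cases I
    rw [if_pos rfl]
    exact extZero_wedgeProd _
  | succ i ih =>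
    intro q J I
    cases J with
    | skip J =>
      cases I with
      | skip I => simp only [Idx.skip.injEq]; exact ih J I
      | take h I =>
        rw [if_neg (by simp), theta, extBas, map_neg, theta_wedge J _ le_rfl, neg_zero]
    | take h J =>
      cases I with
      | skip I =>
        rw [if_neg (by simp), theta, extBas, LinearMap.neg_apply, LinearMap.comp_apply,
          contrC_extBas I _ le_rfl, map_zero, neg_zero]
      | take h' I =>
        rename_i q
        simp only [Idx.take.injEq]
        rw [← ih J I, theta, extBas, LinearMap.neg_apply, LinearMap.comp_apply, map_neg, map_neg,
          neg_neg]
        congr 1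
        cases q with
        | zero => rw [contrC, contr_wedge_zero, proj_basisVec, if_pos rfl, one_smul]
        | succ q =>
          have h0 := contrC_extBas (R := R) I ⟨i, h⟩ le_rfl
          rw [contrC] at h0
          rw [contrC, contr_wedge, proj_basisVec, if_pos rfl, one_smul, h0, map_zero, sub_zero]

/-- Sorting: `e_j` is moved past larger factors, with a sign each time, until it finds its place or
meets a copy of itself. -/
theorem wedge_extBas_mem {i : ℕ} : ∀ {q : ℕ} (I : Idx g i q) (j : Fin g), (j : ℕ) < i →
    wedge R q (basisVec R j) (extBas R I) ∈
      Submodule.span R (Set.range (extBas R : Idx g i (q + 1) → _)) := by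
  induction i with
  | zero => intro q I j hj; omega
  | succ i ih =>
    intro q I j hj
    have hskip : ∀ q, Submodule.span R (Set.range (extBas R : Idx g i q → _)) ≤
        Submodule.span R (Set.range (extBas R : Idx g (i + 1) q → _)) := by
      intro q
      refine Submodule.span_mono ?_
      rintro _ ⟨I, rfl⟩
      exact ⟨I.skip, rfl⟩
    cases I with
    | skip I =>
      rcases Nat.lt_succ_iff_lt_or_eq.1 (show (j : ℕ) < Nat.succ i from hj) with hj | hj
      · exact hskip _ (ih I j hj)
      · subst hj
        rw [← neg_mem_iff]
        exact Submodule.subset_span ⟨Idx.take j.2 I, rfl⟩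
    | take h I =>
      rw [extBas, map_neg, neg_mem_iff]
      rcases Nat.lt_succ_iff_lt_or_eq.1 hj with hj | hj
      · rw [wedge_wedge_swap, neg_mem_iff]
        refine Submodule.span_induction (p := fun x _ => wedge R _ (basisVec R ⟨i, h⟩) x ∈ _)
          ?_ ?_ ?_ ?_ (ih I j hj)
        · rintro _ ⟨J, rfl⟩
          rw [← neg_mem_iff]
          exact Submodule.subset_span ⟨Idx.take h J, rfl⟩
        · rw [map_zero]; exact zero_mem _
        · intro x y _ _ hx hy; rw [map_add]; exact add_mem hx hy
        · intro c x _ hx; rw [map_smul]; exact Submodule.smul_mem _ c hx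
      · have : j = ⟨i, h⟩ := Fin.ext hj
        rw [this, wedge_self_wedge]
        exact zero_mem _

/-- The single multi-index of length zero. -/
def Idx.zero (g : ℕ) : ∀ i, Idx g i 0
  | 0 => Idx.nil
  | i + 1 => (Idx.zero g i).skip

theorem extBas_zero (i : ℕ) : extBas R (Idx.zero g i) = wedgeProd R 0 ![] := by
  induction i with
  | zero => rfl
  | succ i ih => exact ih

theorem span_extBas (q : ℕ) : Submodule.span R (Set.range (extBas R : Idx g g q → _)) = ⊤ := by
  rw [eq_top_iff]
  intro x _
  induction q with
  | zero =>
    refine extPow_induction (fun u => Submodule.subset_span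
      (Set.mem_range.2 ⟨Idx.zero g g, ?_⟩)) x
    rw [extBas_zero]
    congr 1
    exact Subsingleton.elim _ _
  | succ q ih =>
    refine extPow_succ_induction (fun u w => ?_) x
    have hu : u = ∑ j, u j • basisVec R j := by
      simpa [basisVec] using (pi_eq_sum_univ' u)
    rw [hu, map_sum, LinearMap.sum_apply]
    refine sum_mem fun j _ => ?_
    rw [map_smul, LinearMap.smul_apply]
    refine Submodule.smul_mem _ _ ?_
    refine Submodule.span_induction (p := fun x _ => wedge R _ (basisVec R j) x ∈ _)
          ?_ ?_ ?_ ?_ (ih Submodule.mem_top)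
    · rintro _ ⟨J, rfl⟩
      exact wedge_extBas_mem J j j.2
    · rw [map_zero]; exact zero_mem _
    · intro x y _ _ hx hy; rw [map_add]; exact add_mem hx hy
    · intro c x _ hx; rw [map_smul]; exact Submodule.smul_mem _ c hx

variable (R g) in
/-- The basis `extBas` of the exterior power. -/
def extBasis (q : ℕ) : Basis (Idx g g q) R (ExtPow R q (Fin g → R)) :=
  Basis.mk (v := extBas R) (by
    classical
    have := Fintype.ofFinite (Idx g g q)
    rw [Fintype.linearIndependent_iff]
    intro c hc J
    have := congrArg (theta R J) hc
    simpa [theta_extBas] using this) (span_extBas q).ge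

theorem extBasis_repr (q : ℕ) (x : ExtPow R q (Fin g → R)) (J : Idx g g q) :
    (extBasis R g q).repr x J = theta R J x := by
  classical
  refine LinearMap.congr_fun (f := (Finsupp.lapply J).comp (extBasis R g q).repr.toLinearMap)
    (Basis.ext (extBasis R g q) fun I => ?_) x
  simp only [LinearMap.comp_apply, LinearEquiv.coe_coe, Basis.repr_self, Finsupp.lapply_apply]
  rw [extBasis, Basis.mk_apply, theta_extBas, Finsupp.single_apply]
  simp only [eq_comm]

variable (R) in
/-- Coordinates of a multivector with coefficients in `A`. -/
def thetaT {i q : ℕ} (A : Type) [AddCommGroup A] [Module R A] (I : Idx g i q) :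
    (ExtPow R q (Fin g → R) ⊗[R] A) →ₗ[R] A :=
  (TensorProduct.lid R A).toLinearMap.comp ((theta R I).rTensor A)

theorem thetaT_tmul {i q : ℕ} {A : Type} [AddCommGroup A] [Module R A] (I : Idx g i q)
    (x : ExtPow R q (Fin g → R)) (a : A) : thetaT R A I (x ⊗ₜ a) = theta R I x • a := by
  simp [thetaT]

variable (R) in
/-- A multivector with coefficients in `A` is determined by its coordinates. -/
def thetaEquiv (g q : ℕ) (A : Type) [AddCommGroup A] [Module R A] :
    (ExtPow R q (Fin g → R) ⊗[R] A) ≃ₗ[R] (Idx g g q → A) :=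
  haveI := Classical.decEq (Idx g g q)
  (TensorProduct.equivFinsuppOfBasisLeft (extBasis R g q)).trans
    (Finsupp.linearEquivFunOnFinite R A (Idx g g q))

theorem thetaEquiv_apply {q : ℕ} {A : Type} [AddCommGroup A] [Module R A]
    (x : ExtPow R q (Fin g → R) ⊗[R] A) (I : Idx g g q) :
    thetaEquiv R g q A x I = thetaT R A I x := by
  refine LinearMap.congr_fun (f := (LinearMap.proj I).comp (thetaEquiv R g q A).toLinearMap)
    (g := thetaT R A I) (TensorProduct.ext' fun x a => ?_) x
  simp [thetaEquiv, thetaT_tmul, extBasis_repr]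

/-- Expanding each `u_k` in coordinates turns the sum over factors into a sum over directions of
`ℝ^g`. In this form it can be compared with the monodromy operator. -/
theorem phiReal_eq_sum (p q : ℕ)
    (x : ExtPow R (q + 1) (Fin g → R) ⊗[R] ExtPow R p (Fin g → R)) :
    phiReal R p q (Fin g → R) x =
      -∑ j, TensorProduct.map (contrC R j q) (wedge R p (basisVec R j)) x := by
  refine LinearMap.congr_fun (f := phiReal R p q (Fin g → R))
    (g := -∑ j, TensorProduct.map (contrC R j q) (wedge R p (basisVec R j)))
    (TensorProduct.ext (extPow_ext fun u => LinearMap.ext fun v => ?_)) x |>.trans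
      (by simp [LinearMap.sum_apply])
  change phiReal R p q (Fin g → R) (_ ⊗ₜ _) =
    (-∑ j, TensorProduct.map (contrC R j q) (wedge R p (basisVec R j))) (_ ⊗ₜ _)
  simp only [phiReal_apply, LinearMap.neg_apply, LinearMap.sum_apply, TensorProduct.map_tmul,
    contrC, contr_wedgeProd]
  simp only [TensorProduct.sum_tmul]
  rw [Finset.sum_comm, ← Finset.sum_neg_distrib]
  refine Finset.sum_congr rfl fun k _ => ?_
  have hu : u k = ∑ j, u k j • basisVec R j := by
    simpa [basisVec] using (pi_eq_sum_univ' (u k))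
  conv_lhs => rw [hu]
  rw [map_sum, LinearMap.sum_apply, TensorProduct.tmul_sum, Finset.smul_sum,
    ← Finset.sum_neg_distrib]
  refine Finset.sum_congr rfl fun j _ => ?_
  rw [map_smul, LinearMap.smul_apply, TensorProduct.tmul_smul, pow_succ, mul_neg_one, neg_smul,
    ← TensorProduct.smul_tmul', ← TensorProduct.smul_tmul']
  simp

end Coordinates

/-! ### Coordinates of integral multivectors -/

section IntegralCoordinates

variable {g : ℕ}

theorem extPowMap_contr (j : Fin g) (q : ℕ) (x : ExtPow ℤ (q + 1) (Fin g → ℤ)) :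
    extPowMap (intEmb g) q (contrC ℤ j q x) = contrC ℝ j q (extPowMap (intEmb g) (q + 1) x) := by
  refine extPow_induction (S := LinearMap.eqLocus
    ((extPowMap (intEmb g) q).toIntLinearMap.comp (contrC ℤ j q))
    ((contrC ℝ j q).restrictScalars ℤ |>.comp (extPowMap (intEmb g) (q + 1)).toIntLinearMap))
    (fun u => ?_) x
  change extPowMap (intEmb g) q (contrC ℤ j q _) = contrC ℝ j q (extPowMap (intEmb g) (q + 1) _)
  rw [contrC, contrC, extPowMap_wedgeProd, contr_wedgeProd, contr_wedgeProd, map_sum]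
  refine Finset.sum_congr rfl fun k _ => ?_
  refine (map_zsmul (extPowMap (intEmb g) q) ((-1) ^ (k : ℕ)) _).trans (congrArg _ ?_)
  refine (map_zsmul (extPowMap (intEmb g) q) (u k j) _).trans ?_
  rw [extPowMap_wedgeProd, ← Int.cast_smul_eq_zsmul ℝ]
  rfl

theorem theta_extPowMap {i q : ℕ} (I : Idx g i q) (x : ExtPow ℤ q (Fin g → ℤ)) :
    theta ℝ I (extPowMap (intEmb g) q x) = (theta ℤ I x : ℝ) := by
  induction I with
  | nil =>
    refine extPow_induction (S := LinearMap.eqLocus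
      ((theta ℝ Idx.nil).toAddMonoidHom.comp (extPowMap (intEmb g) 0)).toIntLinearMap
      ((Int.castAddHom ℝ).toIntLinearMap.comp (theta ℤ Idx.nil)))
      (fun u => ?_) x
    change theta ℝ Idx.nil (extPowMap (intEmb g) 0 _) = (theta ℤ Idx.nil _ : ℝ)
    rw [extPowMap_wedgeProd]
    simp [theta, extZero_wedgeProd]
  | skip I ih => exact ih x
  | take h I ih =>
    simp only [theta, LinearMap.neg_apply, LinearMap.comp_apply, Int.cast_neg]
    rw [← extPowMap_contr, ih]

/-- Coordinates of an integral multivector with coefficients in `A`. -/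
def thetaZ (g q : ℕ) (A : Type) [AddCommGroup A] :
    (ExtPow ℤ q (Fin g → ℤ) ⊗[ℤ] A) ≃ₗ[ℤ] (Idx g g q → A) := thetaEquiv ℤ g q A

theorem thetaZ_tmul {q : ℕ} {A : Type} [AddCommGroup A] (I : Idx g g q)
    (x : ExtPow ℤ q (Fin g → ℤ)) (a : A) : thetaZ g q A (x ⊗ₜ a) I = theta ℤ I x • a :=
  (thetaEquiv_apply (R := ℤ) _ I).trans (thetaT_tmul I x a)

theorem thetaT_tensorToReal (L : Submodule ℤ (Fin g → ℝ)) {p q : ℕ} (I : Idx g g q)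
    (y : ExtPow ℤ q (Fin g → ℤ) ⊗[ℤ] ExtPow ℤ p L) :
    thetaT ℝ _ I (tensorToReal L p q y) =
      extPowMap L.subtype p (thetaZ g q (ExtPow ℤ p L) y I) := by
  induction y using TensorProduct.induction_on with
  | zero => simp
  | add x y hx hy => simp only [map_add, hx, hy, Pi.add_apply]
  | tmul x y =>
    change thetaT ℝ _ I (extPowMap (intEmb g) q x ⊗ₜ[ℝ] extPowMap L.subtype p y) = _
    rw [thetaT_tmul, thetaZ_tmul, theta_extPowMap, map_zsmul, Int.cast_smul_eq_zsmul]

end IntegralCoordinates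

namespace PolyhedralStructure

/-! ## Faces of the cells -/

section Faces

variable {g : ℕ} {C : PolyhedralStructure g} {P Q R : Set (Fin g → ℝ)}

theorem nonempty_of_mem (hP : P ∈ C.lifts) : P.Nonempty := by
  obtain ⟨s, hs, rfl⟩ := C.polytope P hP
  exact convexHull_nonempty_iff.2 (by exact_mod_cast hs)

theorem isCompact_of_mem (hP : P ∈ C.lifts) : IsCompact P := by
  obtain ⟨s, -, rfl⟩ := C.polytope P hP
  exact s.finite_toSet.isCompact_convexHull ℝ

theorem convex_of_mem (hP : P ∈ C.lifts) : Convex ℝ P := by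
  obtain ⟨s, -, rfl⟩ := C.polytope P hP
  exact convex_convexHull ℝ _

/-- The intersection axiom makes an included cell an exposed face, since `P ∩ Q = Q`. From here on
faces are sets of minima, hence the change of sign of the exposing functional. -/
theorem exists_form (hP : P ∈ C.lifts) (hQ : Q ∈ C.lifts) (h : Q ⊆ P) :
    ∃ (f : (Fin g → ℝ) →ₗ[ℝ] ℝ) (c : ℝ), (∀ x ∈ P, c ≤ f x) ∧ ∀ x ∈ P, (f x = c ↔ x ∈ Q) := by
  obtain ⟨r, hr⟩ := nonempty_of_mem hQ
  have he := (C.inter P hP Q hQ ⟨r, h hr, hr⟩).1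
  rw [Set.inter_eq_right.2 h] at he
  obtain ⟨l, hl⟩ := he ⟨r, hr⟩
  have hr' : r ∈ P ∧ ∀ y ∈ P, l y ≤ l r := by rw [hl] at hr; exact hr
  refine ⟨-(l : (Fin g → ℝ) →ₗ[ℝ] ℝ), -l r, fun x hx => ?_, fun x hx => ?_⟩
  · simpa using hr'.2 x hx
  · rw [hl]
    simp only [LinearMap.neg_apply, neg_inj, Set.mem_ofPred_eq]
    constructor
    · intro hx'
      refine ⟨hx, fun y hy => ?_⟩
      have : l x = l r := hx'
      rw [this]
      exact hr'.2 y hy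
    · rintro ⟨-, hx'⟩
      exact le_antisymm (hr'.2 x hx) (hx' r hr'.1)

theorem exists_face (hP : P ∈ C.lifts) (f : (Fin g → ℝ) →ₗ[ℝ] ℝ) (c : ℝ)
    (h : ∀ x ∈ P, c ≤ f x) (hx : ∃ x ∈ P, f x = c) :
    ∃ Q ∈ C.lifts, Q ⊆ P ∧ ∀ x ∈ P, (x ∈ Q ↔ f x = c) := by
  obtain ⟨x₀, hx₀, hc⟩ := hx
  refine ⟨{x ∈ P | f x = c}, C.face_mem P hP _ ⟨x₀, hx₀, hc⟩ fun _ => ?_, fun x hx => hx.1,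
    fun x hx => ⟨fun h => h.2, fun h => ⟨hx, h⟩⟩⟩
  refine ⟨-LinearMap.toContinuousLinearMap f, Set.ext fun x => and_congr_right fun hxP => ?_⟩
  constructor
  · rintro hx y hy
    simpa [hx] using h y hy
  · intro hx
    refine le_antisymm ?_ (h x hxP)
    simpa [hc] using hx x₀ hx₀

theorem sub_mem_vectorSpan {x y : Fin g → ℝ} (hx : x ∈ P) (hy : y ∈ P) :
    x - y ∈ vectorSpan ℝ P := vsub_mem_vectorSpan ℝ hx hy

theorem vectorSpan_le_ker {f : (Fin g → ℝ) →ₗ[ℝ] ℝ} {c : ℝ} (h : ∀ x ∈ P, f x = c) :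
    vectorSpan ℝ P ≤ LinearMap.ker f := by
  refine Submodule.span_le.2 ?_
  rintro _ ⟨x, hx, y, hy, rfl⟩
  simp [h x hx, h y hy]

theorem exists_of_ne (h : Q ⊆ P) (hne : Q ≠ P) : ∃ x ∈ P, x ∉ Q := by
  by_contra! h'
  exact hne (h.antisymm h')

theorem sub_notMem_vectorSpan (hP : P ∈ C.lifts) (hQ : Q ∈ C.lifts) (h : Q ⊆ P)
    {x y : Fin g → ℝ} (hx : x ∈ Q) (hy : y ∈ P) (hy' : y ∉ Q) : x - y ∉ vectorSpan ℝ Q := by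
  obtain ⟨f, c, h1, h2⟩ := exists_form hP hQ h
  intro hm
  have h3 : f (x - y) = 0 := vectorSpan_le_ker (fun x hx => (h2 x (h hx)).2 hx) hm
  rw [map_sub, sub_eq_zero, (h2 x (h hx)).2 hx] at h3
  exact hy' ((h2 y hy).1 h3.symm)

theorem finrank_lt (hP : P ∈ C.lifts) (hQ : Q ∈ C.lifts) (h : Q ⊆ P) (hne : Q ≠ P) :
    finrank ℝ (vectorSpan ℝ Q) < finrank ℝ (vectorSpan ℝ P) := by
  obtain ⟨r, hr⟩ := nonempty_of_mem hQ
  obtain ⟨x, hx, hx'⟩ := exists_of_ne h hne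
  refine Submodule.finrank_lt_finrank_of_lt (lt_of_le_of_ne (vectorSpan_mono ℝ h) fun he => ?_)
  refine sub_notMem_vectorSpan hP hQ h hr hx hx' ?_
  rw [he]
  exact sub_mem_vectorSpan (h hr) hx

theorem eq_of_finrank_le (hP : P ∈ C.lifts) (hQ : Q ∈ C.lifts) (h : Q ⊆ P)
    (hd : finrank ℝ (vectorSpan ℝ P) ≤ finrank ℝ (vectorSpan ℝ Q)) : Q = P := by
  by_contra hne
  exact absurd (finrank_lt hP hQ h hne) (not_lt.2 hd)

theorem inter_mem (hP : P ∈ C.lifts) (hQ : Q ∈ C.lifts) (h : (P ∩ Q).Nonempty) :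
    P ∩ Q ∈ C.lifts := C.face_mem P hP _ h (C.inter P hP Q hQ h).1

variable (C) in
theorem finite_meeting {B : Set (Fin g → ℝ)} (hB : IsCompact B) :
    {F : C.lifts | ((F : Set (Fin g → ℝ)) ∩ B).Nonempty}.Finite :=
  C.locallyFinite.finite_nonempty_inter_compact hB

theorem finite_faces (hP : P ∈ C.lifts) : {F | F ∈ C.lifts ∧ F ⊆ P}.Finite := by
  refine ((finite_meeting C (isCompact_of_mem hP)).image Subtype.val).subset ?_
  rintro F ⟨hF, hFP⟩
  refine ⟨⟨F, hF⟩, ?_, rfl⟩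
  obtain ⟨x, hx⟩ := nonempty_of_mem hF
  exact ⟨x, hx, hFP hx⟩

/-- Tilt the supporting hyperplane of `R` about `R` until it hits `P` again. The number `t` is the
least slope `(μ - μ r) / (f - c)` among the spanning points of `P` off `R`, so `μ - t f` is minimal
on `R` and on a further point. The vector `v` shows that it is not constant on `P`. -/
theorem exists_rotate (hP : P ∈ C.lifts) (hR : R ∈ C.lifts) (h : R ⊆ P)
    {f : (Fin g → ℝ) →ₗ[ℝ] ℝ} {c : ℝ} (hf : ∀ x ∈ P, c ≤ f x) (hfR : ∀ x ∈ P, (f x = c ↔ x ∈ R))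
    {μ : (Fin g → ℝ) →ₗ[ℝ] ℝ} (hμ : vectorSpan ℝ R ≤ LinearMap.ker μ) {v : Fin g → ℝ}
    (hv : v ∈ vectorSpan ℝ P) (hfv : f v = 0) (hμv : μ v ≠ 0) {r : Fin g → ℝ} (hr : r ∈ R) :
    ∃ Q ∈ C.lifts, ∃ t : ℝ, R ⊆ Q ∧ Q ⊆ P ∧ Q ≠ R ∧ Q ≠ P ∧
      (∀ x ∈ P, t * (f x - c) ≤ μ x - μ r) ∧ ∀ x ∈ P, (x ∈ Q ↔ μ x - μ r = t * (f x - c)) := by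
  classical
  have hμR : ∀ x ∈ R, μ x = μ r := fun x hx => by
    have : μ (x - r) = 0 := hμ (sub_mem_vectorSpan hx hr)
    rwa [map_sub, sub_eq_zero] at this
  obtain ⟨s, hs, hPs⟩ := C.polytope P hP
  have hsP : ∀ x ∈ s, x ∈ P := fun x hx => by rw [hPs]; exact subset_convexHull ℝ _ hx
  have hne : (s.filter fun x => f x ≠ c).Nonempty := by
    by_contra hem
    rw [Finset.not_nonempty_iff_eq_empty, Finset.filter_eq_empty_iff] at hem
    push Not at hem
    have hPc : P ⊆ {x | f x = c} := by
      rw [hPs]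
      exact convexHull_min (fun x hx => hem hx) (convex_hyperplane f.isLinear c)
    exact hμv (hμ (vectorSpan_mono ℝ (fun x hx => (hfR x hx).1 (hPc hx)) hv))
  obtain ⟨x₁, hx₁, hmin⟩ := Finset.exists_min_image _ (fun x => (μ x - μ r) / (f x - c)) hne
  rw [Finset.mem_filter] at hx₁
  set t := (μ x₁ - μ r) / (f x₁ - c) with ht
  have hpos : ∀ x ∈ P, f x ≠ c → 0 < f x - c := fun x hx hxc =>
    sub_pos.2 (lt_of_le_of_ne (hf x hx) (Ne.symm hxc))
  have hP' : P ⊆ {x | μ r - t * c ≤ (μ - t • f) x} := by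
    rw [hPs]
    refine convexHull_min (fun x hx => ?_) (convex_halfSpace_ge (μ - t • f).isLinear _)
    simp only [Set.mem_ofPred_eq, LinearMap.sub_apply, LinearMap.smul_apply, smul_eq_mul]
    by_cases hxc : f x = c
    · rw [hxc, hμR x ((hfR x (hsP x hx)).1 hxc)]
    · have h1 := hmin x (Finset.mem_filter.2 ⟨hx, hxc⟩)
      rw [le_div_iff₀ (hpos x (hsP x hx) hxc)] at h1
      linarith
  have hrP := h hr
  have hrc : f r = c := (hfR r hrP).2 hr
  obtain ⟨Q, hQ, hQP, hQe⟩ := exists_face hP (μ - t • f) (μ r - t * c) (fun x hx => hP' hx)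
    ⟨r, hrP, by simp [hrc]⟩
  have hQe' : ∀ x ∈ P, (x ∈ Q ↔ μ x - μ r = t * (f x - c)) := fun x hx => by
    rw [hQe x hx]
    simp only [LinearMap.sub_apply, LinearMap.smul_apply, smul_eq_mul]
    constructor <;> intro h <;> linarith
  refine ⟨Q, hQ, t, fun x hx => ?_, hQP, ?_, ?_, fun x hx => ?_, hQe'⟩
  · rw [hQe' x (h hx), hμR x hx, (hfR x (h hx)).2 hx]
    simp
  · rintro rfl
    have hx₁P := hsP x₁ hx₁.1
    refine hx₁.2 ((hfR x₁ hx₁P).2 ((hQe' x₁ hx₁P).2 ?_))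
    rw [ht, div_mul_cancel₀]
    exact (hpos x₁ hx₁P hx₁.2).ne'
  · intro hQP'
    have := vectorSpan_le_ker (f := μ - t • f) (c := μ r - t * c)
      (fun x hx => (hQe x hx).1 (hQP' ▸ hx)) hv
    rw [LinearMap.mem_ker, LinearMap.sub_apply, LinearMap.smul_apply, hfv, smul_zero,
      sub_zero] at this
    exact hμv this
  · have := hP' hx
    simp only [Set.mem_ofPred_eq, LinearMap.sub_apply, LinearMap.smul_apply, smul_eq_mul] at this
    linarith

/-- Dimension count: `ker f` lowers the dimension of the span of `P` by at most one, so in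
codimension two a direction outside the span of `R` remains. -/
theorem exists_transverse (hd : finrank ℝ (vectorSpan ℝ R) + 2 ≤ finrank ℝ (vectorSpan ℝ P))
    (f : (Fin g → ℝ) →ₗ[ℝ] ℝ) : ∃ v ∈ vectorSpan ℝ P, f v = 0 ∧
      ∃ μ : (Fin g → ℝ) →ₗ[ℝ] ℝ, vectorSpan ℝ R ≤ LinearMap.ker μ ∧ μ v ≠ 0 := by
  have h1 := Submodule.finrank_sup_add_finrank_inf_eq (vectorSpan ℝ P) (LinearMap.ker f)
  have h2 := LinearMap.finrank_range_add_finrank_ker f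
  have h3 : finrank ℝ (LinearMap.range f) ≤ 1 := by
    simpa using Submodule.finrank_le (LinearMap.range f)
  have h4 := Submodule.finrank_le (vectorSpan ℝ P ⊔ LinearMap.ker f)
  have h5 : ¬ vectorSpan ℝ P ⊓ LinearMap.ker f ≤ vectorSpan ℝ R := fun h => by
    have := Submodule.finrank_mono h
    omega
  obtain ⟨v, hv, hv'⟩ := SetLike.not_le_iff_exists.1 h5
  obtain ⟨μ, hμ1, hμ2⟩ := Submodule.exists_le_ker_of_notMem hv'
  exact ⟨v, hv.1, hv.2, μ, hμ2, hμ1⟩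

theorem exists_proper_face (hP : P ∈ C.lifts) (hd : 0 < finrank ℝ (vectorSpan ℝ P)) :
    ∃ Q ∈ C.lifts, Q ⊆ P ∧ Q ≠ P := by
  have hns : ¬ P.Subsingleton := fun h => by
    rw [vectorSpan_of_subsingleton ℝ h, finrank_bot] at hd
    exact lt_irrefl _ hd
  obtain ⟨x, hx, y, hy, hxy⟩ := Set.not_subsingleton_iff.1 hns
  obtain ⟨i, hi⟩ := Function.ne_iff.1 hxy
  obtain ⟨z, hz, hzm⟩ := (isCompact_of_mem hP).exists_isMinOn ⟨x, hx⟩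
    (f := fun x : Fin g → ℝ => x i) (by fun_prop)
  obtain ⟨Q, hQ, hQP, hQe⟩ := exists_face hP (LinearMap.proj i) (z i) (fun x hx => hzm hx)
    ⟨z, hz, rfl⟩
  refine ⟨Q, hQ, hQP, ?_⟩
  rintro rfl
  exact hi (((hQe x hx).1 hx).trans ((hQe y hy).1 hy).symm)

/-- A proper face of codimension at least two is contained in a strictly larger proper face, by
tilting its hyperplane. -/
theorem exists_facet (hP : P ∈ C.lifts) {n : ℕ} (hd : finrank ℝ (vectorSpan ℝ P) = n + 1) :
    ∃ Q ∈ C.lifts, Q ⊆ P ∧ finrank ℝ (vectorSpan ℝ Q) = n := by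
  have key : ∀ k ≤ n, ∃ Q ∈ C.lifts, Q ⊆ P ∧ Q ≠ P ∧ k ≤ finrank ℝ (vectorSpan ℝ Q) := by
    intro k
    induction k with
    | zero =>
      intro _
      obtain ⟨Q, h1, h2, h3⟩ := exists_proper_face hP (by omega)
      exact ⟨Q, h1, h2, h3, Nat.zero_le _⟩
    | succ k ih =>
      intro hk
      obtain ⟨Q, hQ, hQP, hne, hkQ⟩ := ih (by omega)
      by_cases hlt : k + 1 ≤ finrank ℝ (vectorSpan ℝ Q)
      · exact ⟨Q, hQ, hQP, hne, hlt⟩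
      obtain ⟨f, c, hf, hfQ⟩ := exists_form hP hQ hQP
      obtain ⟨v, hv, hfv, μ, hμ, hμv⟩ := exists_transverse (P := P) (R := Q) (by omega) f
      obtain ⟨r, hr⟩ := nonempty_of_mem hQ
      obtain ⟨Q', hQ', t, h1, h2, h3, h4, -⟩ := exists_rotate hP hQ hQP hf hfQ hμ hv hfv hμv hr
      exact ⟨Q', hQ', h2, h4, by have := finrank_lt hQ' hQ h1 h3.symm; omega⟩
  obtain ⟨Q, hQ, hQP, hne, hn⟩ := key n le_rfl
  exact ⟨Q, hQ, hQP, by have := finrank_lt hP hQ hQP hne; omega⟩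

/-- A face of codimension two lies in exactly two facets. -/
theorem exists_two_facets (hP : P ∈ C.lifts) (hR : R ∈ C.lifts) (h : R ⊆ P)
    (hd : finrank ℝ (vectorSpan ℝ P) = finrank ℝ (vectorSpan ℝ R) + 2) :
    ∃ Q₁ ∈ C.lifts, ∃ Q₂ ∈ C.lifts, R ⊆ Q₁ ∧ R ⊆ Q₂ ∧ Q₁ ⊆ P ∧ Q₂ ⊆ P ∧
      finrank ℝ (vectorSpan ℝ Q₁) = finrank ℝ (vectorSpan ℝ R) + 1 ∧
      finrank ℝ (vectorSpan ℝ Q₂) = finrank ℝ (vectorSpan ℝ R) + 1 ∧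
      (∃ x ∈ Q₁, x ∉ Q₂) ∧ (∃ x ∈ Q₂, x ∉ Q₁) ∧
      ∀ Q ∈ C.lifts, R ⊆ Q → Q ⊆ P →
        finrank ℝ (vectorSpan ℝ Q) = finrank ℝ (vectorSpan ℝ R) + 1 → Q = Q₁ ∨ Q = Q₂ := by
  obtain ⟨f, c, hf, hfR⟩ := exists_form hP hR h
  obtain ⟨v, hv, hfv, μ, hμ, hμv⟩ := exists_transverse (P := P) (R := R) hd.ge f
  obtain ⟨r, hr⟩ := nonempty_of_mem hR
  obtain ⟨Q₁, hQ₁, t₁, hRQ₁, hQP₁, hne₁, hneP₁, hle₁, he₁⟩ :=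
    exists_rotate hP hR h hf hfR hμ hv hfv hμv hr
  obtain ⟨Q₂, hQ₂, t₂, hRQ₂, hQP₂, hne₂, hneP₂, hle₂, he₂⟩ :=
    exists_rotate (μ := -μ) hP hR h hf hfR (by rwa [LinearMap.ker_neg]) hv hfv (by simpa) hr
  simp only [LinearMap.neg_apply] at hle₂ he₂
  have d₁ := finrank_lt hQ₁ hR hRQ₁ hne₁.symm
  have d₁' := finrank_lt hP hQ₁ hQP₁ hneP₁
  have d₂ := finrank_lt hQ₂ hR hRQ₂ hne₂.symm
  have d₂' := finrank_lt hP hQ₂ hQP₂ hneP₂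
  have hpos : ∀ x ∈ P, x ∉ R → 0 < f x - c := fun x hx hxc =>
    sub_pos.2 (lt_of_le_of_ne (hf x hx) fun h => hxc ((hfR x hx).1 h.symm))
  obtain ⟨x₁, hx₁, hxR₁⟩ := exists_of_ne hRQ₁ hne₁.symm
  obtain ⟨x₂, hx₂, hxR₂⟩ := exists_of_ne hRQ₂ hne₂.symm
  have hφ₁ := hpos x₁ (hQP₁ hx₁) hxR₁
  have hφ₂ := hpos x₂ (hQP₂ hx₂) hxR₂
  have hm₁ := (he₁ x₁ (hQP₁ hx₁)).1 hx₁
  have hm₂ := (he₂ x₂ (hQP₂ hx₂)).1 hx₂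
  -- The slope of `μ` against `f` on `P` ranges between `t₁` and `-t₂`. If these did not differ in
  -- this order, `Q₁` would be all of `P`.
  have ht : t₁ < -t₂ := by
    rcases lt_or_ge t₁ (-t₂) with h | h
    · exact h
    exfalso
    obtain ⟨x, hx, hxQ⟩ := exists_of_ne hQP₁ hneP₁
    have h1 := hle₁ x hx
    have h2 := hle₂ x hx
    have h3 : 0 ≤ f x - c := sub_nonneg.2 (hf x hx)
    refine hxQ ((he₁ x hx).2 (le_antisymm ?_ h1))
    nlinarith
  refine ⟨Q₁, hQ₁, Q₂, hQ₂, hRQ₁, hRQ₂, hQP₁, hQP₂, by omega, by omega, ⟨x₁, hx₁, fun hx => ?_⟩,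
    ⟨x₂, hx₂, fun hx => ?_⟩, ?_⟩
  · have := (he₂ x₁ (hQP₁ hx₁)).1 hx
    nlinarith
  · have := (he₁ x₂ (hQP₂ hx₂)).1 hx
    nlinarith
  intro Q hQ hRQ hQP hdQ
  obtain ⟨x, hx, hxR⟩ := exists_of_ne hRQ (fun h => by rw [h] at hdQ; omega)
  have hφ := hpos x (hQP hx) hxR
  have hl₁ := hle₁ x (hQP hx)
  have hl₂ := hle₂ x (hQP hx)
  obtain ⟨χ, c', hχ, hχQ⟩ := exists_form hP hQ hQP
  have hD : 0 < -t₂ - t₁ := by linarith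
  -- Modulo the span of `R` the polytope lives in a plane with coordinates `f` and `μ`.
  have hker : vectorSpan ℝ P ⊓ LinearMap.ker f ⊓ LinearMap.ker μ = vectorSpan ℝ R := by
    symm
    refine Submodule.eq_of_le_of_finrank_le (le_inf (le_inf (vectorSpan_mono ℝ h)
      (vectorSpan_le_ker fun x hx => (hfR x (h hx)).2 hx)) hμ) ?_
    have l1 : finrank ℝ ↥(vectorSpan ℝ P ⊓ LinearMap.ker f) < finrank ℝ (vectorSpan ℝ P) := by
      refine Submodule.finrank_lt_finrank_of_lt (lt_of_le_of_ne inf_le_left fun he => ?_)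
      have : x - r ∈ vectorSpan ℝ P ⊓ LinearMap.ker f := by
        rw [he]; exact sub_mem_vectorSpan (hQP hx) (h hr)
      have h0 : f (x - r) = 0 := this.2
      rw [map_sub, (hfR r (h hr)).2 hr] at h0
      exact hφ.ne' h0
    have l2 : finrank ℝ ↥(vectorSpan ℝ P ⊓ LinearMap.ker f ⊓ LinearMap.ker μ) <
        finrank ℝ ↥(vectorSpan ℝ P ⊓ LinearMap.ker f) := by
      refine Submodule.finrank_lt_finrank_of_lt (lt_of_le_of_ne inf_le_left fun he => ?_)
      have : v ∈ vectorSpan ℝ P ⊓ LinearMap.ker f ⊓ LinearMap.ker μ := by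
        rw [he]; exact ⟨hv, hfv⟩
      exact hμv this.2
    omega
  -- In that plane `x - r` lies in the cone spanned by `x₁ - r` and `x₂ - r`. The coefficients `α`
  -- and `β` solve the two equations given by `f` and `μ`.
  set α := ((-t₂ * (f x - c) - (μ x - μ r)) / (-t₂ - t₁)) / (f x₁ - c) with hα
  set β := ((μ x - μ r - t₁ * (f x - c)) / (-t₂ - t₁)) / (f x₂ - c) with hβ
  have hα0 : 0 ≤ α := div_nonneg (div_nonneg (by linarith) hD.le) hφ₁.le
  have hβ0 : 0 ≤ β := div_nonneg (div_nonneg (by linarith) hD.le) hφ₂.le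
  have hαe : α * (f x₁ - c) = (-t₂ * (f x - c) - (μ x - μ r)) / (-t₂ - t₁) :=
    div_mul_cancel₀ _ hφ₁.ne'
  have hβe : β * (f x₂ - c) = (μ x - μ r - t₁ * (f x - c)) / (-t₂ - t₁) :=
    div_mul_cancel₀ _ hφ₂.ne'
  have hsum : α * (f x₁ - c) + β * (f x₂ - c) = f x - c := by
    rw [hαe, hβe, ← add_div, div_eq_iff hD.ne']; ring
  have hsum' : α * (μ x₁ - μ r) + β * (μ x₂ - μ r) = μ x - μ r := by
    have e2 : μ x₂ - μ r = -t₂ * (f x₂ - c) := by linarith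
    rw [hm₁, e2]
    have : α * (t₁ * (f x₁ - c)) + β * (-t₂ * (f x₂ - c)) =
      t₁ * (α * (f x₁ - c)) + -t₂ * (β * (f x₂ - c)) := by ring
    rw [this, hαe, hβe, ← mul_div_assoc, ← mul_div_assoc, ← add_div, div_eq_iff hD.ne']; ring
  have hrc : f r = c := (hfR r (h hr)).2 hr
  have hw : (x - r) - α • (x₁ - r) - β • (x₂ - r) ∈ vectorSpan ℝ R := by
    rw [← hker]
    refine ⟨⟨sub_mem (sub_mem (sub_mem_vectorSpan (hQP hx) (h hr))
      (Submodule.smul_mem _ _ (sub_mem_vectorSpan (hQP₁ hx₁) (h hr))))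
      (Submodule.smul_mem _ _ (sub_mem_vectorSpan (hQP₂ hx₂) (h hr))), ?_⟩, ?_⟩
    · simp only [SetLike.mem_coe, LinearMap.mem_ker, map_sub, map_smul, smul_eq_mul, hrc]
      linarith
    · simp only [SetLike.mem_coe, LinearMap.mem_ker, map_sub, map_smul, smul_eq_mul]
      linarith
  have hχw : χ ((x - r) - α • (x₁ - r) - β • (x₂ - r)) = 0 :=
    vectorSpan_le_ker (fun y hy => (hχQ y (h hy)).2 (hRQ hy)) hw
  simp only [map_sub, map_smul, smul_eq_mul, (hχQ x (hQP hx)).2 hx,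
    (hχQ r (h hr)).2 (hRQ hr)] at hχw
  have hc₁ := hχ x₁ (hQP₁ hx₁)
  have hc₂ := hχ x₂ (hQP₂ hx₂)
  have hz₁ : 0 ≤ α * (χ x₁ - c') := mul_nonneg hα0 (by linarith)
  have hz₂ : 0 ≤ β * (χ x₂ - c') := mul_nonneg hβ0 (by linarith)
  have fin : ∀ Q' ∈ C.lifts, R ⊆ Q' →
      finrank ℝ (vectorSpan ℝ Q') = finrank ℝ (vectorSpan ℝ R) + 1 →
      ∀ y ∈ Q', y ∉ R → y ∈ Q → Q = Q' := by
    intro Q' hQ' hRQ' hd' y hy hyR hyQ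
    have hm := inter_mem hQ hQ' ⟨y, hyQ, hy⟩
    have hlt := finrank_lt hm hR (Set.subset_inter hRQ hRQ') (fun h => hyR (h ▸ ⟨hyQ, hy⟩))
    have e1 := eq_of_finrank_le hQ hm Set.inter_subset_left (by omega)
    have e2 := eq_of_finrank_le hQ' hm Set.inter_subset_right (by omega)
    exact e1.symm.trans e2
  -- The form `χ - c'` is nonnegative on `P` and vanishes at `x`, so it vanishes at whichever of
  -- `x₁`, `x₂` has a positive coefficient. There `Q` meets `Q₁` or `Q₂` outside `R`, and equality
  -- follows by dimension.
  by_cases hα1 : α = 0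
  · have hβ1 : β ≠ 0 := fun h0 => by rw [hα1, h0] at hsum; simp at hsum; linarith
    have : β * (χ x₂ - c') = 0 := by linarith
    have hx2 := (mul_eq_zero.1 this).resolve_left hβ1
    exact Or.inr (fin Q₂ hQ₂ hRQ₂ (by omega) x₂ hx₂ hxR₂
      ((hχQ x₂ (hQP₂ hx₂)).1 (by linarith)))
  · have : α * (χ x₁ - c') = 0 := by linarith
    have hx1 := (mul_eq_zero.1 this).resolve_left hα1
    exact Or.inl (fin Q₁ hQ₁ hRQ₁ (by omega) x₁ hx₁ hxR₁
      ((hχQ x₁ (hQP₁ hx₁)).1 (by linarith)))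

end Faces

end PolyhedralStructure

/-! ### Multivectors of a linear subspace -/

section Lines

variable {E : Type} [AddCommGroup E] [Module ℝ E]

theorem extMap_wedgeProd {F : Type} [AddCommGroup F] [Module ℝ F] (q : ℕ) (f : E →ₗ[ℝ] F)
    (u : Fin q → E) : extMap ℝ q f (wedgeProd ℝ q u) = wedgeProd ℝ q (f ∘ u) :=
  exteriorPower.map_apply_ιMulti f u

theorem wedge_extMap {F : Type} [AddCommGroup F] [Module ℝ F] (q : ℕ) (f : E →ₗ[ℝ] F) (u : E)
    (w : ExtPow ℝ q E) : wedge ℝ q (f u) (extMap ℝ q f w) = extMap ℝ (q + 1) f (wedge ℝ q u w) := by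
  refine LinearMap.congr_fun (f := (wedge ℝ q (f u)).comp (extMap ℝ q f))
    (g := (extMap ℝ (q + 1) f).comp (wedge ℝ q u)) (extPow_ext fun v => ?_) w
  simp only [LinearMap.comp_apply, extMap_wedgeProd, wedge_wedgeProd]
  congr 1
  ext i
  refine Fin.cases ?_ (fun i => ?_) i <;> rfl

theorem extMap_inclusion {q : ℕ} {V W : Submodule ℝ E} (h : V ≤ W) (a : ExtPow ℝ q V) :
    extMap ℝ q V.subtype a = extMap ℝ q W.subtype (extMap ℝ q (Submodule.inclusion h) a) := by
  refine LinearMap.congr_fun (f := extMap ℝ q V.subtype)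
    (g := (extMap ℝ q W.subtype).comp (extMap ℝ q (Submodule.inclusion h)))
    (extPow_ext fun v => ?_) a
  rw [LinearMap.comp_apply, extMap_wedgeProd, extMap_wedgeProd, extMap_wedgeProd]
  congr 1

theorem wedge_mem_range {q : ℕ} {V W : Submodule ℝ E} (h : V ≤ W) {u : E} (hu : u ∈ W)
    {w : ExtPow ℝ q E} (hw : w ∈ LinearMap.range (extMap ℝ q V.subtype)) :
    wedge ℝ q u w ∈ LinearMap.range (extMap ℝ (q + 1) W.subtype) := by
  obtain ⟨a, rfl⟩ := hw
  rw [extMap_inclusion h]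
  have := wedge_extMap q W.subtype ⟨u, hu⟩ (extMap ℝ q (Submodule.inclusion h) a)
  rw [Submodule.subtype_apply] at this
  rw [this]
  exact LinearMap.mem_range_self _ _

theorem contr_eq_zero {q : ℕ} {V : Submodule ℝ E} {f : E →ₗ[ℝ] ℝ} (hf : V ≤ LinearMap.ker f)
    {w : ExtPow ℝ (q + 1) E} (hw : w ∈ LinearMap.range (extMap ℝ (q + 1) V.subtype)) :
    contr f q w = 0 := by
  obtain ⟨a, rfl⟩ := hw
  refine LinearMap.congr_fun (f := (contr f q).comp (extMap ℝ (q + 1) V.subtype))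
    (g := 0) (extPow_ext fun v => ?_) a
  simp only [LinearMap.comp_apply, extMap_wedgeProd, contr_wedgeProd, LinearMap.zero_apply]
  refine Finset.sum_eq_zero fun k _ => ?_
  have : f (v k) = 0 := hf (v k).2
  simp [this]

/-- Recovers `w` from `u ∧ w`, and so converts questions about the sign of `u ∧ w` into the sign of
the number `f u`. -/
theorem contr_wedge_of_mem {q : ℕ} {V : Submodule ℝ E} {f : E →ₗ[ℝ] ℝ} (hf : V ≤ LinearMap.ker f)
    {w : ExtPow ℝ q E} (hw : w ∈ LinearMap.range (extMap ℝ q V.subtype)) (u : E) :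
    contr f q (wedge ℝ q u w) = f u • w := by
  cases q with
  | zero => exact contr_wedge_zero f u w
  | succ q => rw [contr_wedge, contr_eq_zero hf hw, map_zero, sub_zero]

theorem exists_smul_eq [FiniteDimensional ℝ E] {q : ℕ} {V : Submodule ℝ E} (hV : finrank ℝ V = q)
    {w w' : ExtPow ℝ q E} (hw : w ∈ LinearMap.range (extMap ℝ q V.subtype)) (h0 : w ≠ 0)
    (hw' : w' ∈ LinearMap.range (extMap ℝ q V.subtype)) : ∃ c : ℝ, w' = c • w := by
  obtain ⟨a, rfl⟩ := hw
  obtain ⟨b, rfl⟩ := hw'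
  have ha : a ≠ 0 := fun h => h0 (by rw [h, map_zero])
  have h1 : finrank ℝ (ExtPow ℝ q V) = 1 := by
    have := exteriorPower.finrank_eq ℝ q (M := V)
    rw [hV, Nat.choose_self] at this
    exact this
  obtain ⟨c, hc⟩ := (finrank_eq_one_iff_of_nonzero' a ha).1 h1 b
  exact ⟨c, by rw [← hc, map_smul]⟩

end Lines

theorem sign_sum_eq_zero {a b c d : ℤ} (ha : a = 1 ∨ a = -1) (hb : b = 1 ∨ b = -1)
    (hc : c = 1 ∨ c = -1) (hd : d = 1 ∨ d = -1) {x y : ℝ} (hx : 0 < x) (hy : 0 < y)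
    (h : (a : ℝ) * b * x + c * d * y = 0) : a * b + c * d = 0 := by
  rcases ha with rfl | rfl <;> rcases hb with rfl | rfl <;> rcases hc with rfl | rfl <;>
    rcases hd with rfl | rfl <;> norm_num at h ⊢ <;> linarith

namespace PolyhedralStructure

variable {g : ℕ} {C : PolyhedralStructure g}

/-! ## Signs -/

section Signs

variable (o : C.Orientation)

theorem sgn_eq_or {q : ℕ} (P : C.Lift (q + 1)) (Q : C.Lift q) : o.sgn P Q = 1 ∨ o.sgn P Q = -1 := by
  unfold Orientation.sgn
  split_ifs <;> simp

theorem exists_wedge_eq {q : ℕ} {P : C.Lift (q + 1)} {Q : C.Lift q} (h : Q.1 ⊆ P.1)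
    {x y : Fin g → ℝ} (hx : x ∈ Q.1) (hy : y ∈ P.1) :
    ∃ c : ℝ, wedge ℝ q (x - y) (o.vec Q) = c • o.vec P :=
  exists_smul_eq P.2.2 (o.vec_mem P) (o.vec_ne_zero P)
    (wedge_mem_range (vectorSpan_mono ℝ h) (sub_mem_vectorSpan (h hx) hy) (o.vec_mem Q))

/-- A form cutting out `Q` is negative on every outward vector `x - y`. Contracting with it shows
that the coefficient of `o.vec P` is nonzero and that its sign is the same for all choices of `x`
and `y`. So the sign defined by existence may be computed with any pair of points. -/
theorem sgn_spec {q : ℕ} {P : C.Lift (q + 1)} {Q : C.Lift q} (h : Q.1 ⊆ P.1)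
    {x y : Fin g → ℝ} (hx : x ∈ Q.1) (hy : y ∈ P.1) (hy' : y ∉ Q.1) :
    ∃ c : ℝ, 0 < c ∧ wedge ℝ q (x - y) (o.vec Q) = ((o.sgn P Q : ℝ) * c) • o.vec P := by
  obtain ⟨f, a, hf, hfQ⟩ := exists_form P.2.1 Q.2.1 h
  have hker : vectorSpan ℝ Q.1 ≤ LinearMap.ker f :=
    vectorSpan_le_ker fun x hx => (hfQ x (h hx)).2 hx
  have hneg : ∀ x ∈ Q.1, ∀ y ∈ P.1, y ∉ Q.1 → f (x - y) < 0 := by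
    intro x hx y hy hy'
    rw [map_sub, (hfQ x (h hx)).2 hx]
    have := lt_of_le_of_ne (hf y hy) fun h => hy' ((hfQ y hy).1 h.symm)
    linarith
  obtain ⟨c, hce⟩ := exists_wedge_eq o h hx hy
  have hcf := contr_wedge_of_mem hker (o.vec_mem Q) (x - y)
  rw [hce, map_smul] at hcf
  have hc0 : c ≠ 0 := by
    rintro rfl
    rw [zero_smul] at hcf
    rcases smul_eq_zero.1 hcf.symm with h' | h'
    · exact (hneg x hx y hy hy').ne h'
    · exact o.vec_ne_zero Q h'
  have key : ∀ x' ∈ Q.1, ∀ y' ∈ P.1 \ Q.1, ∀ c' : ℝ,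
      wedge ℝ q (x' - y') (o.vec Q) = c' • o.vec P → 0 < c' → 0 < c := by
    intro x' hx' y' hy'' c' hce' hc'
    have hcf' := contr_wedge_of_mem hker (o.vec_mem Q) (x' - y')
    rw [hce', map_smul] at hcf'
    have e : (c' * f (x - y)) • o.vec Q = (c * f (x' - y')) • o.vec Q := by
      rw [mul_smul, ← hcf, mul_smul, ← hcf', smul_comm]
    have e' := smul_left_injective ℝ (o.vec_ne_zero Q) e
    have h1 := hneg x hx y hy hy'
    have h2 := hneg x' hx' y' hy''.1 hy''.2
    by_contra hneg'
    have h3 : c < 0 := lt_of_le_of_ne (not_lt.1 hneg') hc0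
    nlinarith [mul_pos_of_neg_of_neg h3 h2, mul_neg_of_pos_of_neg hc' h1]
  unfold Orientation.sgn
  split_ifs with hs
  · obtain ⟨x', hx', y', hy'', c', hc', he⟩ := hs
    exact ⟨c, key x' hx' y' hy'' c' he hc', by rw [hce]; simp⟩
  · refine ⟨-c, ?_, by rw [hce]; simp⟩
    have : ¬ 0 < c := fun h' => hs ⟨x, hx, y, ⟨hy, hy'⟩, c, h', hce⟩
    have := lt_of_le_of_ne (not_lt.1 this) hc0
    linarith

theorem sgn_vadd {q : ℕ} (n : Fin g → ℤ) (P : C.Lift (q + 1)) (Q : C.Lift q) :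
    o.sgn (n +ᵥ P) (n +ᵥ Q) = o.sgn P Q := by
  unfold Orientation.sgn
  have : (∃ x ∈ (n +ᵥ Q).1, ∃ y ∈ (n +ᵥ P).1 \ (n +ᵥ Q).1, ∃ c : ℝ, 0 < c ∧
      wedge ℝ q (x - y) (o.vec (n +ᵥ Q)) = c • o.vec (n +ᵥ P)) ↔
      ∃ x ∈ Q.1, ∃ y ∈ P.1 \ Q.1, ∃ c : ℝ, 0 < c ∧
      wedge ℝ q (x - y) (o.vec Q) = c • o.vec P := by
    constructor
    · rintro ⟨_, ⟨x, hx, rfl⟩, _, ⟨⟨y, hy, rfl⟩, hy'⟩, c, hc, h⟩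
      refine ⟨x, hx, y, ⟨hy, fun h' => hy' ⟨y, h', rfl⟩⟩, c, hc, ?_⟩
      rw [o.vec_vadd, o.vec_vadd] at h
      simpa using h
    · rintro ⟨x, hx, y, ⟨hy, hy'⟩, c, hc, h⟩
      refine ⟨intEmb g n +ᵥ x, ⟨x, hx, rfl⟩, intEmb g n +ᵥ y, ⟨⟨y, hy, rfl⟩, ?_⟩, c, hc, ?_⟩
      · rintro ⟨z, hz, hzy⟩
        exact hy' (vadd_left_cancel _ hzy ▸ hz)
      · rw [o.vec_vadd, o.vec_vadd]
        simpa using h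
  by_cases hs : ∃ x ∈ Q.1, ∃ y ∈ P.1 \ Q.1, ∃ c : ℝ, 0 < c ∧
      wedge ℝ q (x - y) (o.vec Q) = c • o.vec P
  · rw [if_pos (this.2 hs), if_pos hs]
  · rw [if_neg (fun h => hs (this.1 h)), if_neg hs]

open Classical in
/-- The sign of an oriented point. -/
def eps (P : C.Lift 0) : ℤ := if ∃ c : ℝ, 0 < c ∧ o.vec P = c • wedgeProd ℝ 0 ![] then 1 else -1

theorem eps_eq_or (P : C.Lift 0) : eps o P = 1 ∨ eps o P = -1 := by
  unfold eps
  split_ifs <;> simp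

theorem eps_spec (P : C.Lift 0) :
    ∃ c : ℝ, 0 < c ∧ o.vec P = ((eps o P : ℝ) * c) • wedgeProd ℝ 0 ![] := by
  have he : o.vec P = extZero (o.vec P) • wedgeProd ℝ 0 ![] := by
    apply extZero.injective
    rw [map_smul, extZero_wedgeProd, smul_eq_mul, mul_one]
  have h0 : extZero (o.vec P) ≠ 0 := fun h => o.vec_ne_zero P (by rw [he, h, zero_smul])
  unfold eps
  split_ifs with h
  · obtain ⟨c, hc, h⟩ := h
    exact ⟨c, hc, by rw [h]; simp⟩
  · refine ⟨-extZero (o.vec P), ?_, ?_⟩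
    · have : ¬ 0 < extZero (o.vec P) := fun h' => h ⟨_, h', he⟩
      have := lt_of_le_of_ne (not_lt.1 this) h0
      linarith
    · conv_lhs => rw [he]
      simp

theorem eps_vadd (n : Fin g → ℤ) (P : C.Lift 0) : eps o (n +ᵥ P) = eps o P := by
  unfold eps
  rw [o.vec_vadd]

theorem smul_eq_smul_cross {E : Type} [AddCommGroup E] [Module ℝ E] {w v : E} (hv : v ≠ 0)
    {a b c d : ℝ} (h : a • w = b • v) (h' : c • w = d • v) : a * d = c * b := by
  have : (a * d) • v = (c * b) • v := by
    rw [mul_smul, ← h', mul_smul, ← h, smul_comm]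
  exact smul_left_injective ℝ hv this

/-- An edge has two end points, with opposite signs. -/
theorem exists_endpoints (P : C.Lift 1) : ∃ Q₁ Q₂ : C.Facet P, Q₁ ≠ Q₂ ∧
    (∀ Q : C.Facet P, Q = Q₁ ∨ Q = Q₂) ∧
    o.sgn P Q₁.1 * eps o Q₁.1 + o.sgn P Q₂.1 * eps o Q₂.1 = 0 := by
  have hP := P.2.1
  have hd := P.2.2
  have hns : ¬ P.1.Subsingleton := fun h => by
    rw [vectorSpan_of_subsingleton ℝ h, finrank_bot] at hd
    omega
  obtain ⟨a, ha, b, hb, hab⟩ := Set.not_subsingleton_iff.1 hns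
  obtain ⟨i, hi⟩ := Function.ne_iff.1 hab
  let f : (Fin g → ℝ) →ₗ[ℝ] ℝ := LinearMap.proj i
  have hcont : ContinuousOn (fun x : Fin g → ℝ => x i) P.1 := by fun_prop
  obtain ⟨x₁, hx₁, hm₁⟩ := (isCompact_of_mem hP).exists_isMinOn ⟨a, ha⟩ hcont
  obtain ⟨x₂, hx₂, hm₂⟩ := (isCompact_of_mem hP).exists_isMaxOn ⟨a, ha⟩ hcont
  have hlt : f x₁ < f x₂ := by
    rcases lt_or_gt_of_ne hi with h | h
    · exact (hm₁ ha).trans_lt (h.trans_le (hm₂ hb))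
    · exact (hm₁ hb).trans_lt (h.trans_le (hm₂ ha))
  obtain ⟨Q₁, hQ₁, hQP₁, he₁⟩ := exists_face hP f (f x₁) (fun x hx => hm₁ hx) ⟨x₁, hx₁, rfl⟩
  obtain ⟨Q₂, hQ₂, hQP₂, he₂⟩ := exists_face hP (-f) (-f x₂)
    (fun x hx => neg_le_neg (hm₂ hx)) ⟨x₂, hx₂, rfl⟩
  have he₂' : ∀ x ∈ P.1, (x ∈ Q₂ ↔ f x = f x₂) := fun x hx => by
    rw [he₂ x hx, LinearMap.neg_apply, neg_inj]
  have hxQ₁ : x₁ ∈ Q₁ := (he₁ x₁ hx₁).2 rfl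
  have hxQ₂ : x₂ ∈ Q₂ := (he₂' x₂ hx₂).2 rfl
  have hxQ₁' : x₁ ∉ Q₂ := fun h => hlt.ne ((he₂' x₁ hx₁).1 h)
  have hxQ₂' : x₂ ∉ Q₁ := fun h => hlt.ne' ((he₁ x₂ hx₂).1 h)
  have d₁ := finrank_lt hP hQ₁ hQP₁ fun h => hxQ₂' (h ▸ hx₂)
  have d₂ := finrank_lt hP hQ₂ hQP₂ fun h => hxQ₁' (h ▸ hx₁)
  let q₁ : C.Lift 0 := ⟨Q₁, hQ₁, by omega⟩
  let q₂ : C.Lift 0 := ⟨Q₂, hQ₂, by omega⟩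
  refine ⟨⟨q₁, hQP₁⟩, ⟨q₂, hQP₂⟩, ?_, ?_, ?_⟩
  · intro h
    have : Q₁ = Q₂ := congrArg (fun Q : C.Facet P => Q.1.1) h
    exact hxQ₁' (this ▸ hxQ₁)
  · rintro ⟨Q, hQP⟩
    have hv : x₂ - x₁ ∈ vectorSpan ℝ P.1 := sub_mem_vectorSpan hx₂ hx₁
    have hv0 : (⟨x₂ - x₁, hv⟩ : vectorSpan ℝ P.1) ≠ 0 := fun h => by
      have : x₂ - x₁ = 0 := congrArg Subtype.val h
      rw [sub_eq_zero] at this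
      exact hlt.ne (by rw [this])
    have hmul : ∀ t ∈ vectorSpan ℝ P.1, ∃ c : ℝ, t = c • (x₂ - x₁) := fun t ht => by
      obtain ⟨c, hc⟩ := (finrank_eq_one_iff_of_nonzero' _ hv0).1 hd ⟨t, ht⟩
      exact ⟨c, (congrArg Subtype.val hc).symm⟩
    obtain ⟨χ, c', hχ, hχQ⟩ := exists_form hP Q.2.1 hQP
    obtain ⟨r, hr⟩ := nonempty_of_mem Q.2.1
    have hχr := (hχQ r (hQP hr)).2 hr
    have same : ∀ Q' : C.Lift 0, r ∈ Q'.1 → Q = Q' := by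
      intro Q' hr'
      have hm := inter_mem Q.2.1 Q'.2.1 ⟨r, hr, hr'⟩
      have e1 := eq_of_finrank_le Q.2.1 hm Set.inter_subset_left (by rw [Q.2.2]; omega)
      have e2 := eq_of_finrank_le Q'.2.1 hm Set.inter_subset_right (by rw [Q'.2.2]; omega)
      exact Subtype.ext (e1.symm.trans e2)
    have hfv : 0 < f (x₂ - x₁) := by rw [map_sub]; linarith
    -- All of `P` runs in the direction `x₂ - x₁`. The sign of `χ` on it tells at which end `χ` is
    -- minimal, and the value zero would give `Q = P`.
    rcases lt_trichotomy (χ (x₂ - x₁)) 0 with h | h | h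
    · right
      refine Subtype.ext (same q₂ ((he₂' r (hQP hr)).2 (le_antisymm (hm₂ (hQP hr)) ?_)))
      obtain ⟨c, hc⟩ := hmul (x₂ - r) (sub_mem_vectorSpan hx₂ (hQP hr))
      have h1 : χ (x₂ - r) = c * χ (x₂ - x₁) := by rw [hc, map_smul, smul_eq_mul]
      have h2 : f (x₂ - r) = c * f (x₂ - x₁) := by rw [hc, map_smul, smul_eq_mul]
      rw [map_sub, hχr] at h1
      have h3 := hχ x₂ hx₂
      have h4 : c ≤ 0 := by
        by_contra hc'
        nlinarith [mul_neg_of_pos_of_neg (not_le.1 hc') h]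
      have h5 : f (x₂ - r) = f x₂ - f r := map_sub _ _ _
      nlinarith [mul_nonneg (neg_nonneg.2 h4) hfv.le]
    · exfalso
      have hall : ∀ y ∈ P.1, y ∈ Q.1 := fun y hy => by
        obtain ⟨c, hc⟩ := hmul (y - r) (sub_mem_vectorSpan hy (hQP hr))
        have h1 : χ (y - r) = c * χ (x₂ - x₁) := by rw [hc, map_smul, smul_eq_mul]
        rw [h, mul_zero, map_sub, sub_eq_zero, hχr] at h1
        exact (hχQ y hy).1 h1
      have : Q.1 = P.1 := hQP.antisymm hall
      have h0 := Q.2.2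
      rw [this, hd] at h0
      omega
    · left
      refine Subtype.ext (same q₁ ((he₁ r (hQP hr)).2 (le_antisymm ?_ (hm₁ (hQP hr)))))
      obtain ⟨c, hc⟩ := hmul (x₁ - r) (sub_mem_vectorSpan hx₁ (hQP hr))
      have h1 : χ (x₁ - r) = c * χ (x₂ - x₁) := by rw [hc, map_smul, smul_eq_mul]
      have h2 : f (x₁ - r) = c * f (x₂ - x₁) := by rw [hc, map_smul, smul_eq_mul]
      rw [map_sub, hχr] at h1
      have h3 := hχ x₁ hx₁
      have h4 : 0 ≤ c := by
        by_contra hc'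
        nlinarith [mul_neg_of_neg_of_pos (not_le.1 hc') h]
      have h5 : f (x₁ - r) = f x₁ - f r := map_sub _ _ _
      nlinarith [mul_nonneg h4 hfv.le]
  -- The outward vectors `x₁ - x₂` and `x₂ - x₁` at the two ends are opposite, which gives the
  -- opposite signs.
  · obtain ⟨c₁, hc₁, e₁⟩ := sgn_spec o (P := P) (Q := q₁) hQP₁ hxQ₁ hx₂ hxQ₂'
    obtain ⟨c₂, hc₂, e₂⟩ := sgn_spec o (P := P) (Q := q₂) hQP₂ hxQ₂ hx₁ hxQ₁'
    obtain ⟨k₁, hk₁, v₁⟩ := eps_spec o q₁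
    obtain ⟨k₂, hk₂, v₂⟩ := eps_spec o q₂
    rw [v₁, map_smul, ← neg_sub, map_neg, LinearMap.neg_apply, smul_neg, ← neg_smul] at e₁
    rw [v₂, map_smul] at e₂
    have := smul_eq_smul_cross (o.vec_ne_zero P) e₁ e₂
    rcases sgn_eq_or o P q₁ with h1 | h1 <;> rcases sgn_eq_or o P q₂ with h2 | h2 <;>
      rcases eps_eq_or o q₁ with h3 | h3 <;> rcases eps_eq_or o q₂ with h4 | h4 <;>
      simp only [h1, h2, h3, h4] at this ⊢ <;> norm_num at this ⊢ <;>
      nlinarith [mul_pos hk₁ hc₂, mul_pos hk₂ hc₁]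

open Classical in
/-- The incidence number of two lifted cells. -/
def inc {q : ℕ} (P : C.Lift (q + 1)) (Q : C.Lift q) : ℤ := if Q.1 ⊆ P.1 then o.sgn P Q else 0

/-- With `x₁` only in `Q₁` and `x₂` only in `Q₂`, the vectors `r - x₁` and `r - x₂` serve both as
outward vectors of `R` in the facets and, exchanged, as outward vectors of the facets in `P`. The
antisymmetry of the wedge product gives the cancellation behind `∂∂ = 0`. -/
theorem exists_diamond {q : ℕ} (P : C.Lift (q + 2)) (R : C.Lift q) (h : R.1 ⊆ P.1) :
    ∃ Q₁ Q₂ : C.Facet P, Q₁ ≠ Q₂ ∧ (∀ Q : C.Facet P, R.1 ⊆ Q.1.1 → Q = Q₁ ∨ Q = Q₂) ∧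
    o.sgn P Q₁.1 * inc o Q₁.1 R + o.sgn P Q₂.1 * inc o Q₂.1 R = 0 := by
  have hP := P.2.1
  have hR := R.2.1
  obtain ⟨Q₁, hQ₁, Q₂, hQ₂, hR₁, hR₂, hP₁, hP₂, d₁, d₂, ⟨x₁, hx₁, hx₁'⟩, ⟨x₂, hx₂, hx₂'⟩, huniq⟩ :=
    exists_two_facets hP hR h (by rw [P.2.2, R.2.2])
  rw [R.2.2] at d₁ d₂
  let q₁ : C.Lift (q + 1) := ⟨Q₁, hQ₁, d₁⟩
  let q₂ : C.Lift (q + 1) := ⟨Q₂, hQ₂, d₂⟩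
  refine ⟨⟨q₁, hP₁⟩, ⟨q₂, hP₂⟩, ?_, ?_, ?_⟩
  · intro h
    have : Q₁ = Q₂ := congrArg (fun Q : C.Facet P => Q.1.1) h
    exact hx₁' (this ▸ hx₁)
  · rintro ⟨Q, hQP⟩ hRQ
    rcases huniq Q.1 Q.2.1 hRQ hQP (by rw [Q.2.2, R.2.2]) with h | h
    · exact Or.inl (Subtype.ext (Subtype.ext h))
    · exact Or.inr (Subtype.ext (Subtype.ext h))
  · have i₁ : inc o q₁ R = o.sgn q₁ R := if_pos hR₁
    have i₂ : inc o q₂ R = o.sgn q₂ R := if_pos hR₂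
    rw [i₁, i₂]
    obtain ⟨r, hr⟩ := nonempty_of_mem hR
    obtain ⟨c₁, hc₁, e₁⟩ := sgn_spec o (P := q₁) (Q := R) hR₁ hr hx₁ fun h => hx₁' (hR₂ h)
    obtain ⟨c₂, hc₂, e₂⟩ := sgn_spec o (P := q₂) (Q := R) hR₂ hr hx₂ fun h => hx₂' (hR₁ h)
    obtain ⟨k₁, hk₁, f₁⟩ := sgn_spec o (P := P) (Q := q₁) hP₁ (hR₁ hr) (hP₂ hx₂) hx₂'
    obtain ⟨k₂, hk₂, f₂⟩ := sgn_spec o (P := P) (Q := q₂) hP₂ (hR₂ hr) (hP₁ hx₁) hx₁'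
    have hsw := wedge_wedge_swap q (r - x₂) (r - x₁) (o.vec R)
    rw [e₁, e₂, map_smul, map_smul, f₁, f₂, ← neg_smul, smul_smul, smul_smul] at hsw
    have := smul_left_injective ℝ (o.vec_ne_zero P) hsw
    refine sign_sum_eq_zero (sgn_eq_or _ _ _) (sgn_eq_or _ _ _) (sgn_eq_or _ _ _)
      (sgn_eq_or _ _ _) (mul_pos hk₁ hc₁) (mul_pos hk₂ hc₂) ?_
    linarith

end Signs

/-! ## The cellular chain complex of the universal cover -/

section LiftChains

variable (o : C.Orientation) (R : Type) (A : Type) [CommRing R] [AddCommGroup A] [Module R A]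

instance instFintypeFacet {q : ℕ} (P : C.Lift (q + 1)) : Fintype (C.Facet P) := Fintype.ofFinite _

/-- The boundary map on chains of lifted cells. -/
def bdy (q : ℕ) : (C.Lift (q + 1) →₀ A) →ₗ[R] (C.Lift q →₀ A) :=
  Finsupp.lsum R fun P => ∑ Q : C.Facet P, o.sgn P Q.1 • Finsupp.lsingle Q.1

/-- The augmentation. -/
def aug : (C.Lift 0 →₀ A) →ₗ[R] A := Finsupp.lsum R fun P => eps o P • LinearMap.id

variable {R A}

theorem bdy_single (q : ℕ) (P : C.Lift (q + 1)) (a : A) :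
    bdy o R A q (Finsupp.single P a) = ∑ Q : C.Facet P, o.sgn P Q.1 • Finsupp.single Q.1 a := by
  rw [bdy, Finsupp.lsum_single, LinearMap.sum_apply]
  rfl

theorem aug_single (P : C.Lift 0) (a : A) :
    aug o R A (Finsupp.single P a) = eps o P • a := by
  rw [aug, Finsupp.lsum_single]
  rfl

theorem bdy_single_apply (q : ℕ) (P : C.Lift (q + 1)) (a : A) (Q : C.Lift q) :
    bdy o R A q (Finsupp.single P a) Q = inc o P Q • a := by
  classical
  rw [bdy_single, Finsupp.finsetSum_apply, inc]
  split_ifs with h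
  · refine (Finset.sum_eq_single (⟨Q, h⟩ : C.Facet P) ?_ ?_).trans ?_
    · intro Q' _ hne
      rw [Finsupp.smul_apply, Finsupp.single_eq_of_ne, smul_zero]
      exact fun h' => hne (Subtype.ext h'.symm)
    · exact fun h' => absurd (Finset.mem_univ (α := C.Facet P) _) h'
    · simp
  · rw [zero_smul]
    refine Finset.sum_eq_zero fun Q' _ => ?_
    rw [Finsupp.smul_apply, Finsupp.single_eq_of_ne, smul_zero]
    exact fun h' => h (h' ▸ Q'.2)

theorem aug_bdy (z : C.Lift 1 →₀ A) : aug o R A (bdy o R A 0 z) = 0 := by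
  induction z using Finsupp.induction_linear with
  | zero => simp
  | add a b ha hb => simp only [map_add, ha, hb, add_zero]
  | single P a =>
    obtain ⟨Q₁, Q₂, hne, huniq, hs⟩ := exists_endpoints o P
    rw [bdy_single, map_sum, Finset.sum_eq_add Q₁ Q₂ hne
      (fun Q _ hQ => by rcases huniq Q with h | h <;> simp_all) (by simp) (by simp)]
    rw [map_zsmul, map_zsmul, aug_single, aug_single, smul_smul, smul_smul, ← add_smul, hs,
      zero_smul]

theorem bdy_bdy (q : ℕ) (z : C.Lift (q + 2) →₀ A) : bdy o R A q (bdy o R A (q + 1) z) = 0 := by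
  classical
  induction z using Finsupp.induction_linear with
  | zero => simp
  | add a b ha hb => simp only [map_add, ha, hb, add_zero]
  | single P a =>
    ext T
    rw [bdy_single, map_sum, Finsupp.finsetSum_apply, Finsupp.zero_apply]
    have e : ∀ Q : C.Facet P, bdy o R A q (o.sgn P Q.1 • Finsupp.single Q.1 a) T =
        (o.sgn P Q.1 * inc o Q.1 T) • a := fun Q => by
      rw [map_zsmul, Finsupp.smul_apply, bdy_single_apply, smul_smul]
    simp only [e]
    by_cases hT : T.1 ⊆ P.1
    · obtain ⟨Q₁, Q₂, hne, huniq, hs⟩ := exists_diamond o P T hT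
      rw [Finset.sum_eq_add Q₁ Q₂ hne (fun Q _ hQ => ?_) (by simp) (by simp), ← add_smul, hs,
        zero_smul]
      have : inc o Q.1 T = 0 := if_neg fun h => by rcases huniq Q h with h | h <;> simp_all
      rw [this, mul_zero, zero_smul]
    · refine Finset.sum_eq_zero fun Q _ => ?_
      have : inc o Q.1 T = 0 := if_neg fun h => hT (h.trans Q.2)
      rw [this, mul_zero, zero_smul]

end LiftChains

end PolyhedralStructure

namespace PolyhedralStructure

variable {g : ℕ} {C : PolyhedralStructure g}

/-! ## Acyclicity of the universal cover -/

section Augmented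

variable (C) in
/-- The terms of the augmented cellular complex of the universal cover. -/
def AugChain (A : Type) [AddCommGroup A] : ℕ → Type
  | 0 => A
  | n + 1 => C.Lift n →₀ A

instance (A : Type) [AddCommGroup A] : ∀ n, AddCommGroup (AugChain C A n)
  | 0 => inferInstanceAs (AddCommGroup A)
  | n + 1 => inferInstanceAs (AddCommGroup (C.Lift n →₀ A))

variable (o : C.Orientation) (R : Type) (A : Type) [CommRing R] [AddCommGroup A] [Module R A]

/-- The differential of the augmented cellular complex of the universal cover. -/
def augD : ∀ n, AugChain C A (n + 1) →+ AugChain C A n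
  | 0 => (aug o R A).toAddMonoidHom
  | n + 1 => (bdy o R A n).toAddMonoidHom

theorem augD_augD : ∀ (n : ℕ) (x : AugChain C A (n + 2)),
    augD o R A n (augD o R A (n + 1) x) = 0
  | 0, x => aug_bdy o x
  | n + 1, x => bdy_bdy o n x

/-- Augmented chains supported in a set of cells. -/
def augSupp (S : Set (Set (Fin g → ℝ))) : ∀ n, AddSubgroup (AugChain C A n)
  | 0 => condSub A S.Nonempty
  | n + 1 => (Finsupp.supported A ℤ {F : C.Lift n | F.1 ∈ S}).toAddSubgroup

variable {A}

theorem mem_augSupp_succ {S : Set (Set (Fin g → ℝ))} {n : ℕ} {z : C.Lift n →₀ A} :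
    (show AugChain C A (n + 1) from z) ∈ augSupp A S (n + 1) ↔
      ∀ F : C.Lift n, z F ≠ 0 → F.1 ∈ S := by
  change z ∈ Finsupp.supported A ℤ {F : C.Lift n | F.1 ∈ S} ↔ _
  rw [Finsupp.mem_supported]
  exact ⟨fun h F hF => h (Finsupp.mem_support_iff.2 hF), fun h F hF =>
    h F (Finsupp.mem_support_iff.1 hF)⟩

theorem augSupp_mono {S T : Set (Set (Fin g → ℝ))} (h : S ⊆ T) :
    ∀ n, augSupp (C := C) A S n ≤ augSupp A T n
  | 0 => condSub_mono fun h' => h'.mono h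
  | _ + 1 => fun _ hz => mem_augSupp_succ.2 fun F hF => h (mem_augSupp_succ.1 hz F hF)

theorem bdy_apply_ne_zero {n : ℕ} {z : C.Lift (n + 1) →₀ A} {Q : C.Lift n}
    (h : bdy o R A n z Q ≠ 0) : ∃ P, z P ≠ 0 ∧ Q.1 ⊆ P.1 := by
  classical
  by_contra! h'
  apply h
  rw [← z.sum_single, Finsupp.sum, map_sum, Finsupp.finsetSum_apply]
  refine Finset.sum_eq_zero fun P hP => ?_
  rw [bdy_single_apply]
  have : inc o P Q = 0 := if_neg (h' P (Finsupp.mem_support_iff.1 hP))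
  rw [this, zero_smul]

theorem augD_mem {S : Set (Set (Fin g → ℝ))}
    (hS : ∀ P ∈ S, ∀ F ∈ C.lifts, F ⊆ P → F ∈ S) :
    ∀ (n : ℕ), ∀ z ∈ augSupp A S (n + 1), augD o R A n z ∈ augSupp A S n
  | 0, z, hz => by
    intro h
    by_contra hne
    have : (show C.Lift 0 →₀ A from z) = 0 := by
      ext F
      by_contra hF
      exact hne ⟨_, mem_augSupp_succ.1 hz F hF⟩
    apply h
    have hz' : z = 0 := this
    rw [hz']
    exact map_zero _
  | n + 1, z, hz => by
    refine mem_augSupp_succ.2 fun F hF => ?_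
    obtain ⟨P, hP, hFP⟩ := bdy_apply_ne_zero o R hF
    exact hS P.1 (mem_augSupp_succ.1 hz P hP) F.1 F.2.1 hFP

variable (C) in
/-- The cells in `S` that lie in all members of a list. -/
def cellsIn (S : Set (Set (Fin g → ℝ))) (s : List S) : Set (Set (Fin g → ℝ)) :=
  {F ∈ S | ∀ P ∈ s, F ⊆ P.1}

variable (C) in
/-- The faces of a lifted cell. -/
def faces (P : Set (Fin g → ℝ)) : Set (Set (Fin g → ℝ)) := {F ∈ C.lifts | F ⊆ P}

theorem listInter_mem {S : Set (Set (Fin g → ℝ))} (hS : S ⊆ C.lifts) (s : List S) (hs : s ≠ [])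
    {x : Fin g → ℝ} (hx : ∀ P ∈ s, x ∈ P.1) : {y | ∀ P ∈ s, y ∈ P.1} ∈ C.lifts := by
  induction s with
  | nil => exact absurd rfl hs
  | cons P s ih =>
    by_cases hs' : s = []
    · subst hs'
      simpa using hS P.2
    · have h1 := ih hs' fun Q hQ => hx Q (List.mem_cons_of_mem _ hQ)
      have h2 := inter_mem (hS P.2) h1
        ⟨x, hx P List.mem_cons_self, fun Q hQ => hx Q (List.mem_cons_of_mem _ hQ)⟩
      convert h2 using 1
      ext y
      simp

theorem exactOn_augSupp_empty : ExactOn (augD o R A) (augSupp A ∅) := by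
  intro n x hx _
  refine ⟨0, zero_mem _, ?_⟩
  rw [map_zero]
  cases n with
  | zero =>
    by_contra h
    exact Set.not_nonempty_empty (hx fun h' => h h'.symm)
  | succ n =>
    symm
    change (show C.Lift n →₀ A from x) = 0
    ext F
    by_contra hF
    exact mem_augSupp_succ.1 hx F hF

/-- In the double complex of chains on the cells common to a list, a nonempty column is zero or
belongs to the faces of the intersection, which is again a cell. The row of coefficients in degree
zero is the nerve. Every other row splits into one part for each cell `F`, and coning with `F`
itself contracts that part. -/
theorem exactOn_of_nerve {S : Set (Set (Fin g → ℝ))} (hS : S ⊆ C.lifts)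
    (hdown : ∀ P ∈ S, ∀ F ∈ C.lifts, F ⊆ P → F ∈ S)
    (hface : ∀ P ∈ S, ExactOn (augD o R A) (augSupp A (faces C P)))
    (hN : AcycL A fun s : List S => (cellsIn S s).Nonempty) :
    ExactOn (augD o R A) (augSupp A S) := by
  classical
  have hnil : cellsIn S [] = S := by simp [cellsIn]
  have key := exactOn_of_bicomplex (d := augD o R A)
    (S := fun s : List S => augSupp A (cellsIn S s))
    (fun s t n h => augSupp_mono (show cellsIn S s ⊆ cellsIn S t from
      fun F hF => ⟨hF.1, fun P hP => hF.2 P (h hP)⟩) n)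
    (augD_augD o R A)
    (fun s n => augD_mem o R (S := cellsIn S s) (fun P hP F hF h => ⟨hdown P hP.1 F hF h,
      fun Q hQ => h.trans (hP.2 Q hQ)⟩) n)
    (fun s hs => by
      by_cases hx : ∃ x, ∀ P ∈ s, x ∈ P.1
      · obtain ⟨x, hx⟩ := hx
        have hm := listInter_mem hS s hs hx
        obtain ⟨P, hP⟩ := List.exists_mem_of_ne_nil s hs
        have hsub : {y | ∀ P ∈ s, y ∈ P.1} ⊆ P.1 := fun y hy => hy P hP
        have e : cellsIn S s = faces C {y | ∀ P ∈ s, y ∈ P.1} := by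
          ext F
          constructor
          · rintro ⟨hF, h⟩
            exact ⟨hS hF, fun y hy Q hQ => h Q hQ hy⟩
          · rintro ⟨hF, h⟩
            exact ⟨hdown P.1 P.2 F hF (h.trans hsub), fun Q hQ y hy => h hy Q hQ⟩
        simp only [e]
        exact hface _ (hdown P.1 P.2 _ hm hsub)
      · have e : cellsIn S s = ∅ := by
          refine Set.eq_empty_iff_forall_notMem.2 ?_
          rintro F ⟨hF, h⟩
          obtain ⟨y, hy⟩ := nonempty_of_mem (hS hF)
          exact hx ⟨y, fun P hP => h P hP hy⟩
        simp only [e]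
        exact exactOn_augSupp_empty o R)
    (fun n z hz hdz => by
      cases n with
      | zero => exact hN z hz hdz
      | succ n =>
        change List S →₀ (C.Lift n →₀ A) at z
        -- `Pr F` isolates the part at the cell `F`. It commutes with `dL`, since it only touches
        -- coefficients.
        let pr : C.Lift n → (C.Lift n →₀ A) →+ (C.Lift n →₀ A) := fun F =>
          (Finsupp.singleAddHom F).comp (Finsupp.applyAddHom F)
        let Pr : C.Lift n → (List S →₀ (C.Lift n →₀ A)) →+ (List S →₀ (C.Lift n →₀ A)) := fun F =>
          dV (X := fun _ => C.Lift n →₀ A) (fun _ => pr F) 0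
        have hPr : ∀ F y, dL (Pr F y) = Pr F (dL y) := fun F y =>
          (dV_dL (X := fun _ => C.Lift n →₀ A) (fun _ => pr F) 0 y).symm
        have hPra : ∀ F s, Pr F z s = Finsupp.single F (z s F) := fun F s =>
          dV_apply (X := fun _ => C.Lift n →₀ A) (fun _ => pr F) 0 z s
        let T := z.support.biUnion fun s => (z s).support
        have hzT : ∑ F ∈ T, Pr F z = z := by
          ext s F
          rw [Finsupp.finsetSum_apply, Finsupp.finsetSum_apply]
          simp only [hPra]
          by_cases hF : z s F = 0
          · rw [hF]
            refine Finset.sum_eq_zero fun G _ => ?_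
            by_cases hG : G = F
            · rw [hG, hF]; simp
            · rw [Finsupp.single_eq_of_ne (Ne.symm hG)]
          · rw [Finset.sum_eq_single F (fun G _ hG => Finsupp.single_eq_of_ne (Ne.symm hG))]
            · simp
            · intro hF'
              refine absurd ?_ hF'
              have hs : s ∈ z.support := Finsupp.mem_support_iff.2 fun h => hF (by rw [h]; rfl)
              exact Finset.mem_biUnion.2 ⟨s, hs, Finsupp.mem_support_iff.2 hF⟩
        have hmem : ∀ s F, z s F ≠ 0 → F.1 ∈ cellsIn S s := fun s F hF =>
          mem_augSupp_succ.1 (hz s) F hF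
        have hTS : ∀ F ∈ T, F.1 ∈ S := fun F hF => by
          obtain ⟨s, -, hs⟩ := Finset.mem_biUnion.1 hF
          exact (hmem s F (Finsupp.mem_support_iff.1 hs)).1
        refine ⟨∑ F ∈ T.attach, coneL (⟨F.1.1, hTS F.1 F.2⟩ : S) (Pr F.1 z),
          sum_mem fun F _ => coneL_mem _ fun s => ?_, ?_⟩
        · refine mem_augSupp_succ.2 fun G hG => ?_
          replace hG : Finsupp.single F.1 (z s F.1) G ≠ 0 := by
            rw [← hPra]
            exact hG
          have hGF : G = F.1 := by
            by_contra hne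
            exact hG (Finsupp.single_eq_of_ne hne)
          subst hGF
          rw [Finsupp.single_eq_same] at hG
          have := hmem s _ hG
          refine ⟨this.1, fun Q hQ => ?_⟩
          rcases List.mem_cons.1 hQ with rfl | hQ
          · exact subset_rfl
          · exact this.2 Q hQ
        · rw [map_sum]
          have e : ∀ F : {x // x ∈ T}, dL (coneL (⟨F.1.1, hTS F.1 F.2⟩ : S) (Pr F.1 z)) =
              Pr F.1 z := fun F => by
            have hdz' : dL z = 0 := hdz
            rw [dL_coneL, hPr, hdz', map_zero, map_zero, sub_zero]
          exact (Finset.sum_congr rfl fun F _ => e F).trans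
            ((Finset.sum_attach T fun F => Pr F z).trans hzT))
  simp only [hnil] at key
  exact key

end Augmented

end PolyhedralStructure

/-! ## Central projections -/

section CentralProjection

variable {n : ℕ} (l : (Fin n → ℝ) →ₗ[ℝ] ℝ) (y : Fin n → ℝ)

/-- The central projection from `y` to a level set of `l`. -/
def centralProj (x : Fin n → ℝ) : Fin n → ℝ := (l x - l y)⁻¹ • (x - y)

variable {l y}

theorem eq_of_centralProj_eq {x x' : Fin n → ℝ} (hx : l y < l x)
    (h : centralProj l y x = centralProj l y x') :
    x - y = ((l x - l y) / (l x' - l y)) • (x' - y) := by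
  have h0 : l x - l y ≠ 0 := (sub_pos.2 hx).ne'
  have := congrArg ((l x - l y) • ·) h
  simp only [centralProj, smul_smul, mul_inv_cancel₀ h0, one_smul] at this
  rw [this, div_eq_mul_inv]

theorem centralProj_add_smul {x : Fin n → ℝ} {t : ℝ} (ht : t ≠ 0) :
    centralProj l y (y + t • (x - y)) = centralProj l y x := by
  simp only [centralProj, map_add, map_smul, map_sub, add_sub_cancel_left, smul_eq_mul, smul_smul]
  congr 1
  by_cases h : l x - l y = 0
  · simp [h]
  · field_simp

/-- A projective map takes segments to segments. The weights of the preimage are divided by the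
heights of the end points over `y` and renormalised by `D`. -/
theorem convex_image_centralProj {K : Set (Fin n → ℝ)} (hK : Convex ℝ K)
    (hl : ∀ x ∈ K, l y < l x) : Convex ℝ (centralProj l y '' K) := by
  rintro _ ⟨x, hx, rfl⟩ _ ⟨x', hx', rfl⟩ s t hs ht hst
  have h1 : 0 < l x - l y := sub_pos.2 (hl x hx)
  have h2 : 0 < l x' - l y := sub_pos.2 (hl x' hx')
  have h3 : 0 < s / (l x - l y) + t / (l x' - l y) := by
    rcases hs.eq_or_lt with rfl | hs'
    · have : t = 1 := by linarith
      subst this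
      simpa using h2
    · have := div_pos hs' h1
      have := div_nonneg ht h2.le
      linarith
  set D := s / (l x - l y) + t / (l x' - l y) with hD
  refine ⟨(s / (l x - l y) / D) • x + (t / (l x' - l y) / D) • x', hK hx hx' (by positivity)
    (by positivity) (by rw [← add_div, ← hD, div_self h3.ne']), ?_⟩
  have e1 : s / (l x - l y) / D + t / (l x' - l y) / D = 1 := by
    rw [← add_div, ← hD, div_self h3.ne']
  have e2 : (s / (l x - l y) / D) • x + (t / (l x' - l y) / D) • x' - y =
      D⁻¹ • ((s / (l x - l y)) • (x - y) + (t / (l x' - l y)) • (x' - y)) := by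
    ext i
    simp only [Pi.sub_apply, Pi.add_apply, Pi.smul_apply, smul_eq_mul]
    linear_combination y i * e1
  have e3 : l ((s / (l x - l y) / D) • x + (t / (l x' - l y) / D) • x') - l y = D⁻¹ := by
    rw [← map_sub, e2, map_smul, map_add, map_smul, map_smul, map_sub, map_sub, smul_eq_mul,
      smul_eq_mul, smul_eq_mul, div_mul_cancel₀ _ h1.ne', div_mul_cancel₀ _ h2.ne', hst, mul_one]
  rw [centralProj, e3, e2, inv_inv, smul_smul, mul_inv_cancel₀ h3.ne', one_smul]
  simp only [centralProj, smul_smul, div_eq_mul_inv]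

theorem continuousOn_centralProj {K : Set (Fin n → ℝ)} (hl : ∀ x ∈ K, l y < l x) :
    ContinuousOn (centralProj l y) K := by
  have hc : Continuous l := l.continuous_of_finiteDimensional
  refine ContinuousOn.smul (f := fun x => (l x - l y)⁻¹) (g := fun x => x - y)
    (ContinuousOn.inv₀ (hc.sub continuous_const).continuousOn fun x hx => ?_)
    (continuous_id.sub continuous_const).continuousOn
  exact (sub_pos.2 (hl x hx)).ne'

/-- A point outside a compact convex set is separated from it by a supporting hyperplane at a
nearest point. -/
theorem exists_support {P : Set (Fin n → ℝ)} (hPc : IsCompact P) (hPv : Convex ℝ P)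
    (hPn : P.Nonempty) {x : Fin n → ℝ} (hx : x ∉ P) :
    ∃ (f : (Fin n → ℝ) →ₗ[ℝ] ℝ), ∃ p ∈ P, dist x p = Metric.infDist x P ∧ f x < f p ∧
      ∀ z ∈ P, f p ≤ f z := by
  obtain ⟨p, hp, hpd⟩ := hPc.exists_infDist_eq_dist hPn x
  have hd : 0 < Metric.infDist x P := (hPc.isClosed.notMem_iff_infDist_pos hPn).1 hx
  obtain ⟨f, u, h1, h2⟩ := geometric_hahn_banach_open (convex_ball x (Metric.infDist x P))
    Metric.isOpen_ball hPv Metric.disjoint_ball_infDist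
  have h3 : f p ≤ u := by
    have hcl : p ∈ closure (Metric.ball x (Metric.infDist x P)) := by
      rw [closure_ball x hd.ne', Metric.mem_closedBall, dist_comm, hpd]
    exact closure_minimal (fun z hz => (h1 z hz).le)
      (isClosed_Iic.preimage f.continuous) hcl
  exact ⟨f, p, hp, hpd.symm, (h1 x (Metric.mem_ball_self hd)).trans_le (h2 p hp), fun z hz =>
    h3.trans (h2 z hz)⟩

end CentralProjection

/-! ### Faces seen from a point beyond a facet -/

namespace PolyhedralStructure

variable {g : ℕ} {C : PolyhedralStructure g} {P Q : Set (Fin g → ℝ)}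

/-- The centroid of the spanning points: where a form attains its minimum at the centroid, it
attains it at every one of these points. -/
theorem exists_interior_point (hQ : Q ∈ C.lifts) :
    ∃ b ∈ Q, ∀ P ∈ C.lifts, ∀ F ∈ C.lifts, F ⊆ P → Q ⊆ P → b ∈ F → Q ⊆ F := by
  classical
  obtain ⟨s, hs, hQs⟩ := C.polytope Q hQ
  have hsQ : ∀ x ∈ s, x ∈ Q := fun x hx => by rw [hQs]; exact subset_convexHull ℝ _ hx
  have hc : (0 : ℝ) < s.card := by exact_mod_cast hs.card_pos
  have hb : ∀ f : (Fin g → ℝ) →ₗ[ℝ] ℝ,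
      f ((s.card : ℝ)⁻¹ • ∑ x ∈ s, x) = (s.card : ℝ)⁻¹ * ∑ x ∈ s, f x := fun f => by
    rw [map_smul, map_sum, smul_eq_mul]
  refine ⟨(s.card : ℝ)⁻¹ • ∑ x ∈ s, x, ?_, fun P hP F hF hFP hQP hbF => ?_⟩
  · rw [Finset.smul_sum]
    refine (convex_of_mem hQ).sum_mem (fun _ _ => (inv_pos.2 hc).le) ?_ hsQ
    rw [Finset.sum_const, nsmul_eq_mul, mul_inv_cancel₀ hc.ne']
  · obtain ⟨f, c, h1, h2⟩ := exists_form hP hF hFP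
    have h3 := (h2 _ (hFP hbF)).2 hbF
    rw [hb, inv_mul_eq_iff_eq_mul₀ hc.ne'] at h3
    have h4 : ∑ x ∈ s, (f x - c) = 0 := by
      rw [Finset.sum_sub_distrib, h3, Finset.sum_const, nsmul_eq_mul, sub_self]
    have h5 := (Finset.sum_eq_zero_iff_of_nonneg fun x hx =>
      sub_nonneg.2 (h1 x (hQP (hsQ x hx)))).1 h4
    rw [hQs]
    exact convexHull_min (fun x hx => (h2 x (hQP (hsQ x hx))).1 (sub_eq_zero.1 (h5 x hx)))
      (convex_of_mem hF)

variable (C) in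
/-- The proper faces of `P` other than `Q`. -/
def others (P Q : Set (Fin g → ℝ)) : Set (Set (Fin g → ℝ)) :=
  {F ∈ C.lifts | F ⊆ P ∧ F ≠ P ∧ F ≠ Q}

theorem eq_of_facet_subset (hP : P ∈ C.lifts) (hQ : Q ∈ C.lifts)
    (hd : finrank ℝ (vectorSpan ℝ P) = finrank ℝ (vectorSpan ℝ Q) + 1) {F : Set (Fin g → ℝ)}
    (hF : F ∈ C.lifts) (hQF : Q ⊆ F) (hFP : F ⊆ P) (hne : F ≠ P) : F = Q :=
  (eq_of_finrank_le hF hQ hQF (by have := finrank_lt hP hF hFP hne; omega)).symm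

theorem others_down (hP : P ∈ C.lifts) (hQ : Q ∈ C.lifts)
    (hd : finrank ℝ (vectorSpan ℝ P) = finrank ℝ (vectorSpan ℝ Q) + 1) :
    ∀ F ∈ others C P Q, ∀ F' ∈ C.lifts, F' ⊆ F → F' ∈ others C P Q := by
  rintro F ⟨hF, hFP, hne, hneQ⟩ F' hF' h
  refine ⟨hF', h.trans hFP, ?_, ?_⟩
  · rintro rfl
    exact hne (hFP.antisymm h)
  · rintro rfl
    exact hneQ (eq_of_facet_subset hP hQ hd hF h hFP hne)

/-- A point beyond the facet `Q` of `P` and no other one. -/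
theorem exists_beyond (hP : P ∈ C.lifts) (hQ : Q ∈ C.lifts) (hQP : Q ⊆ P)
    (hd : finrank ℝ (vectorSpan ℝ P) = finrank ℝ (vectorSpan ℝ Q) + 1) :
    ∃ (l : (Fin g → ℝ) →ₗ[ℝ] ℝ) (y : Fin g → ℝ), (∀ x ∈ P, l y < l x) ∧
      (∀ F ∈ others C P Q, ∃ (f : (Fin g → ℝ) →ₗ[ℝ] ℝ) (c : ℝ), (∀ x ∈ P, c ≤ f x) ∧
        (∀ x ∈ P, (f x = c ↔ x ∈ F)) ∧ c < f y) ∧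
      ∀ (f : (Fin g → ℝ) →ₗ[ℝ] ℝ) (c : ℝ), (∀ x ∈ P, c ≤ f x) → (∀ x ∈ Q, f x = c) → f y ≤ c := by
  classical
  obtain ⟨b, hb, hbF⟩ := exists_interior_point hQ
  have hne : Q ≠ P := by rintro rfl; omega
  obtain ⟨c₀, hc₀, hc₀'⟩ := exists_of_ne hQP hne
  obtain ⟨l, a, hl1, hl2⟩ := exists_form hP hQ hQP
  have hlb : l b = a := (hl2 b (hQP hb)).2 hb
  have hlc : a < l c₀ := lt_of_le_of_ne (hl1 c₀ hc₀) fun h => hc₀' ((hl2 c₀ hc₀).1 h.symm)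
  have hform : ∀ F : others C P Q, ∃ (f : (Fin g → ℝ) →ₗ[ℝ] ℝ) (c : ℝ), (∀ x ∈ P, c ≤ f x) ∧
        (∀ x ∈ P, (f x = c ↔ x ∈ F.1)) := fun F => exists_form hP F.2.1 F.2.2.1
  choose f c hf1 hf2 using hform
  have hfb : ∀ F, c F < f F b := fun F => by
    refine lt_of_le_of_ne (hf1 F b (hQP hb)) fun h => F.2.2.2.2 ?_
    exact eq_of_facet_subset hP hQ hd F.2.1
      (hbF P hP F.1 F.2.1 F.2.2.1 hQP ((hf2 F b (hQP hb)).1 h.symm)) F.2.2.1 F.2.2.2.1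
  have hfin : Finite (others C P Q) :=
    ((finite_faces hP).subset fun F hF => ⟨hF.1, hF.2.1⟩).to_subtype
  -- The point is pushed out of `P` through the relative interior point `b` of `Q`. For small `ε`
  -- the finitely many strict inequalities at `b` survive.
  have hε : ∃ ε : ℝ, 0 < ε ∧ ∀ F, c F < f F (b - ε • (c₀ - b)) := by
    have : ∀ᶠ ε in nhdsWithin (0 : ℝ) (Set.Ioi 0), ∀ F, c F < f F (b - ε • (c₀ - b)) := by
      refine Filter.eventually_all.2 fun F => nhdsWithin_le_nhds ?_
      have hcont : Continuous fun ε : ℝ => f F (b - ε • (c₀ - b)) := by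
        simp only [map_sub, map_smul, smul_eq_mul]
        fun_prop
      refine hcont.continuousAt.eventually (lt_mem_nhds ?_)
      simpa using hfb F
    obtain ⟨ε, h1, h2⟩ := (this.and self_mem_nhdsWithin).exists
    exact ⟨ε, h2, h1⟩
  obtain ⟨ε, hε, hεF⟩ := hε
  refine ⟨l, b - ε • (c₀ - b), fun x hx => ?_, fun F hF => ⟨f ⟨F, hF⟩, c ⟨F, hF⟩, hf1 _, hf2 _,
    hεF _⟩, fun h u hu hQu => ?_⟩
  · refine lt_of_lt_of_le ?_ (hl1 x hx)
    rw [map_sub, map_smul, map_sub, hlb, smul_eq_mul]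
    have := mul_pos hε (sub_pos.2 hlc)
    linarith
  · rw [map_sub, map_smul, map_sub, hQu b hb, smul_eq_mul]
    have := mul_nonneg hε.le (sub_nonneg.2 (hu c₀ hc₀))
    linarith

/-- The faces other than `Q` are visible from a point beyond `Q` in every direction of `P`. -/
theorem exists_exit (hP : P ∈ C.lifts) (hQP : Q ⊆ P) {l : (Fin g → ℝ) →ₗ[ℝ] ℝ} {y : Fin g → ℝ}
    (hl : ∀ x ∈ P, l y < l x)
    (hy : ∀ (f : (Fin g → ℝ) →ₗ[ℝ] ℝ) (c : ℝ), (∀ x ∈ P, c ≤ f x) → (∀ x ∈ Q, f x = c) → f y ≤ c)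
    {x₀ : Fin g → ℝ} (hx₀ : x₀ ∈ P) :
    ∃ F ∈ others C P Q, ∃ x ∈ F, centralProj l y x = centralProj l y x₀ := by
  have hPc := isCompact_of_mem hP
  have hlc : Continuous l := l.continuous_of_finiteDimensional
  have hZ : IsCompact {x ∈ P | centralProj l y x = centralProj l y x₀} := by
    have := (continuousOn_centralProj hl).preimage_isClosed_of_isClosed hPc.isClosed
      (isClosed_singleton (x := centralProj l y x₀))
    exact hPc.of_isClosed_subset this fun x hx => hx.1
  -- The last point of `P` on the ray lies on one of the other faces. Otherwise, a point `x'`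
  -- slightly further on the ray is outside `P`, and a supporting face at the point of `P` nearest
  -- to `x'` must contain `Q`. The point `y` is then weakly on the outer side of its hyperplane, so
  -- moving away from `y` cannot cross that hyperplane outwards.
  obtain ⟨x, ⟨hxP, hxρ⟩, hmax⟩ := hZ.exists_isMaxOn ⟨x₀, hx₀, rfl⟩ hlc.continuousOn
  by_contra hcon
  push Not at hcon
  have hxo : ∀ F ∈ others C P Q, x ∉ F := fun F hF hxF => hcon F hF x hxF hxρ
  have hfin : (others C P Q).Finite := (finite_faces hP).subset fun F hF => ⟨hF.1, hF.2.1⟩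
  have hcl : IsClosed (⋃₀ others C P Q) := by
    rw [Set.sUnion_eq_biUnion]
    exact hfin.isClosed_biUnion fun F hF => (isCompact_of_mem hF.1).isClosed
  have hxU : x ∈ (⋃₀ others C P Q)ᶜ := by
    rintro ⟨F, hF, hxF⟩
    exact hxo F hF hxF
  obtain ⟨δ, hδ, hball⟩ := Metric.isOpen_iff.1 hcl.isOpen_compl x hxU
  have hnorm : 0 < ‖x - y‖ + 1 := by positivity
  set t : ℝ := δ / 2 / (‖x - y‖ + 1) with ht
  have ht0 : 0 < t := by positivity
  have htn : t * ‖x - y‖ < δ / 2 := by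
    rw [ht, div_mul_eq_mul_div, div_lt_iff₀ hnorm]
    have : 0 < δ / 2 := by positivity
    nlinarith
  set x' := x + t • (x - y) with hx'
  have hx'e : x' = y + (1 + t) • (x - y) := by rw [hx', add_smul, one_smul]; abel
  have hx'P : x' ∉ P := fun h => by
    have h1 : l x' ≤ l x := hmax ⟨h, by rw [hx'e, centralProj_add_smul (by positivity), hxρ]⟩
    rw [hx', map_add, map_smul, map_sub, smul_eq_mul] at h1
    have := mul_pos ht0 (sub_pos.2 (hl x hxP))
    linarith
  obtain ⟨f, p, hp, hpd, hfx, hfP⟩ := exists_support hPc (convex_of_mem hP) ⟨x, hxP⟩ hx'P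
  obtain ⟨F, hF, hFP, hFm⟩ := exists_face hP f (f p) hfP ⟨p, hp, rfl⟩
  have hxx' : dist x' x < δ / 2 := by
    rw [dist_eq_norm, hx', add_sub_cancel_left, norm_smul, Real.norm_of_nonneg ht0.le]
    exact htn
  have hpx : dist p x < δ := by
    have h1 : dist x' p ≤ dist x' x := hpd ▸ Metric.infDist_le_dist_of_mem hxP
    have h2 := dist_triangle_left p x x'
    linarith
  have hFo : F ∉ others C P Q := fun h =>
    hball (Metric.mem_ball.2 hpx) ⟨F, h, (hFm p hp).2 rfl⟩
  have hQF : Q ⊆ F := by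
    by_cases h1 : F = P
    · rwa [h1]
    · by_cases h2 : F = Q
      · rw [h2]
      · exact absurd ⟨hF, hFP, h1, h2⟩ hFo
  have h3 := hy f (f p) hfP fun z hz => (hFm z (hQP hz)).1 (hQF hz)
  have h4 := hfP x hxP
  have h5 : f x' = f x + t * (f x - f y) := by
    rw [hx', map_add, map_smul, map_sub, smul_eq_mul]
  have h6 : 0 ≤ t * (f x - f y) := mul_nonneg ht0.le (by linarith)
  linarith

/-- Since the point lies strictly on the inner side of all the other faces, each of these is met at
the far end of its ray (`key`). So the projection is injective on their union, and their images have
the same nerve. They are convex and cover the image of `P`, so the nerve theorem applies. -/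
theorem acycL_others (A : Type) [AddCommGroup A] (hP : P ∈ C.lifts) (hQ : Q ∈ C.lifts) (hQP : Q ⊆ P)
    (hd : finrank ℝ (vectorSpan ℝ P) = finrank ℝ (vectorSpan ℝ Q) + 1) :
    AcycL A fun s : List (others C P Q) => (cellsIn (others C P Q) s).Nonempty := by
  obtain ⟨l, y, hl, hF, hy⟩ := exists_beyond hP hQ hQP hd
  have hfin : Finite (others C P Q) :=
    ((finite_faces hP).subset fun F hF => ⟨hF.1, hF.2.1⟩).to_subtype
  have key : ∀ F ∈ others C P Q, ∀ x ∈ F, ∀ x' ∈ P, centralProj l y x = centralProj l y x' →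
      l x' ≤ l x := by
    intro F hFo x hx x' hx' he
    obtain ⟨f, c, h1, h2, h3⟩ := hF F hFo
    have hxP := hFo.2.1 hx
    have e := eq_of_centralProj_eq (hl x' hx') he.symm
    have h4 : f x = c := (h2 x hxP).2 hx
    have h5 := congrArg f e
    rw [map_smul, map_sub, map_sub, h4, smul_eq_mul] at h5
    have h6 := h1 x' hx'
    have h7 : 0 < l x - l y := sub_pos.2 (hl x hxP)
    by_contra hlt
    push Not at hlt
    have h8 : 1 < (l x' - l y) / (l x - l y) := by
      rw [one_lt_div h7]
      linarith
    nlinarith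
  have hinj : ∀ F ∈ others C P Q, ∀ F' ∈ others C P Q, ∀ x ∈ F, ∀ x' ∈ F',
      centralProj l y x = centralProj l y x' → x = x' := by
    intro F hFo F' hFo' x hx x' hx' he
    have h1 : l x = l x' := le_antisymm (key F' hFo' x' hx' x (hFo.2.1 hx) he.symm)
      (key F hFo x hx x' (hFo'.2.1 hx') he)
    have e := eq_of_centralProj_eq (hl x (hFo.2.1 hx)) he
    rw [h1, div_self (sub_pos.2 (hl x' (hFo'.2.1 hx'))).ne', one_smul] at e
    exact sub_left_injective e
  have hPl : ∀ F ∈ others C P Q, ∀ x ∈ F, l y < l x := fun F hFo x hx => hl x (hFo.2.1 hx)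
  have hKc : ∀ F : others C P Q, IsClosed (centralProj l y '' F.1) := fun F =>
    ((isCompact_of_mem F.2.1).image_of_continuousOn
      (continuousOn_centralProj (hPl F.1 F.2))).isClosed
  have hcov : ∀ p ∈ centralProj l y '' P, ∃ F : others C P Q, p ∈ centralProj l y '' F.1 := by
    rintro _ ⟨x₀, hx₀, rfl⟩
    obtain ⟨F, hFo, x, hx, he⟩ := exists_exit hP hQP hl hy hx₀
    exact ⟨⟨F, hFo⟩, x, hx, he⟩
  have main := acycL_nerve (X := A) (K := fun F : others C P Q => centralProj l y '' F.1)
    (fun F => convex_image_centralProj (convex_of_mem F.2.1) (hPl F.1 F.2))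
    (fun x => ⟨_, (locallyFinite_of_finite _).iInter_compl_mem_nhds hKc x, fun F ⟨z, hz, hz'⟩ => by
      by_contra h
      exact (Set.mem_iInter₂.1 hz' F h) hz⟩)
    (convex_image_centralProj (convex_of_mem hP) hl)
    ((isCompact_of_mem hP).image_of_continuousOn (continuousOn_centralProj hl)) hcov
  convert main using 2 with s
  constructor
  · rintro ⟨F, hFo, h⟩
    obtain ⟨x, hx⟩ := nonempty_of_mem hFo.1
    exact ⟨_, ⟨x, hFo.2.1 hx, rfl⟩, fun G hG => ⟨x, h G hG hx, rfl⟩⟩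
  · rintro ⟨p, hp, h⟩
    obtain ⟨F, x, hx, rfl⟩ := hcov p hp
    have hx' : ∀ G ∈ F :: s, x ∈ G.1 := by
      intro G hG
      rcases List.mem_cons.1 hG with rfl | hG
      · exact hx
      · obtain ⟨x', hx', he⟩ := h G hG
        rwa [hinj F.1 F.2 G.1 G.2 x hx x' hx' he.symm]
    have hm := listInter_mem (fun F hF => hF.1) (F :: s) (List.cons_ne_nil _ _) hx'
    exact ⟨_, others_down hP hQ hd F.1 F.2 _ hm fun z hz => hz F List.mem_cons_self,
      fun G hG z hz => hz G (List.mem_cons_of_mem _ hG)⟩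

end PolyhedralStructure

namespace PolyhedralStructure

variable {g : ℕ} {C : PolyhedralStructure g}

/-! ### Exactness for a polytope and for the universal cover -/

section Acyclic

variable (o : C.Orientation) (R : Type) {A : Type} [CommRing R] [AddCommGroup A] [Module R A]

theorem exactOn_faces_zero {P : Set (Fin g → ℝ)} (hP : P ∈ C.lifts)
    (hd : finrank ℝ (vectorSpan ℝ P) = 0) : ExactOn (augD o R A) (augSupp A (faces C P)) := by
  classical
  have hface : ∀ F ∈ faces C P, F = P := fun F hF =>
    eq_of_finrank_le hP hF.1 hF.2 (by omega)
  obtain ⟨P', hP'⟩ : ∃ P' : C.Lift 0, P'.1 = P := ⟨⟨P, hP, hd⟩, rfl⟩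
  have hsq : ∀ a : A, eps o P' • eps o P' • a = a := fun a => by
    rcases eps_eq_or o P' with h | h <;> rw [h] <;> simp
  intro n x hx hcyc
  match n with
  | 0 =>
    refine ⟨Finsupp.single P' (eps o P' • (show A from x)), ?_, ?_⟩
    · refine mem_augSupp_succ.2 fun F hF => ?_
      by_cases h : F = P'
      · rw [h, hP']; exact ⟨hP, subset_rfl⟩
      · exact absurd (Finsupp.single_eq_of_ne h) hF
    · exact (aug_single (R := R) (A := A) o P' _).trans (hsq x)
  | 1 =>
    change C.Lift 0 →₀ A at x
    have hx1 : x = Finsupp.single P' (x P') := by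
      ext F
      by_cases h : F = P'
      · rw [h, Finsupp.single_eq_same]
      · rw [Finsupp.single_eq_of_ne h]
        by_contra hF
        exact h (Subtype.ext ((hface _ (mem_augSupp_succ.1 hx F hF)).trans hP'.symm))
    have h1 : aug o R A x = 0 := hcyc
    rw [hx1, aug_single] at h1
    have h2 := hsq (x P')
    rw [h1, smul_zero] at h2
    refine ⟨0, zero_mem _, (map_zero _).trans ?_⟩
    rw [hx1, ← h2, Finsupp.single_zero]
    rfl
  | k + 2 =>
    change C.Lift (k + 1) →₀ A at x
    have hx0 : x = 0 := by
      ext F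
      by_contra hF
      have h1 := hface _ (mem_augSupp_succ.1 hx F hF)
      have h2 := F.2.2
      rw [h1] at h2
      omega
    refine ⟨0, zero_mem _, (map_zero _).trans hx0.symm⟩

/-- Below dimension `m` chains live on the other faces. In dimension `m` a multiple of the boundary
of `P` removes the coefficient at `Q`, which leaves a cycle on the other faces. A cycle that is a
multiple of `P` is zero, because its boundary has the same coefficient, up to sign, at `Q`. In the
augmentation degree a chain on `Q` suffices. -/
theorem exactOn_faces_succ {P Q : Set (Fin g → ℝ)} (hP : P ∈ C.lifts) {m : ℕ}
    (hd : finrank ℝ (vectorSpan ℝ P) = m + 1) (hQ : Q ∈ C.lifts) (hQP : Q ⊆ P)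
    (hdQ : finrank ℝ (vectorSpan ℝ Q) = m)
    (hQe : ExactOn (augD o R A) (augSupp A (faces C Q)))
    (ho : ExactOn (augD o R A) (augSupp A (others C P Q))) :
    ExactOn (augD o R A) (augSupp A (faces C P)) := by
  classical
  have hface : ∀ F ∈ faces C P, m + 1 ≤ finrank ℝ (vectorSpan ℝ F) → F = P := fun F hF h =>
    eq_of_finrank_le hP hF.1 hF.2 (by omega)
  have hsub : others C P Q ⊆ faces C P := fun F hF => ⟨hF.1, hF.2.1⟩
  intro n x hx hcyc
  match n with
  | 0 =>
    obtain ⟨w, hw, hwx⟩ := hQe 0 x (fun _ => ⟨Q, hQ, subset_rfl⟩) trivial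
    exact ⟨w, augSupp_mono (show faces C Q ⊆ faces C P from
      fun F hF => ⟨hF.1, hF.2.trans hQP⟩) _ hw, hwx⟩
  | k + 1 =>
    change C.Lift k →₀ A at x
    rcases lt_trichotomy k m with hk | rfl | hk
    · obtain ⟨w, hw, hwx⟩ := ho (k + 1) x (mem_augSupp_succ.2 fun F hF => by
        have h := mem_augSupp_succ.1 hx F hF
        refine ⟨h.1, h.2, fun h' => ?_, fun h' => ?_⟩
        · have := F.2.2
          rw [h'] at this; omega
        · have := F.2.2
          rw [h'] at this; omega) hcyc
      exact ⟨w, augSupp_mono hsub _ hw, hwx⟩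
    · let P' : C.Lift (k + 1) := ⟨P, hP, hd⟩
      let Q' : C.Lift k := ⟨Q, hQ, hdQ⟩
      let y : C.Lift (k + 1) →₀ A := Finsupp.single P' (inc o P' Q' • x Q')
      have hy : (show AugChain C A (k + 2) from y) ∈ augSupp A (faces C P) (k + 2) := by
        refine mem_augSupp_succ.2 fun F hF => ?_
        by_cases h : F = P'
        · rw [h]; exact ⟨hP, subset_rfl⟩
        · exact absurd (Finsupp.single_eq_of_ne h) hF
      have hdown : ∀ F ∈ faces C P, ∀ F' ∈ C.lifts, F' ⊆ F → F' ∈ faces C P :=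
        fun F hF F' hF' h => ⟨hF', h.trans hF.2⟩
      have h1 := sub_mem hx (augD_mem o R hdown (k + 1) _ hy)
      have h0 : (x - bdy o R A k y) Q' = 0 := by
        rw [Finsupp.sub_apply, bdy_single_apply, smul_smul]
        have : inc o P' Q' = o.sgn P' Q' := if_pos hQP
        rw [this]
        rcases sgn_eq_or o P' Q' with h | h <;> rw [h] <;> simp
      obtain ⟨w, hw, hwx⟩ := ho (k + 1) (show AugChain C A (k + 1) from x - bdy o R A k y)
        (mem_augSupp_succ.2 fun F hF => by
          have h := mem_augSupp_succ.1 h1 F hF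
          refine ⟨h.1, h.2, fun h' => ?_, fun h' => ?_⟩
          · have := F.2.2
            rw [h'] at this; omega
          · have : F = Q' := Subtype.ext h'
            rw [this] at hF
            exact hF h0) (by
        have h2 := augD_augD o R A k (show AugChain C A (k + 2) from y)
        have h3 : augD o R A k (show AugChain C A (k + 1) from x) = 0 := hcyc
        change augD o R A k ((show AugChain C A (k + 1) from x) -
          augD o R A (k + 1) (show AugChain C A (k + 2) from y)) = 0
        rw [map_sub, h2, h3, sub_zero])
      refine ⟨w + (show AugChain C A (k + 2) from y), add_mem (augSupp_mono hsub _ hw) hy, ?_⟩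
      rw [map_add, hwx]
      exact sub_add_cancel x (bdy o R A k y)
    · obtain ⟨k, rfl⟩ : ∃ j, k = j + 1 := ⟨k - 1, by omega⟩
      have hx0 : x = 0 := by
        by_cases hkm : k = m
        · subst hkm
          let P' : C.Lift (k + 1) := ⟨P, hP, hd⟩
          let Q' : C.Lift k := ⟨Q, hQ, hdQ⟩
          have hx1 : x = Finsupp.single P' (x P') := by
            ext F
            by_cases h : F = P'
            · rw [h, Finsupp.single_eq_same]
            · rw [Finsupp.single_eq_of_ne h]
              by_contra hF
              exact h (Subtype.ext (hface _ (mem_augSupp_succ.1 hx F hF) F.2.2.ge))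
          have h1 : bdy o R A k x = 0 := hcyc
          have h2 : inc o P' Q' • x P' = 0 := by
            rw [← bdy_single_apply o (R := R), ← hx1, h1, Finsupp.zero_apply]
          have h3 : inc o P' Q' = o.sgn P' Q' := if_pos hQP
          rw [h3] at h2
          have h4 : x P' = 0 := by
            rcases sgn_eq_or o P' Q' with h | h <;> rw [h] at h2 <;> simpa using h2
          rw [hx1, h4, Finsupp.single_zero]
        · ext F
          by_contra hF
          have h1 := hface _ (mem_augSupp_succ.1 hx F hF) (by rw [F.2.2]; omega)
          have h2 := F.2.2
          rw [h1] at h2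
          omega
      exact ⟨0, zero_mem _, (map_zero _).trans hx0.symm⟩

theorem exactOn_faces {P : Set (Fin g → ℝ)} (hP : P ∈ C.lifts) :
    ExactOn (augD o R A) (augSupp A (faces C P)) := by
  obtain ⟨d, hd⟩ : ∃ d, finrank ℝ (vectorSpan ℝ P) = d := ⟨_, rfl⟩
  induction d using Nat.strong_induction_on generalizing P with
  | _ d ih =>
  cases d with
  | zero => exact exactOn_faces_zero o R hP hd
  | succ m =>
    obtain ⟨Q, hQ, hQP, hdQ⟩ := exists_facet hP hd
    have hd' : finrank ℝ (vectorSpan ℝ P) = finrank ℝ (vectorSpan ℝ Q) + 1 := by rw [hd, hdQ]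
    refine exactOn_faces_succ o R hP hd hQ hQP hdQ (ih m (by omega) hQ hdQ)
      (exactOn_of_nerve o R (fun F hF => hF.1) (others_down hP hQ hd') (fun F hF => ?_)
        (acycL_others A hP hQ hQP hd'))
    exact ih _ (by have := finrank_lt hP hF.1 hF.2.1 hF.2.2.1; omega) hF.1 rfl

/-- A cycle involves finitely many lists. A ball containing a common point for each of them reduces
the claim to a compact convex set. -/
theorem acycL_lifts (A : Type) [AddCommGroup A] :
    AcycL A fun s : List C.lifts => (cellsIn C.lifts s).Nonempty := by
  classical
  have hcell : ∀ s : List C.lifts, (cellsIn C.lifts s).Nonempty ↔ ∃ x, ∀ F ∈ s, x ∈ F.1 := by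
    intro s
    constructor
    · rintro ⟨F, hF, h⟩
      obtain ⟨x, hx⟩ := nonempty_of_mem hF
      exact ⟨x, fun G hG => h G hG hx⟩
    · rintro ⟨x, hx⟩
      obtain ⟨F, hF, hxF⟩ := C.cover x
      have hm := listInter_mem subset_rfl (⟨F, hF⟩ :: s) (List.cons_ne_nil _ _) (x := x)
        (fun G hG => by
          rcases List.mem_cons.1 hG with rfl | hG
          · exact hxF
          · exact hx G hG)
      exact ⟨_, hm, fun G hG z hz => hz G (List.mem_cons_of_mem _ hG)⟩
  intro z hz hdz
  have hw : ∀ s : z.support, ∃ x, ∀ F ∈ s.1, x ∈ F.1 := fun s =>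
    (hcell s.1).1 (hz s.1 (Finsupp.mem_support_iff.1 s.2))
  choose x hx using hw
  obtain ⟨r, hr⟩ := (Set.finite_range x).isBounded.subset_closedBall 0
  have hball : InNerve (fun F : C.lifts => F.1) (Metric.closedBall 0 |r|) ≤
      fun s => (cellsIn C.lifts s).Nonempty := fun s ⟨x, _, h⟩ => (hcell s).2 ⟨x, h⟩
  obtain ⟨w, hw, hwz⟩ := acycL_nerve (X := A) (K := fun F : C.lifts => F.1)
    (fun F => convex_of_mem F.2)
    (fun x => ⟨_, C.locallyFinite.iInter_compl_mem_nhds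
      (fun F => (isCompact_of_mem F.2).isClosed) x, fun F ⟨z, hz, hz'⟩ => by
        by_contra h
        exact (Set.mem_iInter₂.1 hz' F h) hz⟩)
    (convex_closedBall (0 : Fin g → ℝ) |r|) (isCompact_closedBall _ _)
    (fun x _ => by
      obtain ⟨F, hF, hx⟩ := C.cover x
      exact ⟨⟨F, hF⟩, hx⟩) z
    (fun s hs => ⟨x ⟨s, Finsupp.mem_support_iff.2 hs⟩,
      Metric.closedBall_subset_closedBall (le_abs_self r) (hr ⟨_, rfl⟩),
      hx ⟨s, Finsupp.mem_support_iff.2 hs⟩⟩) hdz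
  exact ⟨w, fun s => condSub_mono (hball s) (hw s), hwz⟩

theorem exactOn_lifts : ExactOn (augD o R A) (augSupp A C.lifts) :=
  exactOn_of_nerve o R subset_rfl (fun _ _ _ hF _ => hF) (fun _ hP => exactOn_faces o R hP)
    (acycL_lifts A)

theorem exists_bdy_eq (q : ℕ) (z : C.Lift (q + 1) →₀ A) (hz : bdy o R A q z = 0) :
    ∃ w, bdy o R A (q + 1) w = z := by
  obtain ⟨w, -, hw⟩ := exactOn_lifts o R (q + 2) z (mem_augSupp_succ.2 fun F _ => F.2.1) hz
  exact ⟨w, hw⟩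

theorem exists_bdy_eq_zero (z : C.Lift 0 →₀ A) (hz : aug o R A z = 0) :
    ∃ w, bdy o R A 0 w = z := by
  obtain ⟨w, -, hw⟩ := exactOn_lifts o R 1 z (mem_augSupp_succ.2 fun F _ => F.2.1) hz
  exact ⟨w, hw⟩

theorem aug_surjective : Function.Surjective (aug o R A) := fun a => by
  obtain ⟨P, hP, -⟩ := C.cover 0
  obtain ⟨w, -, hw⟩ := exactOn_lifts o R 0 (show AugChain C A 0 from a) (fun _ => ⟨P, hP⟩) trivial
  exact ⟨w, hw⟩

end Acyclic

end PolyhedralStructure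

namespace PolyhedralStructure

variable {g : ℕ} {C : PolyhedralStructure g}

/-! ## Translations -/

section Translation

theorem vadd_free {q : ℕ} {n : Fin g → ℤ} {P : C.Lift q} (h : n +ᵥ P = P) : n = 0 := by
  obtain ⟨x, hx⟩ := nonempty_of_mem P.2.1
  refine C.embedded P.1 P.2.1 x hx n ?_
  have h' : intEmb g n +ᵥ P.1 = P.1 := congrArg Subtype.val h
  rw [← h']
  exact Set.vadd_mem_vadd_set hx

theorem vadd_right_inj' {q : ℕ} {n n' : Fin g → ℤ} {P : C.Lift q} (h : n +ᵥ P = n' +ᵥ P) :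
    n = n' := by
  have : (-n' + n) +ᵥ P = P := by rw [add_vadd, h, neg_vadd_vadd]
  have := vadd_free this
  rwa [neg_add_eq_zero, eq_comm] at this

theorem toCell_vadd {q : ℕ} (n : Fin g → ℤ) (P : C.Lift q) : C.toCell (n +ᵥ P) = C.toCell P :=
  Quotient.sound (s := AddAction.orbitRel (Fin g → ℤ) (C.Lift q)) ⟨n, rfl⟩

theorem toCell_someLift {q : ℕ} (P : C.Cell q) : C.toCell (C.someLift P) = P := Quotient.out_eq P

theorem exists_coord {q : ℕ} (P : C.Lift q) :
    ∃ n : Fin g → ℤ, n +ᵥ C.someLift (C.toCell P) = P := by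
  have h := Quotient.exact (s := AddAction.orbitRel (Fin g → ℤ) (C.Lift q))
    (toCell_someLift (C.toCell P))
  obtain ⟨n, hn⟩ := h
  refine ⟨-n, ?_⟩
  have hn' : n +ᵥ P = C.someLift (C.toCell P) := hn
  rw [← hn', neg_vadd_vadd]

/-- The translation from the chosen lift of a cell to a given one. -/
def coord {q : ℕ} (P : C.Lift q) : Fin g → ℤ := (exists_coord P).choose

theorem coord_spec {q : ℕ} (P : C.Lift q) : coord P +ᵥ C.someLift (C.toCell P) = P :=
  (exists_coord P).choose_spec

theorem coord_vadd {q : ℕ} (n : Fin g → ℤ) (P : C.Lift q) : coord (n +ᵥ P) = n + coord P := by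
  apply vadd_right_inj' (P := C.someLift (C.toCell P))
  rw [add_vadd, coord_spec P]
  have := coord_spec (n +ᵥ P)
  rwa [toCell_vadd] at this

theorem inc_vadd (o : C.Orientation) {q : ℕ} (n : Fin g → ℤ) (P : C.Lift (q + 1)) (Q : C.Lift q) :
    inc o (n +ᵥ P) (n +ᵥ Q) = inc o P Q := by
  have : (n +ᵥ Q).1 ⊆ (n +ᵥ P).1 ↔ Q.1 ⊆ P.1 := Set.vadd_set_subset_vadd_set_iff
  classical
  exact if_congr this (sgn_vadd o n P Q) rfl

variable (o : C.Orientation) {R : Type} {A : Type} [CommRing R] [AddCommGroup A] [Module R A]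

/-- The action of a translation on the chains of the universal cover. -/
def trans (R : Type) [CommRing R] [Module R A] {q : ℕ} (n : Fin g → ℤ) :
    (C.Lift q →₀ A) →ₗ[R] (C.Lift q →₀ A) := Finsupp.lmapDomain A R (n +ᵥ ·)

theorem trans_single {q : ℕ} (n : Fin g → ℤ) (P : C.Lift q) (a : A) :
    trans R n (Finsupp.single P a) = Finsupp.single (n +ᵥ P) a := Finsupp.mapDomain_single

theorem trans_zero {q : ℕ} (z : C.Lift q →₀ A) : trans R 0 z = z := by
  induction z using Finsupp.induction_linear with
  | zero => simp
  | add a b ha hb => rw [map_add, ha, hb]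
  | single P a => rw [trans_single, zero_vadd]

theorem trans_add {q : ℕ} (m n : Fin g → ℤ) (z : C.Lift q →₀ A) :
    trans R (m + n) z = trans R m (trans R n z) := by
  induction z using Finsupp.induction_linear with
  | zero => simp
  | add a b ha hb => rw [map_add, ha, hb, map_add, map_add]
  | single P a => rw [trans_single, trans_single, trans_single, add_vadd]

theorem trans_apply {q : ℕ} (n : Fin g → ℤ) (z : C.Lift q →₀ A) (P : C.Lift q) :
    trans R n z (n +ᵥ P) = z P :=
  Finsupp.mapDomain_apply (AddAction.injective n) z P

theorem bdy_trans {q : ℕ} (n : Fin g → ℤ) (z : C.Lift (q + 1) →₀ A) :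
    bdy o R A q (trans R n z) = trans R n (bdy o R A q z) := by
  induction z using Finsupp.induction_linear with
  | zero => simp
  | add a b ha hb => simp only [map_add, ha, hb]
  | single P a =>
    ext Q
    obtain ⟨Q, rfl⟩ := AddAction.surjective n Q
    rw [trans_apply, trans_single, bdy_single_apply, bdy_single_apply, inc_vadd]

theorem aug_trans (n : Fin g → ℤ) (z : C.Lift 0 →₀ A) :
    aug o R A (trans R n z) = aug o R A z := by
  induction z using Finsupp.induction_linear with
  | zero => simp
  | add a b ha hb => simp only [map_add, ha, hb]
  | single P a => rw [trans_single, aug_single, aug_single, eps_vadd]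

/-- The part of a translation in the first `i` directions. -/
def low (i : ℕ) (n : Fin g → ℤ) : Fin g → ℤ := fun j => if (j : ℕ) < i then n j else 0

/-- The representative of a cell modulo the translations in the first `i` directions. -/
def red (i : ℕ) {q : ℕ} (P : C.Lift q) : C.Lift q := -low i (coord P) +ᵥ P

theorem red_vadd_gen (i : ℕ) {q : ℕ} (n : Fin g → ℤ) (P : C.Lift q) :
    red i (n +ᵥ P) = (n - low i n) +ᵥ red i P := by
  unfold red
  rw [← add_vadd, ← add_vadd, coord_vadd]
  congr 1
  ext j
  simp only [low, Pi.add_apply, Pi.sub_apply, Pi.neg_apply]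
  split_ifs <;> ring

theorem red_vadd {i : ℕ} {q : ℕ} {n : Fin g → ℤ} (hn : ∀ j : Fin g, i ≤ j → n j = 0)
    (P : C.Lift q) : red i (n +ᵥ P) = red i P := by
  have : n - low i n = 0 := by
    ext j
    simp only [low, Pi.sub_apply, Pi.zero_apply]
    split_ifs with h
    · ring
    · rw [hn j (by omega), sub_zero]
  rw [red_vadd_gen, this, zero_vadd]

variable (C R A) in
/-- The chains that vanish modulo the translations in the first `i` directions. -/
def relSub (i q : ℕ) : Submodule R (C.Lift q →₀ A) := LinearMap.ker (Finsupp.lmapDomain A R (red i))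

/-- An invariant map factors through the choice of representatives `red i`. This universal property
gives most of the membership statements below. -/
theorem relSub_vanish {B : Type} [AddCommGroup B] {i q : ℕ} (f : (C.Lift q →₀ A) →+ B)
    (hf : ∀ n : Fin g → ℤ, (∀ j : Fin g, i ≤ j → n j = 0) → ∀ z, f (trans R n z) = f z)
    {c : C.Lift q →₀ A} (hc : c ∈ relSub C R A i q) : f c = 0 := by
  have key : ∀ c : C.Lift q →₀ A, f (Finsupp.lmapDomain A R (red i) c) = f c := by
    intro c
    induction c using Finsupp.induction_linear with
    | zero => simp
    | add a b ha hb => rw [map_add, map_add, ha, hb, map_add]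
    | single P a =>
      rw [Finsupp.lmapDomain_apply, Finsupp.mapDomain_single]
      have := hf (-low i (coord P)) (fun j hj => by simp [low, not_lt.2 hj]) (Finsupp.single P a)
      rw [trans_single] at this
      exact this
  rw [← key, LinearMap.mem_ker.1 hc, map_zero]

theorem trans_sub_mem {i q : ℕ} {n : Fin g → ℤ} (hn : ∀ j : Fin g, i ≤ j → n j = 0)
    (z : C.Lift q →₀ A) : trans R n z - z ∈ relSub C R A i q := by
  rw [relSub, LinearMap.mem_ker, map_sub, sub_eq_zero]
  induction z using Finsupp.induction_linear with
  | zero => simp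
  | add a b ha hb => simp only [map_add, ha, hb]
  | single P a =>
    rw [trans_single, Finsupp.lmapDomain_apply, Finsupp.lmapDomain_apply, Finsupp.mapDomain_single,
      Finsupp.mapDomain_single, red_vadd hn]

theorem map_mem_relSub {i q q' : ℕ} {B : Type} [AddCommGroup B] [Module R B]
    (f : (C.Lift q →₀ A) →+ (C.Lift q' →₀ B))
    (hf : ∀ (n : Fin g → ℤ) z, f (trans R n z) = trans R n (f z))
    {c : C.Lift q →₀ A} (hc : c ∈ relSub C R A i q) : f c ∈ relSub C R B i q' := by
  refine relSub_vanish (B := C.Lift q' →₀ B) (f := AddMonoidHom.comp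
    (Finsupp.lmapDomain B R (red i)).toAddMonoidHom f) (fun n hn z => ?_) hc
  have := trans_sub_mem (R := R) hn (f z)
  rw [relSub, LinearMap.mem_ker, map_sub, sub_eq_zero, ← hf] at this
  exact this

theorem relSub_zero {q : ℕ} {c : C.Lift q →₀ A} (hc : c ∈ relSub C R A 0 q) : c = 0 :=
  relSub_vanish (R := R) (AddMonoidHom.id _) (fun n hn z => by
    have : n = 0 := funext fun j => hn j (Nat.zero_le _)
    rw [this, trans_zero]) hc

theorem relSub_mono {i i' q : ℕ} (h : i ≤ i') : relSub C R A i q ≤ relSub C R A i' q := by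
  intro c hc
  refine relSub_vanish (B := C.Lift q →₀ A)
    (f := (Finsupp.lmapDomain A R (red i')).toAddMonoidHom) (fun n hn z => ?_) hc
  have := trans_sub_mem (R := R) (i := i') (fun j hj => hn j (h.trans hj)) z
  rw [relSub, LinearMap.mem_ker, map_sub, sub_eq_zero] at this
  exact this

/-- Dividing by one more direction means dividing by the image of `e - 1` for a single translation
`e`: once `e` acts trivially on a quotient, so do its multiples. With `mem_relSub_of_trans` this is
the exact sequence behind the Wang sequence. -/
theorem exists_of_mem_relSub_succ {i q : ℕ} (hi : i < g) {c : C.Lift q →₀ A}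
    (hc : c ∈ relSub C R A (i + 1) q) :
    ∃ y, c - (trans R (basisVec ℤ ⟨i, hi⟩) y - y) ∈ relSub C R A i q := by
  let e : Fin g → ℤ := basisVec ℤ ⟨i, hi⟩
  let S : Submodule R (C.Lift q →₀ A) :=
    relSub C R A i q ⊔ LinearMap.range (trans R e - LinearMap.id)
  have h1 : ∀ z, S.mkQ (trans R e z) = S.mkQ z := fun z => by
    rw [← sub_eq_zero, ← map_sub]
    exact (Submodule.Quotient.mk_eq_zero _).2 (Submodule.mem_sup_right ⟨z, rfl⟩)
  have h2 : ∀ (k : ℤ) z, S.mkQ (trans R (k • e) z) = S.mkQ z := fun k => by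
    induction k using Int.induction_on with
    | zero => intro z; rw [zero_smul, trans_zero]
    | succ k ih => intro z; rw [add_smul, one_smul, trans_add, ih, h1]
    | pred k ih => intro z; rw [← h1, ← trans_add, sub_smul, one_smul, add_sub_cancel, ih]
  have h3 : S.mkQ c = 0 := by
    refine relSub_vanish (R := R) (S.mkQ).toAddMonoidHom (fun n hn z => ?_) hc
    have hn' : n = low i n + n ⟨i, hi⟩ • e := by
      ext j
      simp only [low, Pi.add_apply, Pi.smul_apply, smul_eq_mul, e, basisVec, Pi.single_apply,
        Fin.ext_iff]
      rcases lt_trichotomy (j : ℕ) i with h | h | h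
      · simp [h, h.ne]
      · have : j = ⟨i, hi⟩ := Fin.ext h
        subst this
        simp
      · simp [h.ne', not_lt.2 h.le, hn j h]
    change S.mkQ _ = S.mkQ _
    rw [hn', trans_add, ← h2 (n ⟨i, hi⟩) z, ← sub_eq_zero, ← map_sub]
    exact (Submodule.Quotient.mk_eq_zero _).2 (Submodule.mem_sup_left
      (trans_sub_mem (fun j hj => by simp [low, not_lt.2 hj]) _))
  obtain ⟨w, hw, _, ⟨y, rfl⟩, hy⟩ := Submodule.mem_sup.1 ((Submodule.Quotient.mk_eq_zero _).1 h3)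
  refine ⟨y, ?_⟩
  rw [← hy]
  convert hw using 1
  exact add_sub_cancel_right _ _

/-- Injectivity of `e - 1`: a nonzero chain fixed by `e` would contain infinitely many translates of
a cell in its support. -/
theorem mem_relSub_of_trans {i q : ℕ} (hi : i < g) {c : C.Lift q →₀ A}
    (hc : trans R (basisVec ℤ ⟨i, hi⟩) c - c ∈ relSub C R A i q) : c ∈ relSub C R A i q := by
  set e : Fin g → ℤ := basisVec ℤ ⟨i, hi⟩ with he
  have hlow : low i e = 0 := by
    ext j
    simp only [low, e, basisVec, Pi.single_apply, Fin.ext_iff, Pi.zero_apply]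
    split_ifs <;> omega
  have hcomm : ∀ z : C.Lift q →₀ A, Finsupp.lmapDomain A R (red i) (trans R e z) =
      trans R e (Finsupp.lmapDomain A R (red i) z) := by
    intro z
    induction z using Finsupp.induction_linear with
    | zero => simp
    | add a b ha hb => simp only [map_add, ha, hb]
    | single P a =>
      rw [trans_single, Finsupp.lmapDomain_apply, Finsupp.lmapDomain_apply,
        Finsupp.mapDomain_single, Finsupp.mapDomain_single, trans_single, red_vadd_gen, hlow,
        sub_zero]
  rw [relSub, LinearMap.mem_ker, map_sub, hcomm, sub_eq_zero] at hc
  rw [relSub, LinearMap.mem_ker]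
  set c' := Finsupp.lmapDomain A R (red i) c
  ext P
  by_contra hP
  have h1 : ∀ k : ℕ, c' (k • e +ᵥ P) ≠ 0 := by
    intro k
    induction k with
    | zero => rwa [zero_smul, zero_vadd]
    | succ k ih => rwa [succ_nsmul', add_vadd, ← hc, trans_apply]
  have h2 : Function.Injective fun k : ℕ => k • e +ᵥ P := fun k k' h => by
    have := congrFun (vadd_right_inj' h) ⟨i, hi⟩
    simpa [e, basisVec] using this
  exact Set.infinite_of_injective_forall_mem h2
    (fun k => Finset.mem_coe.2 (Finsupp.mem_support_iff.2 (h1 k))) c'.support.finite_toSet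

/-- The projection from the chains of the universal cover to those of the torus. -/
def proj (R : Type) [CommRing R] [Module R A] (q : ℕ) : (C.Lift q →₀ A) →ₗ[R] (C.Cell q →₀ A) :=
  Finsupp.lmapDomain A R C.toCell

/-- A section of the projection. -/
def sect (R : Type) [CommRing R] [Module R A] (q : ℕ) : (C.Cell q →₀ A) →ₗ[R] (C.Lift q →₀ A) :=
  Finsupp.lmapDomain A R C.someLift

theorem proj_single {q : ℕ} (P : C.Lift q) (a : A) :
    proj R q (Finsupp.single P a) = Finsupp.single (C.toCell P) a := Finsupp.mapDomain_single

theorem sect_single {q : ℕ} (P : C.Cell q) (a : A) :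
    sect R q (Finsupp.single P a) = Finsupp.single (C.someLift P) a := Finsupp.mapDomain_single

theorem proj_sect {q : ℕ} (c : C.Cell q →₀ A) : proj R q (sect R q c) = c := by
  induction c using Finsupp.induction_linear with
  | zero => simp
  | add a b ha hb => simp only [map_add, ha, hb]
  | single P a => rw [sect_single, proj_single, toCell_someLift]

theorem proj_trans {q : ℕ} (n : Fin g → ℤ) (z : C.Lift q →₀ A) :
    proj R q (trans R n z) = proj R q z := by
  induction z using Finsupp.induction_linear with
  | zero => simp
  | add a b ha hb => simp only [map_add, ha, hb]
  | single P a => rw [trans_single, proj_single, proj_single, toCell_vadd]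

theorem mem_relSub_iff {q : ℕ} (z : C.Lift q →₀ A) : z ∈ relSub C R A g q ↔ proj R q z = 0 := by
  constructor
  · exact relSub_vanish (R := R) (proj R q).toAddMonoidHom fun n _ z => proj_trans n z
  · have key : ∀ z : C.Lift q →₀ A,
        Finsupp.lmapDomain A R (red g) z = sect R q (proj R q z) := by
      intro z
      induction z using Finsupp.induction_linear with
      | zero => simp
      | add a b ha hb => simp only [map_add, ha, hb]
      | single P a =>
        have : red g P = C.someLift (C.toCell P) := by
          have h : low g (coord P) = coord P := by ext j; simp [low]
          have h' := coord_spec P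
          rw [red, h]
          nth_rewrite 2 [← h']
          rw [neg_vadd_vadd]
        rw [Finsupp.lmapDomain_apply, Finsupp.mapDomain_single, proj_single, sect_single, this]
    intro h
    rw [relSub, LinearMap.mem_ker, key, h, map_zero]

end Translation

end PolyhedralStructure

namespace PolyhedralStructure

variable {g : ℕ} {C : PolyhedralStructure g}

/-! ## Iterated periods -/

section Periods

variable (C) in
/-- A `ℤ^g`-equivariant choice of a point for every lifted cell. -/
structure Position (R : Type) [CommRing R] where
  x : ∀ {q : ℕ}, C.Lift q → Fin g → R
  x_vadd : ∀ {q : ℕ} (n : Fin g → ℤ) (P : C.Lift q) (j : Fin g), x (n +ᵥ P) j = n j + x P j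

variable (C) in
/-- The position of a cell relative to the chosen lift. -/
def coordPosition (R : Type) [CommRing R] : Position C R where
  x P j := (coord P j : R)
  x_vadd n P j := by rw [coord_vadd, Pi.add_apply, Int.cast_add]

variable (o : C.Orientation) {R : Type} {A : Type} [CommRing R] [AddCommGroup A] [Module R A]
  (s : Position C R)

/-- Multiplication with a coordinate of the position. -/
def mulPos (j : Fin g) {q : ℕ} : (C.Lift q →₀ A) →ₗ[R] (C.Lift q →₀ A) :=
  Finsupp.lsum R fun P => s.x P j • Finsupp.lsingle P

theorem mulPos_single (j : Fin g) {q : ℕ} (P : C.Lift q) (a : A) :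
    mulPos s j (Finsupp.single P a) = s.x P j • Finsupp.single P a := by
  rw [mulPos, Finsupp.lsum_single]
  rfl

theorem mulPos_trans (j : Fin g) {q : ℕ} (n : Fin g → ℤ) (z : C.Lift q →₀ A) :
    mulPos s j (trans R n z) = trans R n (mulPos s j z) + (n j : R) • trans R n z := by
  induction z using Finsupp.induction_linear with
  | zero => simp
  | add a b ha hb => simp only [map_add, ha, hb, smul_add]; abel
  | single P a =>
    rw [trans_single, mulPos_single, mulPos_single, map_smul, trans_single, s.x_vadd, add_smul,
      add_comm]

/-- The commutator of the boundary with a position operator. -/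
def del (j : Fin g) (q : ℕ) : (C.Lift (q + 1) →₀ A) →ₗ[R] (C.Lift q →₀ A) :=
  (bdy o R A q).comp (mulPos s j) - (mulPos s j).comp (bdy o R A q)

theorem del_apply (j : Fin g) (q : ℕ) (z : C.Lift (q + 1) →₀ A) :
    del o s j q z = bdy o R A q (mulPos s j z) - mulPos s j (bdy o R A q z) := rfl

theorem del_single (j : Fin g) (q : ℕ) (P : C.Lift (q + 1)) (a : A) :
    del o s j q (Finsupp.single P a) =
      ∑ Q : C.Facet P, o.sgn P Q.1 • (s.x P j - s.x Q.1 j) • Finsupp.single Q.1 a := by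
  rw [del_apply, mulPos_single, map_smul, bdy_single, map_sum, Finset.smul_sum,
    ← Finset.sum_sub_distrib]
  refine Finset.sum_congr rfl fun Q _ => ?_
  rw [map_zsmul, mulPos_single, smul_comm, sub_smul, smul_sub]

/-- A translation changes the position operator by a constant, which the commutator does not see. So
`del` descends to the torus although `mulPos` does not. -/
theorem del_trans (j : Fin g) (q : ℕ) (n : Fin g → ℤ) (z : C.Lift (q + 1) →₀ A) :
    del o s j q (trans R n z) = trans R n (del o s j q z) := by
  rw [del_apply, del_apply, mulPos_trans, map_add, map_smul, bdy_trans, bdy_trans, mulPos_trans,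
    map_sub]
  abel

theorem bdy_del (j : Fin g) (q : ℕ) (z : C.Lift (q + 2) →₀ A) :
    bdy o R A q (del o s j (q + 1) z) = -del o s j q (bdy o R A (q + 1) z) := by
  rw [del_apply, del_apply, map_sub, bdy_bdy, bdy_bdy, map_zero]
  abel

theorem del_bdy (j : Fin g) (q : ℕ) (z : C.Lift (q + 2) →₀ A) :
    del o s j q (bdy o R A (q + 1) z) = -bdy o R A q (del o s j (q + 1) z) := by
  rw [bdy_del, neg_neg]

/-- Cycles modulo the translations in the first `i` directions. -/
def IsRelCycle (R : Type) [CommRing R] [Module R A] (i : ℕ) : ∀ {q : ℕ}, (C.Lift q →₀ A) → Prop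
  | 0, _ => True
  | q + 1, z => bdy o R A q z ∈ relSub C R A i q

theorem IsRelCycle.del {i q : ℕ} {z : C.Lift (q + 1) →₀ A} (hz : IsRelCycle o R i z) (j : Fin g) :
    IsRelCycle o R i (del o s j q z) := by
  cases q with
  | zero => trivial
  | succ q =>
    change bdy o R A q _ ∈ _
    rw [bdy_del, neg_mem_iff]
    exact map_mem_relSub (PolyhedralStructure.del o s j q).toAddMonoidHom (del_trans o s j q) hz

/-- Iterated periods. -/
def per : ∀ {i q : ℕ}, Idx g i q → (C.Lift q →₀ A) →ₗ[R] A
  | _, _, Idx.nil => aug o R A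
  | _, _, Idx.skip I => per I
  | _, _, Idx.take (i := i) (q := q) h I => (per I).comp (del o s ⟨i, h⟩ q)

theorem per_take {i q : ℕ} (h : i < g) (I : Idx g i q) (z : C.Lift (q + 1) →₀ A) :
    per o s (Idx.take h I) z = per o s I (del o s ⟨i, h⟩ q z) := rfl

theorem per_trans {i q : ℕ} (I : Idx g i q) (n : Fin g → ℤ) (z : C.Lift q →₀ A) :
    per o s I (trans R n z) = per o s I z := by
  induction I with
  | nil => exact aug_trans o n z
  | skip I ih => exact ih z
  | take h I ih => rw [per_take, per_take, del_trans, ih]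

theorem per_bdy {i q : ℕ} (I : Idx g i q) (z : C.Lift (q + 1) →₀ A) :
    per o s I (bdy o R A q z) = 0 := by
  induction I with
  | nil => exact aug_bdy o z
  | skip I ih => exact ih z
  | take h I ih => rw [per_take, del_bdy, map_neg, ih, neg_zero]

theorem per_relSub {i i' q : ℕ} (I : Idx g i q) {z : C.Lift q →₀ A}
    (hz : z ∈ relSub C R A i' q) : per o s I z = 0 :=
  relSub_vanish (R := R) (per o s I).toAddMonoidHom (fun n _ z => per_trans o s I n z) hz

/-- The connecting map of the Wang sequence. The translation `e` raises the `i`-th coordinate by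
`1`, so weighting `e y - y` with that coordinate leaves, under an invariant functional, exactly the
value at `y`. -/
theorem per_del {i q : ℕ} (hi : i < g) (I : Idx g i q) {z : C.Lift (q + 1) →₀ A}
    {y : C.Lift q →₀ A}
    (h : bdy o R A q z - (trans R (basisVec ℤ ⟨i, hi⟩) y - y) ∈ relSub C R A i q) :
    per o s I (del o s ⟨i, hi⟩ q z) = -per o s I y := by
  have h1 : per o s I (mulPos s ⟨i, hi⟩
      (bdy o R A q z - (trans R (basisVec ℤ ⟨i, hi⟩) y - y))) = 0 := by
    refine relSub_vanish (R := R) ((per o s I).comp (mulPos s ⟨i, hi⟩)).toAddMonoidHom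
      (fun n hn z => ?_) h
    change per o s I (mulPos s _ _) = per o s I (mulPos s _ _)
    rw [mulPos_trans, map_add, map_smul, per_trans, hn ⟨i, hi⟩ le_rfl, Int.cast_zero, zero_smul,
      add_zero]
  have h2 : (basisVec ℤ ⟨i, hi⟩ : Fin g → ℤ) ⟨i, hi⟩ = 1 := by simp [basisVec]
  simp only [map_sub, mulPos_trans, map_add, per_trans, h2, Int.cast_one, one_smul] at h1
  rw [del_apply, map_sub, per_bdy]
  rw [add_sub_cancel_left, sub_eq_zero] at h1
  rw [h1, zero_sub]

theorem sub_mem_relSub_succ {i q : ℕ} (hi : i < g) {c y : C.Lift q →₀ A}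
    (h : c - (trans R (basisVec ℤ ⟨i, hi⟩) y - y) ∈ relSub C R A i q) :
    c ∈ relSub C R A (i + 1) q := by
  have h1 := trans_sub_mem (R := R) (i := i + 1) (n := basisVec ℤ ⟨i, hi⟩) (fun j hj => by
    simp only [basisVec, Pi.single_apply, Fin.ext_iff, ite_eq_right_iff]; omega) y
  simpa using add_mem (relSub_mono (Nat.le_succ i) h) h1

/-- Relative cycles are determined up to boundaries by their iterated periods, which are
arbitrary. -/
theorem per_bijective_aux {i : ℕ} (hi : i ≤ g) :
    (∀ (q : ℕ) (z : C.Lift q →₀ A), IsRelCycle o R i z → (∀ I : Idx g i q, per o s I z = 0) →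
      ∃ u, z - bdy o R A q u ∈ relSub C R A i q) ∧
    ∀ (q : ℕ) (w : Idx g i q → A), ∃ z : C.Lift q →₀ A, IsRelCycle o R i z ∧
      ∀ I, per o s I z = w I := by
  induction i with
  | zero =>
    constructor
    · intro q z hz hper
      cases q with
      | zero =>
        obtain ⟨u, hu⟩ := exists_bdy_eq_zero o R z (hper Idx.nil)
        exact ⟨u, by rw [hu, sub_self]; exact zero_mem _⟩
      | succ q =>
        obtain ⟨u, hu⟩ := exists_bdy_eq o R q z (relSub_zero hz)
        exact ⟨u, by rw [hu, sub_self]; exact zero_mem _⟩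
    · intro q w
      cases q with
      | zero =>
        obtain ⟨z, hz⟩ := aug_surjective o R (w Idx.nil)
        exact ⟨z, trivial, fun I => by cases I; exact hz⟩
      | succ q =>
        refine ⟨0, ?_, fun I => nomatch I⟩
        change bdy o R A q 0 ∈ _
        rw [map_zero]
        exact zero_mem _
  | succ i ih =>
    obtain ⟨inj, surj⟩ := ih (by omega)
    let e : Fin g → ℤ := basisVec ℤ ⟨i, hi⟩
    have hbt : ∀ {q : ℕ} {y : C.Lift (q + 1) →₀ A}, bdy o R A q (trans R e y - y) =
        trans R e (bdy o R A q y) - bdy o R A q y := fun {q y} => by rw [map_sub, bdy_trans]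
    have hbm : ∀ {q : ℕ} {y : C.Lift (q + 1) →₀ A}, y ∈ relSub C R A i (q + 1) →
        bdy o R A q y ∈ relSub C R A i q := fun {q y} =>
      map_mem_relSub (bdy o R A q).toAddMonoidHom (bdy_trans o)
    have htm : ∀ {q : ℕ} {y : C.Lift q →₀ A}, y ∈ relSub C R A i q →
        trans R e y - y ∈ relSub C R A i q := fun {q y} h =>
      sub_mem (map_mem_relSub (trans R e).toAddMonoidHom (fun n z => by
        change trans R e (trans R n z) = trans R n (trans R e z)
        rw [← trans_add, ← trans_add, add_comm]) h) h
    constructor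
    · intro q z hz hper
      cases q with
      | zero =>
        obtain ⟨u, hu⟩ := inj 0 z trivial fun I => hper I.skip
        exact ⟨u, relSub_mono (Nat.le_succ i) hu⟩
      | succ q =>
        -- The boundary of `z` is `e y - y` modulo fewer translations. By `per_del` all periods of
        -- the cycle `y` vanish, so `y` bounds some `u`, and subtracting `e u - u` makes `z` a cycle
        -- for fewer translations without changing its periods.
        obtain ⟨y, hy⟩ := exists_of_mem_relSub_succ hi hz
        have hyc : IsRelCycle o R i y := by
          cases q with
          | zero => trivial
          | succ q =>
            refine mem_relSub_of_trans hi ?_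
            have h1 := hbm hy
            rw [map_sub, bdy_bdy, zero_sub, neg_mem_iff, hbt] at h1
            exact h1
        obtain ⟨u, hu⟩ := inj q y hyc fun I => by
          have h1 := per_del o s hi I hy
          rw [← per_take, hper, eq_comm, neg_eq_zero] at h1
          exact h1
        have hz' : bdy o R A q (z - (trans R e u - u)) ∈ relSub C R A i q := by
          rw [map_sub, hbt]
          have h1 := add_mem hy (htm hu)
          rw [map_sub] at h1
          convert h1 using 1
          abel
        obtain ⟨v, hv⟩ := inj (q + 1) (z - (trans R e u - u)) hz' fun I => by
          rw [map_sub, map_sub, per_trans, sub_self, sub_zero]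
          exact hper I.skip
        refine ⟨v, sub_mem_relSub_succ hi (y := u) ?_⟩
        convert hv using 1
        abel
    · intro q w
      cases q with
      | zero =>
        obtain ⟨z, -, hz⟩ := surj 0 fun I => w I.skip
        exact ⟨z, trivial, fun I => by cases I with | skip I => exact hz I⟩
      | succ q =>
        -- Here `y` carries the periods that involve direction `i`, with the sign of `per_del`. The
        -- chain `u` has boundary `e y - y`, and the cycle `z₀` corrects the remaining periods.
        obtain ⟨y, hyc, hy⟩ := surj q fun I => -w (Idx.take hi I)
        have hy' : IsRelCycle o R i (trans R e y - y) := by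
          cases q with
          | zero => trivial
          | succ q =>
            change bdy o R A q _ ∈ _
            rw [hbt]
            exact htm hyc
        obtain ⟨u, hu⟩ := inj q (trans R e y - y) hy' fun I => by
          rw [map_sub, per_trans, sub_self]
        obtain ⟨z₀, hz₀, hw⟩ := surj (q + 1) fun I => w I.skip - per o s I u
        have hz : bdy o R A q (u + z₀) - (trans R e y - y) ∈ relSub C R A i q := by
          have h1 : bdy o R A q z₀ ∈ relSub C R A i q := hz₀
          have h2 := sub_mem h1 hu
          convert h2 using 1
          rw [map_add]
          abel
        refine ⟨u + z₀, sub_mem_relSub_succ hi hz, fun I => ?_⟩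
        cases I with
        | skip I =>
          change per o s I _ = _
          rw [map_add, hw]
          abel
        | take h I => rw [per_take, per_del o s hi I hz, hy, neg_neg]

end Periods

/-! ## Homology of the torus -/

section CellHomology

variable (o : C.Orientation) (R : Type) {A : Type} [CommRing R] [AddCommGroup A] [Module R A]

theorem boundary_proj (q : ℕ) (z : C.Lift (q + 1) →₀ A) :
    boundary o R A q (proj R (q + 1) z) = proj R q (bdy o R A q z) := by
  have key : ∀ P : C.Cell (q + 1), ∀ a : A, boundary o R A q (Finsupp.single P a) =
      proj R q (bdy o R A q (Finsupp.single (C.someLift P) a)) := fun P a => by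
    rw [boundary_single, finsum_eq_sum_of_fintype, bdy_single, map_sum]
    refine Finset.sum_congr rfl fun Q _ => ?_
    rw [map_zsmul, proj_single]
  induction z using Finsupp.induction_linear with
  | zero => simp
  | add a b ha hb => simp only [map_add, ha, hb]
  | single P a =>
    rw [proj_single, key]
    nth_rewrite 2 [← coord_spec P]
    rw [← trans_single (R := R), bdy_trans, proj_trans]

theorem mem_cycles_of_isRelCycle {q : ℕ} {z : C.Lift q →₀ A} (hz : IsRelCycle o R g z) :
    proj R q z ∈ cycles o R A q := by
  cases q with
  | zero => exact Submodule.mem_top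
  | succ q =>
    change boundary o R A q _ = 0
    rw [boundary_proj]
    exact (mem_relSub_iff _).1 hz

theorem isRelCycle_sect {q : ℕ} {c : C.Cell q →₀ A} (hc : c ∈ cycles o R A q) :
    IsRelCycle o R g (sect R q c) := by
  cases q with
  | zero => trivial
  | succ q =>
    refine (mem_relSub_iff _).2 ?_
    rw [← boundary_proj, proj_sect]
    exact hc

variable {R} in
theorem invariant_sect {B : Type} [AddCommGroup B] {q : ℕ} (f : (C.Lift q →₀ A) →+ B)
    (hf : ∀ (n : Fin g → ℤ) z, f (trans R n z) = f z) (z : C.Lift q →₀ A) :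
    f (sect R q (proj R q z)) = f z := by
  rw [← sub_eq_zero, ← map_sub]
  refine relSub_vanish (R := R) (i := g) f (fun n _ z => hf n z) ((mem_relSub_iff _).2 ?_)
  rw [map_sub, proj_sect, sub_self]

variable {R} (s : Position C R)

/-- Iterated periods of the chains of the torus. -/
def cellPer (A : Type) [AddCommGroup A] [Module R A] (q : ℕ) :
    (C.Cell q →₀ A) →ₗ[R] (Idx g g q → A) :=
  LinearMap.pi fun I => (per o s I).comp (sect R q)

theorem cellPer_proj (q : ℕ) (z : C.Lift q →₀ A) (I : Idx g g q) :
    cellPer o s A q (proj R q z) I = per o s I z :=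
  invariant_sect (per o s I).toAddMonoidHom (fun n z => per_trans o s I n z) z

theorem cellPer_boundary (q : ℕ) (c : C.Cell (q + 1) →₀ A) :
    cellPer o s A q (boundary o R A q c) = 0 := by
  ext I
  rw [← proj_sect (R := R) c, boundary_proj, cellPer_proj, per_bdy]
  rfl

/-- Iterated periods on homology. -/
def homPer (A : Type) [AddCommGroup A] [Module R A] (q : ℕ) :
    Homology o R A q →ₗ[R] (Idx g g q → A) :=
  Submodule.liftQ _ ((cellPer o s A q).comp (cycles o R A q).subtype) (by
    rintro ⟨c, hc⟩ ⟨b, hb⟩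
    change cellPer o s A q c = 0
    have hb' : boundary o R A q b = c := hb
    rw [← hb', cellPer_boundary])

theorem homPer_cls (q : ℕ) (c : cycles o R A q) :
    homPer o s A q (cls o R A q c) = cellPer o s A q c.1 := rfl

theorem cls_surjective (q : ℕ) : Function.Surjective (cls o R A q) := Submodule.mkQ_surjective _

theorem homPer_bijective (q : ℕ) : Function.Bijective (homPer o s A q) := by
  obtain ⟨inj, surj⟩ := per_bijective_aux (A := A) o s le_rfl
  constructor
  · rw [injective_iff_map_eq_zero]
    intro x hx
    obtain ⟨⟨c, hc⟩, rfl⟩ := cls_surjective o q x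
    rw [homPer_cls] at hx
    obtain ⟨u, hu⟩ := inj q (sect R q c) (isRelCycle_sect o R hc) fun I => congrFun hx I
    refine (Submodule.Quotient.mk_eq_zero _).2 ⟨proj R (q + 1) u, ?_⟩
    rw [boundary_proj]
    have h1 := (mem_relSub_iff _).1 hu
    rw [map_sub, proj_sect, sub_eq_zero] at h1
    exact h1.symm
  · intro w
    obtain ⟨z, hz, hw⟩ := surj q w
    refine ⟨cls o R A q ⟨proj R q z, mem_cycles_of_isRelCycle o R hz⟩, ?_⟩
    rw [homPer_cls]
    ext I
    rw [cellPer_proj, hw]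

/-- The homology of the torus in terms of iterated periods. -/
def homEquiv (A : Type) [AddCommGroup A] [Module R A] (q : ℕ) :
    Homology o R A q ≃ₗ[R] (Idx g g q → A) :=
  LinearEquiv.ofBijective (homPer o s A q) (homPer_bijective o s q)

end CellHomology

end PolyhedralStructure

namespace PolyhedralStructure

variable {g : ℕ} {C : PolyhedralStructure g}

/-! ## Independence of the position -/

section Independence

variable (o : C.Orientation) {R : Type} {A : Type} [CommRing R] [AddCommGroup A] [Module R A]
  (s s' : Position C R)

theorem mulPos_sub_trans (j : Fin g) {q : ℕ} (n : Fin g → ℤ) (z : C.Lift q →₀ A) :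
    mulPos s j (trans R n z) - mulPos s' j (trans R n z) =
      trans R n (mulPos s j z - mulPos s' j z) := by
  rw [mulPos_trans, mulPos_trans, map_sub]
  abel

/-- The difference of two position operators commutes with translations, so on the torus it is an
honest homotopy between the two versions of `del`. Periods of cycles do not see it. -/
theorem per_eq_per {i q : ℕ} (I : Idx g i q) {z : C.Lift q →₀ A} (hz : IsRelCycle o R g z) :
    per o s I z = per o s' I z := by
  induction I with
  | nil => rfl
  | skip I ih => exact ih hz
  | @take i q h I ih =>
    rw [per_take, per_take, ← ih (hz.del o s' ⟨i, h⟩), ← sub_eq_zero, ← map_sub]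
    have h1 : del o s ⟨i, h⟩ q z - del o s' ⟨i, h⟩ q z =
        bdy o R A q (mulPos s ⟨i, h⟩ z - mulPos s' ⟨i, h⟩ z) -
          (mulPos s ⟨i, h⟩ (bdy o R A q z) - mulPos s' ⟨i, h⟩ (bdy o R A q z)) := by
      rw [del_apply, del_apply, map_sub]
      abel
    have hz' : bdy o R A q z ∈ relSub C R A g q := hz
    let Y : (C.Lift q →₀ A) →ₗ[R] (C.Lift q →₀ A) := mulPos s ⟨i, h⟩ - mulPos s' ⟨i, h⟩
    have h2 : Y (bdy o R A q z) ∈ relSub C R A g q :=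
      map_mem_relSub Y.toAddMonoidHom (fun n z => mulPos_sub_trans s s' ⟨i, h⟩ n z) hz'
    rw [h1, map_sub, per_bdy, zero_sub, neg_eq_zero]
    exact per_relSub o s I h2

end Independence

/-! ## Volume multivectors -/

section Volume

variable (o : C.Orientation) (m : C.Marking)

/-- The position given by a marking. -/
def markPosition (m : C.Marking) : Position C ℝ where
  x P := m.pt P
  x_vadd n P j := by rw [m.pt_vadd]; rfl

variable (A : Type) [AddCommGroup A] [Module ℝ A]

/-- Exterior multiplication with a basis vector. -/
def wedgeT (j : Fin g) (q : ℕ) :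
    (ExtPow ℝ q (Fin g → ℝ) ⊗[ℝ] A) →ₗ[ℝ] (ExtPow ℝ (q + 1) (Fin g → ℝ) ⊗[ℝ] A) :=
  (wedge ℝ q (basisVec ℝ j)).rTensor A

/-- Contraction with a coordinate form. -/
def contrT (j : Fin g) (q : ℕ) :
    (ExtPow ℝ (q + 1) (Fin g → ℝ) ⊗[ℝ] A) →ₗ[ℝ] (ExtPow ℝ q (Fin g → ℝ) ⊗[ℝ] A) :=
  (contrC ℝ j q).rTensor A

variable {A}

theorem contrT_wedgeT_zero (j k : Fin g) (x : ExtPow ℝ 0 (Fin g → ℝ) ⊗[ℝ] A) :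
    contrT A j 0 (wedgeT A k 0 x) = if j = k then x else 0 := by
  induction x using TensorProduct.induction_on with
  | zero => simp
  | add x y hx hy => rw [map_add, map_add, hx, hy]; split_ifs <;> simp
  | tmul x a =>
    rw [wedgeT, contrT, LinearMap.rTensor_tmul, LinearMap.rTensor_tmul, contrC, contr_wedge_zero,
      proj_basisVec]
    split_ifs <;> simp

theorem contrT_wedgeT (j k : Fin g) (q : ℕ) (x : ExtPow ℝ (q + 1) (Fin g → ℝ) ⊗[ℝ] A) :
    contrT A j (q + 1) (wedgeT A k (q + 1) x) =
      (if j = k then x else 0) - wedgeT A k q (contrT A j q x) := by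
  induction x using TensorProduct.induction_on with
  | zero => simp
  | add x y hx hy => simp only [map_add, hx, hy]; split_ifs <;> abel
  | tmul x a =>
    simp only [wedgeT, contrT, LinearMap.rTensor_tmul, contrC]
    rw [contr_wedge, proj_basisVec, TensorProduct.sub_tmul]
    split_ifs <;> simp

/-- Integration of constant differential forms over chains of the universal cover. -/
def volL (q : ℕ) : (C.Lift q →₀ A) →ₗ[ℝ] (ExtPow ℝ q (Fin g → ℝ) ⊗[ℝ] A) :=
  Finsupp.lsum ℝ fun P => TensorProduct.mk ℝ _ _ (vol o m P)

theorem volL_single (q : ℕ) (P : C.Lift q) (a : A) :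
    volL o m q (Finsupp.single P a) = vol o m P ⊗ₜ a := by
  rw [volL, Finsupp.lsum_single]
  rfl

theorem volL_zero (z : C.Lift 0 →₀ A) :
    volL o m 0 z = wedgeProd ℝ 0 ![] ⊗ₜ aug o ℝ A z := by
  induction z using Finsupp.induction_linear with
  | zero => simp
  | add a b ha hb => rw [map_add, map_add, TensorProduct.tmul_add, ha, hb]
  | single P a =>
    have h : vol o m P = eps o P • wedgeProd ℝ 0 ![] := by
      unfold vol eps
      split_ifs
      · rw [one_smul]
      · rw [neg_one_smul]
    rw [volL_single, aug_single, h, ← Int.cast_smul_eq_zsmul ℝ, ← Int.cast_smul_eq_zsmul ℝ,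
      TensorProduct.smul_tmul]

theorem sum_smul_wedge_basisVec (q : ℕ) (u : Fin g → ℝ) (w : ExtPow ℝ q (Fin g → ℝ)) :
    ∑ k, u k • wedge ℝ q (basisVec ℝ k) w = wedge ℝ q u w := by
  have hu : u = ∑ j, u j • basisVec ℝ j := by
    simpa [basisVec] using (pi_eq_sum_univ' u)
  conv_rhs => rw [hu]
  simp only [map_sum, LinearMap.sum_apply, map_smul, LinearMap.smul_apply]

/-- The decomposition into pyramids, written in coordinates: the vectors from `o_P` to the `o_Q`
are, up to sign, the coefficients of `del`. Invariance under translations and vanishing on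
boundaries are thereby inherited from `del`. -/
theorem volL_succ (q : ℕ) (z : C.Lift (q + 1) →₀ A) :
    volL o m (q + 1) z =
      -((q : ℝ) + 1)⁻¹ • ∑ k, wedgeT A k q (volL o m q (del o (markPosition m) k q z)) := by
  induction z using Finsupp.induction_linear with
  | zero => simp
  | add a b ha hb => simp only [map_add, Finset.sum_add_distrib, smul_add, ha, hb]
  | single P a =>
    have h1 : ∀ k, wedgeT A k q
        (volL o m q (del o (markPosition m) k q (Finsupp.single P a))) =
        ∑ Q : C.Facet P, o.sgn P Q.1 • (((m.pt P - m.pt Q.1) k •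
          wedge ℝ q (basisVec ℝ k) (vol o m Q.1)) ⊗ₜ[ℝ] a) := fun k => by
      rw [del_single, map_sum, map_sum]
      refine Finset.sum_congr rfl fun Q _ => ?_
      rw [map_zsmul, map_zsmul, map_smul, map_smul, volL_single, wedgeT, LinearMap.rTensor_tmul,
        TensorProduct.smul_tmul']
      rfl
    rw [volL_single, vol, finsum_eq_sum_of_fintype, Finset.sum_congr rfl fun k _ => h1 k,
      Finset.sum_comm, neg_smul, ← smul_neg, ← Finset.sum_neg_distrib, ← TensorProduct.smul_tmul',
      TensorProduct.sum_tmul]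
    congr 1
    refine Finset.sum_congr rfl fun Q _ => ?_
    rw [← Finset.smul_sum, ← TensorProduct.sum_tmul, sum_smul_wedge_basisVec, ← smul_neg,
      ← neg_sub, map_neg, LinearMap.neg_apply, smul_neg, TensorProduct.neg_tmul, smul_neg,
      ← Int.cast_smul_eq_zsmul ℝ, ← Int.cast_smul_eq_zsmul ℝ, TensorProduct.smul_tmul']

theorem volL_trans (q : ℕ) (n : Fin g → ℤ) (z : C.Lift q →₀ A) :
    volL o m q (trans ℝ n z) = volL o m q z := by
  induction q with
  | zero => rw [volL_zero, volL_zero, aug_trans]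
  | succ q ih => simp only [volL_succ, del_trans, ih]

theorem volL_bdy (q : ℕ) (z : C.Lift (q + 1) →₀ A) : volL o m q (bdy o ℝ A q z) = 0 := by
  induction q with
  | zero => rw [volL_zero, aug_bdy, TensorProduct.tmul_zero]
  | succ q ih => simp [volL_succ, del_bdy, ih]

theorem volL_relSub {i q : ℕ} {z : C.Lift q →₀ A} (hz : z ∈ relSub C ℝ A i q) :
    volL o m q z = 0 :=
  relSub_vanish (R := ℝ) (volL o m q).toAddMonoidHom (fun n _ z => volL_trans o m q n z) hz

/-- The commutator operators anticommute up to homotopy. -/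
theorem volL_del_del (j k : Fin g) (q : ℕ) {z : C.Lift (q + 2) →₀ A} {i : ℕ}
    (hz : IsRelCycle o ℝ i z) :
    volL o m q (del o (markPosition m) j q (del o (markPosition m) k (q + 1) z)) =
      -volL o m q (del o (markPosition m) k q (del o (markPosition m) j (q + 1) z)) := by
  set s := markPosition m
  -- The commutator of `del j` with the `k`-th position operator is equivariant, and it is the
  -- homotopy: the anticommutator of `del j` and `del k` is `-(∂σ + σ∂)`.
  let σ : ∀ q, (C.Lift (q + 1) →₀ A) →ₗ[ℝ] (C.Lift q →₀ A) := fun q =>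
    (del o s j q).comp (mulPos s k) - (mulPos s k).comp (del o s j q)
  have hσ : ∀ q y, σ q y = del o s j q (mulPos s k y) - mulPos s k (del o s j q y) :=
    fun _ _ => rfl
  have hσt : ∀ q n y, σ q (trans ℝ n y) = trans ℝ n (σ q y) := fun q n y => by
    rw [hσ, hσ, mulPos_trans, map_add, map_smul, del_trans, del_trans, mulPos_trans, map_sub]
    abel
  have h1 : del o s j q (del o s k (q + 1) z) + del o s k q (del o s j (q + 1) z) =
      -bdy o ℝ A q (σ (q + 1) z) - σ q (bdy o ℝ A (q + 1) z) := by
    have h0 : mulPos s k (bdy o ℝ A q (del o s j (q + 1) z)) =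
        -mulPos s k (del o s j q (bdy o ℝ A (q + 1) z)) := by rw [bdy_del, map_neg]
    rw [hσ, hσ, del_apply o s k, map_sub, del_bdy, del_apply o s k q, h0, map_sub]
    abel
  have h2 : volL o m q (σ q (bdy o ℝ A (q + 1) z)) = 0 :=
    volL_relSub o m (map_mem_relSub (σ q).toAddMonoidHom (hσt q) hz)
  rw [eq_neg_iff_add_eq_zero, ← map_add, h1, map_sub, map_neg, volL_bdy, h2, neg_zero, sub_zero]

/-- Contract the recursion of `volL_succ`. In the inductive step the antiderivation rule yields the
volume of `del j z` once. After the two commutators are exchanged, the other terms reassemble to `q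
+ 1` further copies of it, and the total of `q + 2` cancels the factor of the pyramids. -/
theorem contrT_volL (j : Fin g) (q : ℕ) {z : C.Lift (q + 1) →₀ A} {i : ℕ}
    (hz : IsRelCycle o ℝ i z) :
    contrT A j q (volL o m (q + 1) z) = -volL o m q (del o (markPosition m) j q z) := by
  induction q with
  | zero =>
    rw [volL_succ, map_smul, map_sum]
    simp only [contrT_wedgeT_zero]
    simp
  | succ q ih =>
    have h1 : ∀ k, contrT A j q (volL o m (q + 1) (del o (markPosition m) k (q + 1) z)) =
        volL o m q (del o (markPosition m) k q (del o (markPosition m) j (q + 1) z)) := fun k => by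
      rw [ih (hz.del o (markPosition m) k), volL_del_del o m j k q hz, neg_neg]
    have h2 : ∑ k, wedgeT A k q (volL o m q
        (del o (markPosition m) k q (del o (markPosition m) j (q + 1) z))) =
        -((q : ℝ) + 1) • volL o m (q + 1) (del o (markPosition m) j (q + 1) z) := by
      rw [volL_succ, smul_smul, neg_mul_neg, mul_inv_cancel₀ (by positivity), one_smul]
    rw [volL_succ, map_smul, map_sum]
    simp only [contrT_wedgeT, h1]
    rw [Finset.sum_sub_distrib, h2, Finset.sum_ite_eq]
    simp only [Finset.mem_univ, if_true]
    generalize volL o m (q + 1) (del o (markPosition m) j (q + 1) z) = v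
    rw [show v - -((q : ℝ) + 1) • v = ((q : ℝ) + 1 + 1) • v by module, smul_smul, Nat.cast_add,
      Nat.cast_one, neg_mul, inv_mul_cancel₀ (by positivity), neg_one_smul]

theorem thetaT_volL {i q : ℕ} (I : Idx g i q) {z : C.Lift q →₀ A} {i' : ℕ}
    (hz : IsRelCycle o ℝ i' z) : thetaT ℝ A I (volL o m q z) = per o (markPosition m) I z := by
  induction I with
  | nil =>
    rw [volL_zero, thetaT_tmul]
    simp only [theta, LinearEquiv.coe_coe]
    rw [extZero_wedgeProd, one_smul]
    rfl
  | skip I ih => exact ih hz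
  | @take i q h I ih =>
    have h1 : ∀ x, thetaT ℝ A (Idx.take h I) x = -thetaT ℝ A I (contrT A ⟨i, h⟩ q x) := fun x => by
      induction x using TensorProduct.induction_on with
      | zero => simp
      | add x y hx hy => simp only [map_add, hx, hy, neg_add]
      | tmul x a =>
        rw [contrT, LinearMap.rTensor_tmul, thetaT_tmul, thetaT_tmul, ← neg_smul]
        rfl
    rw [h1, contrT_volL o m ⟨i, h⟩ q hz, map_neg, neg_neg, ih (hz.del o _ _), per_take]

end Volume

end PolyhedralStructure

namespace PolyhedralStructure

variable {g : ℕ} {C : PolyhedralStructure g}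

/-! ## Change of coefficients -/

section Coefficients

section Additive

variable {A B : Type} [AddCommGroup A] [AddCommGroup B] (f : A →+ B)

/-- The map on chains of the universal cover induced by a map of coefficients. -/
def mapCoeff (q : ℕ) : (C.Lift q →₀ A) →+ (C.Lift q →₀ B) := Finsupp.mapRange.addMonoidHom f

theorem mapCoeff_single {q : ℕ} (P : C.Lift q) (a : A) :
    mapCoeff f q (Finsupp.single P a) = Finsupp.single P (f a) := by
  simp [mapCoeff]

theorem bdy_mapCoeff (o : C.Orientation) (R R' : Type) [CommRing R] [CommRing R'] [Module R A]
    [Module R' B] (q : ℕ) (z : C.Lift (q + 1) →₀ A) :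
    bdy o R' B q (mapCoeff f (q + 1) z) = mapCoeff f q (bdy o R A q z) := by
  induction z using Finsupp.induction_linear with
  | zero => simp
  | add a b ha hb => simp only [map_add, ha, hb]
  | single P a =>
    rw [mapCoeff_single, bdy_single, bdy_single, map_sum]
    refine Finset.sum_congr rfl fun Q _ => ?_
    rw [← mapCoeff_single]
    exact (map_zsmul (mapCoeff f q) _ _).symm

end Additive

variable (o : C.Orientation) {A B : Type} [AddCommGroup A] [AddCommGroup B] [Module ℝ B]
  (f : A →+ B)

theorem aug_mapCoeff (z : C.Lift 0 →₀ A) : aug o ℝ B (mapCoeff f 0 z) = f (aug o ℤ A z) := by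
  induction z using Finsupp.induction_linear with
  | zero => simp
  | add a b ha hb => simp only [map_add, ha, hb]
  | single P a =>
    rw [mapCoeff_single, aug_single, aug_single]
    exact (map_zsmul f _ _).symm

theorem mulPos_mapCoeff (j : Fin g) {q : ℕ} (z : C.Lift q →₀ A) :
    mulPos (coordPosition C ℝ) j (mapCoeff f q z) =
      mapCoeff f q (mulPos (coordPosition C ℤ) j z) := by
  induction z using Finsupp.induction_linear with
  | zero => simp
  | add a b ha hb => simp only [map_add, ha, hb]
  | single P a =>
    rw [mapCoeff_single, mulPos_single, mulPos_single, ← mapCoeff_single]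
    change ((coord P j : ℤ) : ℝ) • _ = mapCoeff f q (coord P j • _)
    rw [Int.cast_smul_eq_zsmul]
    exact (map_zsmul (mapCoeff f q) _ _).symm

/-- The positions relative to chosen lifts are integers, so the same periods exist over `ℤ`. This
makes the two identifications compatible. -/
theorem per_mapCoeff {i q : ℕ} (I : Idx g i q) (z : C.Lift q →₀ A) :
    per o (coordPosition C ℝ) I (mapCoeff f q z) = f (per o (coordPosition C ℤ) I z) := by
  induction I with
  | nil => exact aug_mapCoeff o f z
  | skip I ih => exact ih z
  | take h I ih =>
    rw [per_take, per_take, ← ih, del_apply, del_apply, map_sub, mulPos_mapCoeff,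
      bdy_mapCoeff f o ℤ ℝ, bdy_mapCoeff f o ℤ ℝ, mulPos_mapCoeff, ← map_sub, ← map_sub]

end Coefficients

/-! ## The monodromy operator -/

section MonodromyOperator

variable (o : C.Orientation) (m : C.Marking)

theorem mapRange_trans {A B : Type} [AddCommGroup A] [AddCommGroup B] [Module ℝ A] [Module ℝ B]
    (f : A →ₗ[ℝ] B) {q : ℕ} (n : Fin g → ℤ) (z : C.Lift q →₀ A) :
    Finsupp.mapRange.linearMap f (trans ℝ n z) = trans ℝ n (Finsupp.mapRange.linearMap f z) := by
  induction z using Finsupp.induction_linear with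
  | zero => simp
  | add a b ha hb => simp only [map_add, ha, hb]
  | single P a =>
    rw [trans_single, Finsupp.mapRange.linearMap_apply, Finsupp.mapRange.linearMap_apply,
      Finsupp.mapRange_single, Finsupp.mapRange_single, trans_single]

theorem bdy_mapRange {A B : Type} [AddCommGroup A] [AddCommGroup B] [Module ℝ A] [Module ℝ B]
    (f : A →ₗ[ℝ] B) (q : ℕ) (z : C.Lift (q + 1) →₀ A) :
    bdy o ℝ B q (Finsupp.mapRange.linearMap f z) =
      Finsupp.mapRange.linearMap f (bdy o ℝ A q z) :=
  bdy_mapCoeff f.toAddMonoidHom o ℝ ℝ q z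

theorem volL_mapRange {A B : Type} [AddCommGroup A] [AddCommGroup B] [Module ℝ A] [Module ℝ B]
    (f : A →ₗ[ℝ] B) (q : ℕ) (z : C.Lift q →₀ A) :
    volL o m q (Finsupp.mapRange.linearMap f z) = f.lTensor _ (volL o m q z) := by
  induction z using Finsupp.induction_linear with
  | zero => simp
  | add a b ha hb => simp only [map_add, ha, hb]
  | single P a =>
    rw [Finsupp.mapRange.linearMap_apply, Finsupp.mapRange_single, volL_single, volL_single,
      LinearMap.lTensor_tmul]

/-- The monodromy operator on chains of the universal cover. -/
def liftN (p q : ℕ) :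
    (C.Lift (q + 1) →₀ ExtPow ℝ p (Fin g → ℝ)) →ₗ[ℝ] (C.Lift q →₀ ExtPow ℝ (p + 1) (Fin g → ℝ)) :=
  ∑ j, (Finsupp.mapRange.linearMap (wedge ℝ p (basisVec ℝ j))).comp (del o (markPosition m) j q)

theorem liftN_apply (p q : ℕ) (z : C.Lift (q + 1) →₀ ExtPow ℝ p (Fin g → ℝ)) :
    liftN o m p q z = ∑ j, Finsupp.mapRange.linearMap (wedge ℝ p (basisVec ℝ j))
      (del o (markPosition m) j q z) := by
  rw [liftN, LinearMap.sum_apply]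
  rfl

theorem liftN_single (p q : ℕ) (P : C.Lift (q + 1)) (v : ExtPow ℝ p (Fin g → ℝ)) :
    liftN o m p q (Finsupp.single P v) = ∑ Q : C.Facet P, o.sgn P Q.1 •
      Finsupp.single Q.1 (wedge ℝ p (m.pt P - m.pt Q.1) v) := by
  have h1 : ∀ j, Finsupp.mapRange.linearMap (wedge ℝ p (basisVec ℝ j))
      (del o (markPosition m) j q (Finsupp.single P v)) = ∑ Q : C.Facet P, o.sgn P Q.1 •
        Finsupp.single Q.1 ((m.pt P - m.pt Q.1) j • wedge ℝ p (basisVec ℝ j) v) := fun j => by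
    rw [del_single, map_sum]
    refine Finset.sum_congr rfl fun Q _ => ?_
    rw [map_zsmul, map_smul, Finsupp.mapRange.linearMap_apply, Finsupp.mapRange_single,
      Finsupp.smul_single]
    rfl
  rw [liftN_apply, Finset.sum_congr rfl fun j _ => h1 j, Finset.sum_comm]
  refine Finset.sum_congr rfl fun Q _ => ?_
  rw [← Finset.smul_sum, ← sum_smul_wedge_basisVec]
  congr 1
  exact (map_sum (Finsupp.singleAddHom Q.1) _ _).symm

theorem liftN_trans (p q : ℕ) (n : Fin g → ℤ) (z : C.Lift (q + 1) →₀ ExtPow ℝ p (Fin g → ℝ)) :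
    liftN o m p q (trans ℝ n z) = trans ℝ n (liftN o m p q z) := by
  simp only [liftN_apply, del_trans, mapRange_trans, map_sum]

theorem bdy_liftN (p q : ℕ) (z : C.Lift (q + 2) →₀ ExtPow ℝ p (Fin g → ℝ)) :
    bdy o ℝ _ q (liftN o m p (q + 1) z) = -liftN o m p q (bdy o ℝ _ (q + 1) z) := by
  simp only [liftN_apply, map_sum, bdy_mapRange, bdy_del, map_neg, Finset.sum_neg_distrib]

theorem chainN_single (p q : ℕ) (P : C.Cell (q + 1)) (v : ExtPow ℝ p (Fin g → ℝ)) :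
    chainN o m p q (Finsupp.single P v) =
      proj ℝ q (liftN o m p q (Finsupp.single (C.someLift P) v)) := by
  rw [chainN, Finsupp.lsum_single, finsum_eq_sum_of_fintype, LinearMap.sum_apply, liftN_single,
    map_sum]
  refine Finset.sum_congr rfl fun Q _ => ?_
  rw [map_zsmul, proj_single]
  rfl

theorem chainN_proj (p q : ℕ) (z : C.Lift (q + 1) →₀ ExtPow ℝ p (Fin g → ℝ)) :
    chainN o m p q (proj ℝ (q + 1) z) = proj ℝ q (liftN o m p q z) := by
  induction z using Finsupp.induction_linear with
  | zero => simp
  | add a b ha hb => simp only [map_add, ha, hb]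
  | single P a =>
    rw [proj_single, chainN_single]
    nth_rewrite 2 [← coord_spec P]
    rw [← trans_single (R := ℝ), liftN_trans, proj_trans]

theorem boundary_chainN (p q : ℕ) (c : C.Cell (q + 2) →₀ ExtPow ℝ p (Fin g → ℝ)) :
    boundary o ℝ _ q (chainN o m p (q + 1) c) = -chainN o m p q (boundary o ℝ _ (q + 1) c) := by
  rw [← proj_sect (R := ℝ) c, chainN_proj, boundary_proj, bdy_liftN, boundary_proj, chainN_proj,
    map_neg]

theorem descends (p q : ℕ) : Descends o m p q := by
  constructor
  · intro z hz
    cases q with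
    | zero => exact Submodule.mem_top
    | succ q =>
      have hz' : boundary o ℝ _ (q + 1) z = 0 := hz
      change boundary o ℝ _ q _ = 0
      rw [boundary_chainN, hz', map_zero, neg_zero]
  · rintro _ ⟨c, rfl⟩
    exact ⟨-chainN o m p (q + 1) c, by rw [map_neg, boundary_chainN, neg_neg]⟩

theorem N_cls (p q : ℕ) (z : cycles o ℝ (ExtPow ℝ p (Fin g → ℝ)) (q + 1)) :
    N o m p q (cls o ℝ _ (q + 1) z) =
      cls o ℝ _ q ⟨chainN o m p q z.1, (descends o m p q).1 z.1 z.2⟩ := by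
  have h : N o m p q = _ := dif_pos (descends o m p q)
  exact LinearMap.congr_fun h _

theorem period_eq (p q : ℕ) (c : C.Cell q →₀ ExtPow ℝ p (Fin g → ℝ)) :
    period o m p q c = volL o m q (sect ℝ q c) := by
  induction c using Finsupp.induction_linear with
  | zero => simp
  | add a b ha hb => simp only [map_add, ha, hb]
  | single P a =>
    rw [sect_single, volL_single, period, Finsupp.lsum_single]
    rfl

theorem period_proj (p q : ℕ) (z : C.Lift q →₀ ExtPow ℝ p (Fin g → ℝ)) :
    period o m p q (proj ℝ q z) = volL o m q z := by
  rw [period_eq]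
  exact invariant_sect (R := ℝ) (volL o m q).toAddMonoidHom (fun n z => volL_trans o m q n z) z

/-- Direction by direction: `e_j ∧` acts on the coefficients only, and on volumes of cycles `del j`
is minus the contraction. That sign is the one in `phiReal_eq_sum`. -/
theorem period_chainN (p q : ℕ) {c : C.Cell (q + 1) →₀ ExtPow ℝ p (Fin g → ℝ)}
    (hc : c ∈ cycles o ℝ (ExtPow ℝ p (Fin g → ℝ)) (q + 1)) :
    period o m (p + 1) q (chainN o m p q c) =
      phiReal ℝ p q (Fin g → ℝ) (period o m p (q + 1) c) := by
  have hz := isRelCycle_sect o ℝ hc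
  have h1 : ∀ (j : Fin g) (x : ExtPow ℝ (q + 1) (Fin g → ℝ) ⊗[ℝ] ExtPow ℝ p (Fin g → ℝ)),
      TensorProduct.map (contrC ℝ j q) (wedge ℝ p (basisVec ℝ j)) x =
        (wedge ℝ p (basisVec ℝ j)).lTensor (ExtPow ℝ q (Fin g → ℝ)) (contrT _ j q x) :=
      fun j x => by
    rw [contrT, ← LinearMap.comp_apply, LinearMap.lTensor_comp_rTensor]
  rw [← proj_sect (R := ℝ) c, chainN_proj, period_proj, period_proj, liftN_apply, map_sum,
    phiReal_eq_sum, ← Finset.sum_neg_distrib]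
  refine Finset.sum_congr rfl fun j _ => ?_
  rw [volL_mapRange, h1, contrT_volL o m j q hz, map_neg, neg_neg]

end MonodromyOperator

/-! ## The identifications -/

section Identification

variable (o : C.Orientation)

/-- The identification of the real tropical homology. -/
def realIso (p q : ℕ) : HR o p q ≃ₗ[ℝ] (ExtPow ℝ q (Fin g → ℝ) ⊗[ℝ] ExtPow ℝ p (Fin g → ℝ)) :=
  (homEquiv o (coordPosition C ℝ) (ExtPow ℝ p (Fin g → ℝ)) q).trans (thetaEquiv ℝ g q _).symm

/-- The identification of the integral tropical homology. -/
def intIso (L : Submodule ℤ (Fin g → ℝ)) (p q : ℕ) :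
    HZ o L p q ≃ₗ[ℤ] (ExtPow ℤ q (Fin g → ℤ) ⊗[ℤ] ExtPow ℤ p L) :=
  (homEquiv o (coordPosition C ℤ) (ExtPow ℤ p L) q).trans (thetaZ g q _).symm

theorem thetaEquiv_realIso (p q : ℕ) (z : cycles o ℝ (ExtPow ℝ p (Fin g → ℝ)) q) :
    thetaEquiv ℝ g q _ (realIso o p q (cls o ℝ _ q z)) =
      cellPer o (coordPosition C ℝ) (ExtPow ℝ p (Fin g → ℝ)) q z.1 :=
  (thetaEquiv ℝ g q _).apply_symm_apply _

theorem thetaZ_intIso (L : Submodule ℤ (Fin g → ℝ)) (p q : ℕ)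
    (z : cycles o ℤ (ExtPow ℤ p L) q) :
    thetaZ g q (ExtPow ℤ p L) (intIso o L p q (cls o ℤ _ q z)) =
      cellPer o (coordPosition C ℤ) (ExtPow ℤ p L) q z.1 :=
  (thetaZ g q (ExtPow ℤ p L)).apply_symm_apply _

/-- In coordinates both sides are iterated periods of the same cycle, one for the integral positions
and one for the marked points. -/
theorem realIso_cls (m : C.Marking) (p q : ℕ) (z : cycles o ℝ (ExtPow ℝ p (Fin g → ℝ)) q) :
    realIso o p q (cls o ℝ _ q z) = period o m p q z := by
  apply (thetaEquiv ℝ g q _).injective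
  have hz := isRelCycle_sect o ℝ z.2
  rw [thetaEquiv_realIso]
  ext1 I
  rw [thetaEquiv_apply, period_eq, thetaT_volL o m I hz]
  exact per_eq_per o _ _ I hz

theorem realIso_toReal (L : Submodule ℤ (Fin g → ℝ)) (p q : ℕ) (x : HZ o L p q) :
    realIso o p q (toReal o L p q x) = tensorToReal L p q (intIso o L p q x) := by
  obtain ⟨z, rfl⟩ := cls_surjective o q x
  apply (thetaEquiv ℝ g q _).injective
  rw [toReal_cls, thetaEquiv_realIso]
  ext1 I
  rw [thetaEquiv_apply, thetaT_tensorToReal, thetaZ_intIso]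
  have h1 : ∀ c : C.Cell q →₀ ExtPow ℤ p L, sect ℝ q (chainToReal L p q c) =
      mapCoeff (extPowMap L.subtype p) q (sect ℤ q c) := fun c => by
    induction c using Finsupp.induction_linear with
    | zero => simp
    | add a b ha hb => simp only [map_add, ha, hb]
    | single P a =>
      rw [sect_single, mapCoeff_single, ← sect_single (R := ℝ)]
      simp [chainToReal]
  change per o (coordPosition C ℝ) I (sect ℝ q (chainToReal L p q z.1)) = _
  rw [h1]
  exact per_mapCoeff o _ I _

theorem realIso_N (m : C.Marking) (p q : ℕ) (x : HR o p (q + 1)) :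
    realIso o (p + 1) q (N o m p q x) = phiReal ℝ p q (Fin g → ℝ) (realIso o p (q + 1) x) := by
  obtain ⟨z, rfl⟩ := cls_surjective o (q + 1) x
  rw [N_cls, realIso_cls o m, realIso_cls o m]
  exact period_chainN o m p q z.2

theorem iterate_comm {M M' : ℕ → ℕ → Type} [∀ p q, AddCommMonoid (M p q)]
    [∀ p q, AddCommMonoid (M' p q)] [∀ p q, Module ℝ (M p q)] [∀ p q, Module ℝ (M' p q)]
    (F : ∀ p q, M p (q + 1) →ₗ[ℝ] M (p + 1) q) (F' : ∀ p q, M' p (q + 1) →ₗ[ℝ] M' (p + 1) q)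
    (Φ : ∀ p q, M p q ≃ₗ[ℝ] M' p q)
    (h : ∀ p q x, Φ (p + 1) q (F p q x) = F' p q (Φ p (q + 1) x)) (k : ℕ) :
    ∀ {p q p' q' : ℕ} (hp : p + k = p') (hq : q' + k = q) (x : M p q),
      Φ p' q' (iterate F k hp hq x) = iterate F' k hp hq (Φ p q x) := by
  induction k with
  | zero => rintro p q p' q' rfl rfl x; rfl
  | succ k ih =>
    rintro p q p' q' hp rfl x
    simp only [iterate, LinearMap.comp_apply]
    rw [ih, h]
    rfl

theorem map_latticeL (m : C.Marking) (L : Submodule ℤ (Fin g → ℝ)) {p q k : ℕ} (h : q + k = p) :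
    (latticeL o m L h).map (realIso o p q).toAddEquiv.toAddMonoidHom = (phiIter L k h h).range := by
  have key : ∀ x, realIso o p q (iterate (R := ℝ) (M := fun p q => HR o p q) (N o m) k h h
      (toReal o L q p x)) = phiIter L k h h (intIso o L q p x) := fun x => by
    rw [iterate_comm (M := fun p q => HR o p q)
      (M' := fun p q => ExtPow ℝ q (Fin g → ℝ) ⊗[ℝ] ExtPow ℝ p (Fin g → ℝ)) (N o m)
      (fun p q => phiReal ℝ p q (Fin g → ℝ)) (realIso o) (realIso_N o m) k h h, realIso_toReal]
    rfl
  ext y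
  constructor
  · rintro ⟨_, ⟨x, rfl⟩, rfl⟩
    exact ⟨_, (key x).symm⟩
  · rintro ⟨y, rfl⟩
    refine ⟨_, ⟨(intIso o L q p).symm y, rfl⟩, ?_⟩
    exact (key _).trans (by rw [LinearEquiv.apply_symm_apply])

end Identification

end PolyhedralStructure

end

end TropTorus

open TropTorus PolyhedralStructure in
theorem mainTheorem7 (g : ℕ) (L : Submodule ℤ (Fin g → ℝ)) [DiscreteTopology L] [IsZLattice ℝ L]
    (C : PolyhedralStructure g) (o : C.Orientation) :
    -- the identifications of tropical homology, which depend on no marking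
    ∃ (ΦZ : ∀ p q : ℕ, HZ o L p q ≃ₗ[ℤ] (ExtPow ℤ q (Fin g → ℤ) ⊗[ℤ] ExtPow ℤ p L))
      (ΦR : ∀ p q : ℕ, HR o p q ≃ₗ[ℝ] (ExtPow ℝ q (Fin g → ℝ) ⊗[ℝ] ExtPow ℝ p (Fin g → ℝ))),
      (∀ (p q : ℕ) (x : HZ o L p q), ΦR p q (toReal o L p q x) = tensorToReal L p q (ΦZ p q x)) ∧
      ∀ m : C.Marking,
        -- they are the canonical ones
        (∀ (p q : ℕ) (z : cycles o ℝ (ExtPow ℝ p (Fin g → ℝ)) q),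
          ΦR p q (cls o ℝ (ExtPow ℝ p (Fin g → ℝ)) q z) = period o m p q z) ∧
        -- the monodromy operator is well defined on homology
        (∀ p q : ℕ, Descends o m p q) ∧
        -- the diagram commutes
        (∀ (p q : ℕ) (x : HZ o L p (q + 1)),
          ΦR (p + 1) q (N o m p q (toReal o L p (q + 1) x)) = phi L p q (ΦZ p (q + 1) x)) ∧
        -- the intermediate Jacobian
        (∀ (p q k : ℕ) (h : q + k = p),
          ∃ e : JH o m L h ≃+
              ((ExtPow ℝ q (Fin g → ℝ) ⊗[ℝ] ExtPow ℝ p (Fin g → ℝ)) ⧸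
                (phiIter L k h h).range),
            ∀ x : HR o p q,
              e (QuotientAddGroup.mk' (latticeL o m L h) x) =
                QuotientAddGroup.mk' (phiIter L k h h).range (ΦR p q x)) := by
  refine ⟨intIso o L, realIso o, realIso_toReal o L, fun m => ⟨realIso_cls o m, descends o m,
    fun p q x => ?_, fun p q k h => ?_⟩⟩
  · rw [realIso_N, realIso_toReal]
    rfl
  · exact ⟨QuotientAddGroup.congr _ _ (realIso o p q).toAddEquiv (map_latticeL o m L h),
      fun x => rfl⟩
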